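/- Conventions. All sequences $\alpha=(\alpha_1,\alpha_2,\dots)$ are sequences of non-negative integers with finite support; $|\alpha|=\sum_i\alpha_i$ and $\alpha!=\prod_i\alpha_i!$. A *floor diagram* $\mathcal D$ of degree $d$ is a directed graph on the vertices $1,\dots,d$, possibly with multiple edges and possibly disconnected, with positive integral edge weights $w(e)$, such that every edge $i\to j$ has $i<j$, and such that $\mathrm{div}(j):=\sum_{e:\,j\to k}w(e)-\sum_{e:\,i\to j}w(e)\le 1$ for every vertex $j$. The cogenus of a connected floor diagram of degree $d$ and genus (first Betti number) $g$ is $\frac{(d-1)(d-2)}2-g$. If $\mathcal D$ has connected components of degrees $d_1,d_2,\dots$ and cogenera $\delta_1,\delta_2,\dots$, its cogenus is $\sum_j\delta_j+\sum_{j<j'}d_jd_{j'}$. Put $\mu(\mathcal D)=\prod_e w(e)^2$. Let $\alpha,\beta$ be sequences and let $\mathcal D$ have degree $d=\sum_{i\ge1} i(\alpha_i+\beta_i)$. An $(\alpha,\beta)$-*marking* of $\mathcal D$ is obtained as follows. Choose sequences $\alpha^i,\beta^i$ for each vertex $i$ of $\mathcal D$ with $\sum_i\alpha^i=\alpha$,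 $\sum_i\beta^i=\beta$ and $\sum_{j\ge1} j(\alpha^i_j+\beta^i_j)=1-\mathrm{div}(i)$ for all $i$. For all $i$ and $j$, attach to the vertex $i$, by edges of weight $j$ directed away from $i$, $\beta^i_j$ new "$\beta$-vertices" and $\alpha^i_j$ new "$\alpha$-vertices". Subdivide each original edge of $\mathcal D$ by a midpoint, both halves keeping its weight and direction. Finally choose a linear order on all vertices that extends the order of the vertices of $\mathcal D$, along which all edges increase, and in which the $\alpha$-vertices are the largest vertices and are ordered weakly increasingly by the weights of their edges. Two markings are equivalent if there is an isomorphism of weighted directed graphs that fixes the vertices of $\mathcal D$ and carries one linear order to the other. Let $\nu_{\alpha,\beta}(\mathcal D)$ be the number of equivalence classes. The relative Severi degree, in its combinatorial description, is $$N^\delta_{\alpha,\beta}=\sum_{\mathcal D}1^{\beta_1}2^{\beta_2}\cdots\,\mu(\mathcal D)\,\nu_{\alpha,\beta}(\mathcal D),$$ where $\mathcal D$ runs over all floor diagrams of degree $d=\sum_{i\ge1} i(\alpha_i+\beta_i)$ and cogenus $\delta$. For $\delta\ge1$, $m\ge0$ and $n\ge1$, the *relative node polynomial* $N_\delta(\alpha_1,\dots,\alpha_m;\beta_1,\dots,\beta_n)$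 is the polynomial with rational coefficients such that $$N^\delta_{\alpha,\beta}=1^{\beta_1}2^{\beta_2}\cdots\frac{(|\beta|-\delta)!}{\beta!}\,N_\delta(\alpha_1,\dots,\alpha_m;\beta_1,\dots,\beta_n)$$ for all non-negative integers $\alpha_1,\dots,\alpha_m,\beta_1,\dots,\beta_n$ with $|\beta|\ge\delta$ (further entries of $\alpha$ and $\beta$ being $0$). **Proposition.** Let $\delta\ge1$. The relative node polynomial $N_\delta(\alpha;\beta)$ is a polynomial in $d=\sum_{i\ge1} i(\alpha_i+\beta_i)$, $|\beta|$, $\alpha_1,\dots,\alpha_\delta$ and $\beta_1,\dots,\beta_\delta$. Precisely: there is a polynomial $R$ with rational coefficients in $2+2\delta$ variables such that, for all $m\ge0$ and $n\ge1$, a relative node polynomial in $\alpha_1,\dots,\alpha_m,\beta_1,\dots,\beta_n$ exists, is unique, and is equal, as a polynomial, to $$N_\delta(\alpha;\beta)=R\big(d,\,|\beta|,\,\alpha_1,\dots,\alpha_\delta,\,\beta_1,\dots,\beta_\delta\big),$$ where $\alpha_i=0$ for $i>m$ and $\beta_i=0$ for $i>n$. -/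

import Mathlib

open scoped Nat

noncomputable section

/-- A sequence `(s₁, s₂, …)` of non-negative integers with finite support, indexed from `1`. -/
abbrev TangencySeq : Type := ℕ+ →₀ ℕ

namespace TangencySeq

/-- `|s| = s₁ + s₂ + ⋯`. -/
def size (s : TangencySeq) : ℕ := s.sum fun _ a => a

/-- `∑ i * sᵢ`. -/
def weight (s : TangencySeq) : ℕ := s.sum fun i a => (i : ℕ) * a

/-- `s! = s₁! * s₂! * ⋯`. -/
def fact (s : TangencySeq) : ℕ := s.prod fun _ a => a !

/-- `1 ^ s₁ * 2 ^ s₂ * ⋯`. -/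
def powProd (s : TangencySeq) : ℕ := s.prod fun i a => (i : ℕ) ^ a

/-- The sequence `(a₁, …, aₘ, 0, 0, …)`; the entry of index `i : Fin m` sits in place `i + 1`. -/
def ofFin {m : ℕ} (a : Fin m → ℕ) : TangencySeq :=
  ∑ i : Fin m, Finsupp.single (Nat.succPNat i) (a i)

end TangencySeq

/-- The divergence at `j` of a weighted directed multigraph on `{1, …, d}`, given as a multiset
of edges `(source, target, weight)`: total outgoing weight minus total incoming weight. -/
def edgeDivergence {d : ℕ} (E : Multiset (Fin d × Fin d × ℕ+)) (j : Fin d) : ℤ :=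
  ((E.filter fun e => e.1 = j).map fun e => ((e.2.2 : ℕ) : ℤ)).sum -
    ((E.filter fun e => e.2.1 = j).map fun e => ((e.2.2 : ℕ) : ℤ)).sum

/-- A (possibly disconnected) floor diagram of degree `d`: a directed multigraph on the `d`
ordered vertices, with positive integral edge weights, whose edges go from smaller to larger
vertices and all of whose divergences are at most `1`. -/
@[ext]
structure FloorDiagram (d : ℕ) where
  edges : Multiset (Fin d × Fin d × ℕ+)
  source_lt_target : ∀ e ∈ edges, e.1 < e.2.1
  divergence_le_one : ∀ j, edgeDivergence edges j ≤ 1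

namespace FloorDiagram

variable {d : ℕ}

/-- The divergence of the vertex `j`. -/
def div (D : FloorDiagram d) (j : Fin d) : ℤ := edgeDivergence D.edges j

/-- The multiplicity: the product of the squares of the edge weights. -/
def multiplicity (D : FloorDiagram d) : ℕ := (D.edges.map fun e => (e.2.2 : ℕ) ^ 2).prod

/-- The underlying simple graph (orientations, weights and multiplicities of edges forgotten);
it has the same connected components as the floor diagram. -/
def graph (D : FloorDiagram d) : SimpleGraph (Fin d) :=
  SimpleGraph.fromRel fun i j => ∃ w, (i, j, w) ∈ D.edges

/-- The degree of a connected component: its number of vertices. -/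
def compDegree (D : FloorDiagram d) (C : D.graph.ConnectedComponent) : ℕ := C.supp.ncard

open Classical in
/-- The number of edges (with multiplicity) of a connected component. -/
def compEdges (D : FloorDiagram d) (C : D.graph.ConnectedComponent) : ℕ :=
  (D.edges.filter fun e => D.graph.connectedComponentMk e.1 = C).card

/-- The genus (first Betti number) of a connected component. -/
def compGenus (D : FloorDiagram d) (C : D.graph.ConnectedComponent) : ℤ :=
  (D.compEdges C : ℤ) - D.compDegree C + 1

/-- The cogenus `(d' - 1) (d' - 2) / 2 - g'` of a connected component of degree `d'` and
genus `g'`; the division is exact. -/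
def compCogenus (D : FloorDiagram d) (C : D.graph.ConnectedComponent) : ℤ :=
  ((D.compDegree C : ℤ) - 1) * ((D.compDegree C : ℤ) - 2) / 2 - D.compGenus C

open Classical in
/-- The cogenus: the sum of the cogenera of the connected components, plus the sum of the
products of degrees over all (unordered) pairs of distinct components. -/
def cogenus (D : FloorDiagram d) : ℤ :=
  ∑ C : D.graph.ConnectedComponent, D.compCogenus C +
    ∑ S ∈ (Finset.univ : Finset D.graph.ConnectedComponent).powersetCard 2,
      ∏ C ∈ S, (D.compDegree C : ℤ)

/-- A pair of collections of sequences `({αⁱ}, {βⁱ})` compatible with `D` and `(α, β)`. -/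
@[ext]
structure CompatiblePair (D : FloorDiagram d) (α β : TangencySeq) where
  a : Fin d → TangencySeq
  b : Fin d → TangencySeq
  sum_a : ∑ i, a i = α
  sum_b : ∑ i, b i = β
  weight_eq : ∀ i, (((a i).weight + (b i).weight : ℕ) : ℤ) = 1 - D.div i

/-- The vertices of the extended graph of a floor diagram with a compatible pair: the vertices of
the floor diagram, one midpoint for each of its edges, and, for each vertex `i` and `j ≥ 1`,
`βⁱⱼ` many `β`-vertices and `αⁱⱼ` many `α`-vertices. -/
inductive ExtVertex {D : FloorDiagram d} {α β : TangencySeq} (p : CompatiblePair D α β) : Type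
  | floor (i : Fin d) : ExtVertex p
  | mid (e : D.edges.ToType) : ExtVertex p
  | beta (i : Fin d) (j : ℕ+) (k : Fin (p.b i j)) : ExtVertex p
  | alpha (i : Fin d) (j : ℕ+) (k : Fin (p.a i j)) : ExtVertex p

/-- `ExtEdge p u v w`: there is an edge of weight `w` from `u` to `v` in the extended graph. -/
inductive ExtEdge {D : FloorDiagram d} {α β : TangencySeq} (p : CompatiblePair D α β) :
    ExtVertex p → ExtVertex p → ℕ+ → Prop
  | toMid (e : D.edges.ToType) : ExtEdge p (.floor e.1.1) (.mid e) e.1.2.2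
  | fromMid (e : D.edges.ToType) : ExtEdge p (.mid e) (.floor e.1.2.1) e.1.2.2
  | toBeta (i : Fin d) (j : ℕ+) (k : Fin (p.b i j)) : ExtEdge p (.floor i) (.beta i j k) j
  | toAlpha (i : Fin d) (j : ℕ+) (k : Fin (p.a i j)) : ExtEdge p (.floor i) (.alpha i j k) j

/-- Being an `α`-vertex. -/
def ExtVertex.IsAlpha {D : FloorDiagram d} {α β : TangencySeq} {p : CompatiblePair D α β}
    (v : ExtVertex p) : Prop := ∃ i j k, v = .alpha i j k

/-- An `(α, β)`-marking of the floor diagram `D`: a compatible pair and a linear order on the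
vertices of the extended graph which extends the order of the vertices of `D`, along which all
edges increase, for which the `α`-vertices are the largest vertices, and are ordered weakly
increasingly by the weights of their edges. -/
structure Marking (D : FloorDiagram d) (α β : TangencySeq) where
  pair : CompatiblePair D α β
  lt : ExtVertex pair → ExtVertex pair → Prop
  isStrictTotalOrder : IsStrictTotalOrder (ExtVertex pair) lt
  floor_lt_floor : ∀ i j : Fin d, i < j → lt (.floor i) (.floor j)
  lt_of_edge : ∀ u v w, ExtEdge pair u v w → lt u v
  lt_of_isAlpha : ∀ u v, ¬ u.IsAlpha → v.IsAlpha → lt u v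
  weight_le_weight : ∀ i j k i' j' k', lt (.alpha i j k) (.alpha i' j' k') → j ≤ j'

/-- Two markings are equivalent if there is an isomorphism of the weighted directed extended
graphs, fixing the vertices of `D`, that carries one linear order to the other. -/
def Marking.Equivalent {D : FloorDiagram d} {α β : TangencySeq} (M N : Marking D α β) : Prop :=
  ∃ f : ExtVertex M.pair ≃ ExtVertex N.pair,
    (∀ i, f (.floor i) = .floor i) ∧
    (∀ u v w, ExtEdge M.pair u v w ↔ ExtEdge N.pair (f u) (f v) w) ∧
    (∀ u v, M.lt u v ↔ N.lt (f u) (f v))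

/-- Equivalence of markings is an equivalence relation. -/
def markingSetoid (D : FloorDiagram d) (α β : TangencySeq) : Setoid (Marking D α β) where
  r := Marking.Equivalent
  iseqv :=
    { refl := fun M => ⟨Equiv.refl _, by simp, by simp, by simp⟩
      symm := by
        rintro M N ⟨f, h1, h2, h3⟩
        refine ⟨f.symm, fun i => ?_, fun u v w => ?_, fun u v => ?_⟩
        · rw [← h1 i, f.symm_apply_apply]
        · rw [h2, f.apply_symm_apply, f.apply_symm_apply]
        · rw [h3, f.apply_symm_apply, f.apply_symm_apply]
      trans := by
        rintro M N K ⟨f, h1, h2, h3⟩ ⟨g, k1, k2, k3⟩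
        refine ⟨f.trans g, fun i => ?_, fun u v w => ?_, fun u v => ?_⟩
        · rw [Equiv.trans_apply, h1, k1]
        · rw [h2, k2]; rfl
        · rw [h3, k3]; rfl }

/-- The number `ν_{α,β}(D)` of `(α, β)`-markings of `D` up to equivalence. -/
def numMarkings (D : FloorDiagram d) (α β : TangencySeq) : ℕ :=
  Nat.card (Quotient (markingSetoid D α β))

end FloorDiagram

/-- The relative Severi degree `N^δ_{α,β}`, in its combinatorial description: the sum of
`1 ^ β₁ * 2 ^ β₂ * ⋯ * μ(D) * ν_{α,β}(D)` over the (finitely many) floor diagrams `D` of degree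
`d = ∑ i * (αᵢ + βᵢ)` and cogenus `δ`. -/
def relativeSeveriDegree (δ : ℕ) (α β : TangencySeq) : ℕ :=
  ∑ᶠ D ∈ {D : FloorDiagram (α.weight + β.weight) | D.cogenus = (δ : ℤ)},
    β.powProd * D.multiplicity * D.numMarkings α β

/-- `P`, a polynomial in `α₁, …, αₘ` and `β₁, …, βₙ`, is the relative node polynomial
`N_δ(α₁, …, αₘ; β₁, …, βₙ)`: it computes all relative Severi degrees with `|β| ≥ δ`, through
`N^δ_{α,β} = 1 ^ β₁ * 2 ^ β₂ * ⋯ * (|β| - δ)! / β! * N_δ(α; β)`. -/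
def IsRelativeNodePolynomial (δ m n : ℕ) (P : MvPolynomial (Fin m ⊕ Fin n) ℚ) : Prop :=
  ∀ (a : Fin m → ℕ) (b : Fin n → ℕ), δ ≤ (TangencySeq.ofFin b).size →
    (relativeSeveriDegree δ (TangencySeq.ofFin a) (TangencySeq.ofFin b) : ℚ) =
      (TangencySeq.ofFin b).powProd *
        ((((TangencySeq.ofFin b).size - δ)! : ℕ) : ℚ) / ((TangencySeq.ofFin b).fact : ℚ) *
        MvPolynomial.eval (Sum.elim (fun i => (a i : ℚ)) (fun i => (b i : ℚ))) P

/-- Names for the quantities `d`, `|β|`, `α₁, …, α_δ` and `β₁, …, β_δ`. -/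
inductive NodeVar (δ : ℕ) : Type
  | degree : NodeVar δ
  | size : NodeVar δ
  | alpha (i : Fin δ) : NodeVar δ
  | beta (i : Fin δ) : NodeVar δ

/-- The quantities `d = ∑ i * (αᵢ + βᵢ)`, `|β|`, `α₁, …, α_δ`, `β₁, …, β_δ` as polynomials in
`α₁, …, αₘ, β₁, …, βₙ`, where `αᵢ = 0` for `i > m` and `βᵢ = 0` for `i > n`. -/
def NodeVar.toPoly {δ : ℕ} (m n : ℕ) : NodeVar δ → MvPolynomial (Fin m ⊕ Fin n) ℚ
  | .degree => ∑ i : Fin m, MvPolynomial.C ((i : ℚ) + 1) * MvPolynomial.X (Sum.inl i) +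
      ∑ i : Fin n, MvPolynomial.C ((i : ℚ) + 1) * MvPolynomial.X (Sum.inr i)
  | .size => ∑ i : Fin n, MvPolynomial.X (Sum.inr i)
  | .alpha i => if h : (i : ℕ) < m then MvPolynomial.X (Sum.inl ⟨i, h⟩) else 0
  | .beta i => if h : (i : ℕ) < n then MvPolynomial.X (Sum.inr ⟨i, h⟩) else 0

end

/-! Number the floors `0, …, e` with `e = d - 1`. Summed over components, the genus and degree terms
recombine, so the cogenus is `d.choose 2` minus the number of edges (`cogenus_eq`) and connectivity
plays no role. An equivalence class of markings is a word: the vertices in order, each recorded by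
the source, target and weight of its edge (`numMarkings_eq`). The divergence conditions say that
weight `g + 1` crosses the gap after the floor `g`. Cutting words at the floors gives one list of
tokens per gap (`relativeSeveriDegree_eq_sum_word`).

Call a token trivial if it is a midpoint of weight one between consecutive floors, or an end
attached to the last floor `e` and lying after it. After erasing trivial tokens a configuration `C`
remains. It determines the cogenus (`endCost`); each of its tokens costs at least one, and an end of
weight `w` costs at least `w`. For fixed `C` the trivial tokens are reinserted independently in each
gap (`validWord_iff_slots`): a binomial coefficient counts the ways in a gap `g < e`, a multinomial
one in the gap `e`, a product of binomials for the `α`-vertices. The multinomial yields `(|β| - δ)!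
/ β!` times a polynomial in `|β|` and the `β_w` with `w ≤ δ`
(`relativeSeveriDegree_eq_sum_endConfs`).

The range of `C` still grows with `d`. Tokens of a configuration of cost `δ` pass over at most `δ`
of the floors `1, …, e`. Split `C` at the last floor that no token passes over: costs add, counts
multiply, the left part is counted by `closedSum`, and the right part is one of finitely many blocks
independent of `d`, carrying all dependence on `α` and `β`. The same splitting shows that `closedSum
k (n + 1) - closedSum k n` involves only smaller costs, so `closedSum k n` is polynomial for `n ≥ k`
(`polyFrom_closedSum`). With careful thresholds (`BlockBound`) the whole sum is polynomial for `d ≥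
δ + 1`.

The condition `|β| ≥ δ` also allows `d = δ`, but only with `α = 0` and `β = (δ, 0, …)`. For `α = 0`,
`β = (N, 0, …)` the ends can be led to one additional floor; this expresses the sum through closed
configurations whose last edges are light, and it is polynomial already from `N = δ` on
(`sum_endConfs_endFactor_single`). As it agrees with the polynomial found before for all `N > δ`, it
also agrees at `N = δ` (`sum_eq_eval_of_eq`). -/

/-! ### The cogenus as a count of edges. -/

theorem two_mul_sum_powersetCard_two {ι : Type*} [DecidableEq ι] (s : Finset ι) (f : ι → ℤ) :
    2 * ∑ S ∈ s.powersetCard 2, ∏ i ∈ S, f i = (∑ i ∈ s, f i) ^ 2 - ∑ i ∈ s, f i ^ 2 := by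
  induction s using Finset.induction_on with
  | empty => rw [Finset.powersetCard_eq_empty.2 (by simp)]; simp
  | insert a s ha ih =>
    rw [Finset.powersetCard_succ_insert ha, Finset.sum_union, Finset.sum_image, mul_add, ih,
      Finset.sum_insert ha, Finset.sum_insert ha]
    · have h : ∑ S ∈ s.powersetCard 1, ∏ i ∈ insert a S, f i = f a * ∑ i ∈ s, f i := by
        rw [Finset.powersetCard_one, Finset.sum_map, Finset.mul_sum]
        refine Finset.sum_congr rfl fun i hi => ?_
        have : a ≠ i := fun h => ha (h ▸ hi)
        simp [Finset.prod_pair this]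
      rw [h]; ring
    · intro S hS T hT h
      have h1 : a ∉ S := fun h => ha ((Finset.mem_powersetCard.1 hS).1 h)
      have h2 : a ∉ T := fun h => ha ((Finset.mem_powersetCard.1 hT).1 h)
      rw [← Finset.erase_insert h1, h, Finset.erase_insert h2]
    · rw [Finset.disjoint_left]
      intro S hS hS'
      obtain ⟨T, -, rfl⟩ := Finset.mem_image.1 hS'
      exact ha ((Finset.mem_powersetCard.1 hS).1 (Finset.mem_insert_self _ _))

namespace FloorDiagram

variable {d : ℕ}

open Classical in
theorem sum_compDegree (D : FloorDiagram d) :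
    ∑ C : D.graph.ConnectedComponent, D.compDegree C = d := by
  have h := Finset.card_eq_sum_card_fiberwise (s := (Finset.univ : Finset (Fin d)))
    (t := (Finset.univ : Finset D.graph.ConnectedComponent))
    (f := D.graph.connectedComponentMk) (fun _ _ => Finset.mem_coe.2 (Finset.mem_univ _))
  rw [Finset.card_univ, Fintype.card_fin] at h
  conv_rhs => rw [h]
  refine Finset.sum_congr rfl fun C _ => ?_
  rw [compDegree, ← Set.ncard_coe_finset]
  congr 1
  ext v
  simp [SimpleGraph.ConnectedComponent.mem_supp_iff]

open Classical in
theorem sum_compEdges (D : FloorDiagram d) :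
    ∑ C : D.graph.ConnectedComponent, D.compEdges C = D.edges.card := by
  simp only [compEdges]
  generalize D.edges = E
  induction E using Multiset.induction_on with
  | empty => simp
  | cons e E ih =>
    simp only [Multiset.filter_cons, Multiset.card_add, Finset.sum_add_distrib, ih,
      Multiset.card_cons]
    have : ∀ C, Multiset.card (if D.graph.connectedComponentMk e.1 = C then {e} else 0) =
      if D.graph.connectedComponentMk e.1 = C then 1 else 0 := by
      intro C; split_ifs <;> simp
    simp only [this, Finset.sum_ite_eq, Finset.mem_univ, if_true]
    omega

/-- Doubling the cogenus, the squares of the component degrees cancel against the products over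
pairs, leaving `(∑ d_C)² - ∑ d_C` minus twice the number of edges. -/
theorem cogenus_eq (D : FloorDiagram d) :
    D.cogenus = (d.choose 2 : ℤ) - D.edges.card := by
  classical
  have h1 : ∀ n : ℕ, 2 * (((n : ℤ) - 1) * ((n : ℤ) - 2) / 2) = ((n : ℤ) - 1) * ((n : ℤ) - 2) := by
    intro n
    apply Int.mul_ediv_cancel'
    rcases Int.even_or_odd' (n : ℤ) with ⟨k, hk | hk⟩
    · exact ⟨(2 * k - 1) * (k - 1), by rw [hk]; ring⟩
    · exact ⟨k * (2 * k - 1), by rw [hk]; ring⟩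
  have h2 : (2 : ℤ) * (d.choose 2 : ℤ) = d * (d - 1) := by
    rcases d with _ | d
    · simp
    · have h := Nat.choose_two_right (d + 1)
      have h3 : 2 * (d + 1).choose 2 = (d + 1) * d := by
        rw [h]; exact Nat.mul_div_cancel' (by simpa [mul_comm] using (Nat.even_mul_succ_self d).two_dvd)
      push_cast
      have : ((2 * (d + 1).choose 2 : ℕ) : ℤ) = ((d + 1) * d : ℕ) := by rw [h3]
      push_cast at this
      linarith
  have hE : (∑ C : D.graph.ConnectedComponent, (D.compEdges C : ℤ)) = D.edges.card := by
    exact_mod_cast D.sum_compEdges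
  have hD : (∑ C : D.graph.ConnectedComponent, (D.compDegree C : ℤ)) = d := by
    exact_mod_cast D.sum_compDegree
  have h3 := two_mul_sum_powersetCard_two (Finset.univ : Finset D.graph.ConnectedComponent)
    fun C => (D.compDegree C : ℤ)
  have h4 : ∀ C : D.graph.ConnectedComponent, 2 * D.compCogenus C =
      (D.compDegree C : ℤ) ^ 2 - D.compDegree C - 2 * D.compEdges C := by
    intro C
    rw [compCogenus, mul_sub, h1, compGenus]; ring
  have h5 : 2 * ∑ C : D.graph.ConnectedComponent, D.compCogenus C =
      ∑ C : D.graph.ConnectedComponent, (D.compDegree C : ℤ) ^ 2 - d - 2 * D.edges.card := by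
    rw [Finset.mul_sum, Finset.sum_congr rfl fun C _ => h4 C, Finset.sum_sub_distrib,
      Finset.sum_sub_distrib, ← Finset.mul_sum, hE, hD]
  have h6 : 2 * D.cogenus = 2 * ((d.choose 2 : ℤ) - D.edges.card) := by
    rw [mul_sub, h2, cogenus, mul_add]
    rw [hD] at h3
    linear_combination h5 + h3
  linarith

end FloorDiagram

/-! ### Labels of vertices and valid words. -/

/-- Labels of the vertices of a marked floor diagram: `inl i` is the `i`-th floor, `inr (i, j, w)`
is a vertex on an edge of weight `w` from the floor `i` to `j`, where `j = d` for `β`-vertices and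
`j = d + 1` for `α`-vertices. -/
abbrev Lab := ℕ ⊕ (ℕ × ℕ × ℕ+)

namespace Lab

/-- `Before d x y`: in a marking, vertices with label `x` must precede vertices with label `y`. -/
def Before (d : ℕ) : Lab → Lab → Prop
  | .inl i, .inl j => i < j
  | .inl i, .inr t => t.1 = i ∨ t.2.1 = d + 1
  | .inr t, .inl j => t.2.1 = j
  | .inr t, .inr t' => (t.2.1 ≠ d + 1 ∧ t'.2.1 = d + 1) ∨
      (t.2.1 = d + 1 ∧ t'.2.1 = d + 1 ∧ t.2.2 < t'.2.2)

/-- `EdgeLab x y w`: there is an edge of weight `w` between vertices with labels `x` and `y`. -/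
def EdgeLab : Lab → Lab → ℕ+ → Prop
  | .inl i, .inr t, w => t.1 = i ∧ t.2.2 = w
  | .inr t, .inl j, w => t.2.1 = j ∧ t.2.2 = w
  | _, _, _ => False

/-- The weight with which an edge crosses the gap after the floor `g`. -/
def crossing (g : ℕ) : Lab → ℕ
  | .inl _ => 0
  | .inr t => if t.1 ≤ g ∧ g < t.2.1 then t.2.2 else 0

/-- The contribution to the divergence of the floor `i`. -/
def flow (i : ℕ) : Lab → ℤ
  | .inl _ => 0
  | .inr t => (if t.1 = i then ((t.2.2 : ℕ) : ℤ) else 0) - if t.2.1 = i then ((t.2.2 : ℕ) : ℤ) else 0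

/-- Indicator of the vertices on edges of weight `w` with target `e`. -/
def endInd (e : ℕ) (w : ℕ+) : Lab → ℕ
  | .inl _ => 0
  | .inr t => if t.2.1 = e ∧ t.2.2 = w then 1 else 0

/-- Indicator of the midpoints. -/
def midInd (d : ℕ) : Lab → ℕ
  | .inl _ => 0
  | .inr t => if t.2.1 < d then 1 else 0

/-- The contribution of a vertex to the multiplicity. -/
def sqWeight (d : ℕ) : Lab → ℕ
  | .inl _ => 1
  | .inr t => if t.2.1 < d then (t.2.2 : ℕ) ^ 2 else 1

theorem crossing_eq_sum_flow (g : ℕ) (x : Lab) (hx : ∀ t, x = .inr t → t.1 < t.2.1) :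
    (crossing g x : ℤ) = ∑ i ∈ Finset.range (g + 1), flow i x := by
  rcases x with i | t
  · simp [crossing, flow]
  · have := hx t rfl
    simp only [crossing, flow, Finset.sum_sub_distrib, Finset.sum_ite_eq, Finset.mem_range]
    split_ifs <;> omega

end Lab

open Lab

/-- A list of labels is valid if it comes from an `(α, β)`-marking of a floor diagram of
degree `d`. -/
structure FlatValid (d : ℕ) (α β : TangencySeq) (L : List Lab) : Prop where
  floor_lt : ∀ i, Sum.inl i ∈ L → i < d
  tok_range : ∀ t, Sum.inr t ∈ L → t.1 < t.2.1 ∧ t.1 < d ∧ t.2.1 ≤ d + 1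
  count_floor : ∀ i < d, (L : Multiset Lab).count (Sum.inl i) = 1
  order : L.Pairwise fun x y => ¬ Before d y x
  beta : ∀ w, (L.map (endInd d w)).sum = β w
  alpha : ∀ w, (L.map (endInd (d + 1) w)).sum = α w
  cross : ∀ g < d, (L.map (crossing g)).sum = g + 1

theorem Lab.before_irrefl (d : ℕ) (x : Lab) : ¬ Before d x x := by
  rcases x with i | t <;> simp [Before]

instance finite_sigma_fin (s : TangencySeq) : Finite (Σ j : ℕ+, Fin (s j)) := by
  refine Finite.of_injective (β := Σ j : s.support, Fin (s j))
    (fun x => ⟨⟨x.1, Finsupp.mem_support_iff.2 (by have := x.2.2; omega)⟩, x.2⟩) ?_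
  rintro ⟨j, k⟩ ⟨j', k'⟩ h
  simp only [Sigma.mk.injEq, Subtype.mk.injEq] at h
  obtain ⟨rfl, h⟩ := h
  simpa using h

noncomputable instance fintype_sigma_fin (s : TangencySeq) : Fintype (Σ j : ℕ+, Fin (s j)) :=
  Fintype.ofFinite _

theorem sum_sigma_fin {A : Type*} [AddCommMonoid A] (s : TangencySeq) (f : ℕ+ → A) :
    ∑ x : (Σ j : ℕ+, Fin (s j)), f x.1 = s.sum fun j n => n • f j := by
  classical
  rw [Finsupp.sum, ← Finset.sum_fiberwise_of_maps_to (s := Finset.univ) (t := s.support)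
    (g := fun x : (Σ j : ℕ+, Fin (s j)) => x.1)]
  · refine Finset.sum_congr rfl fun j _ => ?_
    rw [Finset.sum_congr rfl (g := fun _ => f j)
      (fun x hx => by rw [(Finset.mem_filter.1 hx).2]), Finset.sum_const]
    congr 1
    rw [← Fintype.card_fin (s j)]
    refine (Finset.card_bij (s := (Finset.univ : Finset (Fin (s j)))) (fun k _ => ⟨j, k⟩) ?_ ?_ ?_).symm
    · simp
    · simp
    · rintro ⟨j', k⟩ h
      obtain rfl : j' = j := (Finset.mem_filter.1 h).2
      exact ⟨k, Finset.mem_univ _, rfl⟩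
  · rintro ⟨j, k⟩ _
    exact Finsupp.mem_support_iff.2 (by have := k.2; dsimp only; omega)

namespace FloorDiagram

variable {d : ℕ} {D : FloorDiagram d} {α β : TangencySeq}

/-- The label of the midpoint of an edge. -/
def midLab (e : Fin d × Fin d × ℕ+) : Lab := .inr (e.1, e.2.1, e.2.2)

theorem midLab_injective : Function.Injective (midLab (d := d)) := by
  rintro ⟨i, j, w⟩ ⟨i', j', w'⟩ h
  simp only [midLab, Sum.inr.injEq, Prod.mk.injEq, Fin.val_inj] at h
  obtain ⟨rfl, rfl, rfl⟩ := h
  rfl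

namespace ExtVertex

variable {p : CompatiblePair D α β}

/-- The label of a vertex. -/
def label : ExtVertex p → Lab
  | floor i => .inl i
  | mid e => midLab e.1
  | beta i j _ => .inr (i, d, j)
  | alpha i j _ => .inr (i, d + 1, j)

/-- The four kinds of vertices. -/
def equivSum (p : CompatiblePair D α β) : ExtVertex p ≃
    (Fin d ⊕ D.edges.ToType) ⊕ ((Σ i : Fin d, Σ j : ℕ+, Fin (p.b i j)) ⊕
      (Σ i : Fin d, Σ j : ℕ+, Fin (p.a i j))) where
  toFun
    | floor i => .inl (.inl i)
    | mid e => .inl (.inr e)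
    | beta i j k => .inr (.inl ⟨i, j, k⟩)
    | alpha i j k => .inr (.inr ⟨i, j, k⟩)
  invFun
    | .inl (.inl i) => floor i
    | .inl (.inr e) => mid e
    | .inr (.inl x) => beta x.1 x.2.1 x.2.2
    | .inr (.inr x) => alpha x.1 x.2.1 x.2.2
  left_inv v := by cases v <;> rfl
  right_inv x := by rcases x with (_ | _) | (_ | _) <;> rfl

noncomputable instance : Fintype (ExtVertex p) := Fintype.ofEquiv _ (equivSum p).symm

theorem sum_label {A : Type*} [AddCommMonoid A] (p : CompatiblePair D α β) (f : Lab → A) :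
    ∑ v : ExtVertex p, f v.label = (∑ i : Fin d, f (.inl i) + (D.edges.map fun e => f (midLab e)).sum) +
      (∑ i : Fin d, ((p.b i).sum fun j n => n • f (.inr (i, d, j))) +
        ∑ i : Fin d, ((p.a i).sum fun j n => n • f (.inr (i, d + 1, j)))) := by
  rw [← (equivSum p).symm.sum_comp, Fintype.sum_sum_type, Fintype.sum_sum_type,
    Fintype.sum_sum_type]
  congr 2
  · rw [← Multiset.map_univ (m := D.edges)]
    rfl
  · rw [Fintype.sum_sigma]
    refine Finset.sum_congr rfl fun i _ => ?_
    exact sum_sigma_fin (p.b i) fun j => f (.inr (i, d, j))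
  · rw [Fintype.sum_sigma]
    refine Finset.sum_congr rfl fun i _ => ?_
    exact sum_sigma_fin (p.a i) fun j => f (.inr (i, d + 1, j))

theorem edge_iff {u v : ExtVertex p} {w : ℕ+} : ExtEdge p u v w ↔ EdgeLab u.label v.label w := by
  constructor
  · rintro (e | e | ⟨i, j, k⟩ | ⟨i, j, k⟩) <;> simp [label, EdgeLab, midLab]
  · intro h
    rcases u with i | e | ⟨i, j, k⟩ | ⟨i, j, k⟩ <;> rcases v with i' | e' | ⟨i', j', k'⟩ | ⟨i', j', k'⟩ <;>
      simp only [label, EdgeLab, midLab, Fin.val_inj] at h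
    · obtain ⟨rfl, rfl⟩ := h
      exact ExtEdge.toMid e'
    · obtain ⟨rfl, rfl⟩ := h
      exact ExtEdge.toBeta ..
    · obtain ⟨rfl, rfl⟩ := h
      exact ExtEdge.toAlpha ..
    · obtain ⟨rfl, rfl⟩ := h
      exact ExtEdge.fromMid e
    · have := i'.2; omega
    · have := i'.2; omega

theorem isAlpha_iff {v : ExtVertex p} : v.IsAlpha ↔ ∃ t, v.label = .inr t ∧ t.2.1 = d + 1 := by
  rcases v with i | e | ⟨i, j, k⟩ | ⟨i, j, k⟩
  · simp [IsAlpha, label]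
  · have := e.1.2.1.2
    simp [IsAlpha, label, midLab]; omega
  · simp [IsAlpha, label]
  · simp [IsAlpha, label]

end ExtVertex

/-- All order axioms of a marking concern labels only, and `Before` collects them. For two
`α`-vertices of different weights the axiom excludes the wrong order, and totality then forces the
right one. -/
theorem Marking.lt_of_before (M : Marking D α β) {u v : ExtVertex M.pair}
    (h : Before d u.label v.label) : M.lt u v := by
  have := M.isStrictTotalOrder
  rcases hu : u.label with i | t <;> rcases hv : v.label with j | t' <;> rw [hu, hv] at h <;>
    simp only [Before] at h
  · rcases u with i | e | ⟨i, j, k⟩ | ⟨i, j, k⟩ <;> simp [ExtVertex.label, midLab] at hu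
    rcases v with i' | e | ⟨i, j, k⟩ | ⟨i, j, k⟩ <;> simp [ExtVertex.label, midLab] at hv
    exact M.floor_lt_floor _ _ (by rw [Fin.lt_def]; omega)
  · rcases h with h | h
    · refine M.lt_of_edge u v t'.2.2 (ExtVertex.edge_iff.2 ?_)
      rw [hu, hv]; exact ⟨h, rfl⟩
    · refine M.lt_of_isAlpha u v ?_ (ExtVertex.isAlpha_iff.2 ⟨t', hv, h⟩)
      rw [ExtVertex.isAlpha_iff, hu]; simp
  · refine M.lt_of_edge u v t.2.2 (ExtVertex.edge_iff.2 ?_)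
    rw [hu, hv]; exact ⟨h, rfl⟩
  · rcases h with h | h
    · refine M.lt_of_isAlpha u v ?_ (ExtVertex.isAlpha_iff.2 ⟨t', hv, h.2⟩)
      rw [ExtVertex.isAlpha_iff, hu]
      rintro ⟨t1, h1, h2⟩
      cases h1
      exact h.1 h2
    · obtain ⟨i, j, k, rfl⟩ := ExtVertex.isAlpha_iff.2 ⟨t, hu, h.1⟩
      obtain ⟨i', j', k', rfl⟩ := ExtVertex.isAlpha_iff.2 ⟨t', hv, h.2.1⟩
      simp only [ExtVertex.label, Sum.inr.injEq] at hu hv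
      subst hu hv
      rcases trichotomous_of M.lt (ExtVertex.alpha i j k) (ExtVertex.alpha i' j' k') with h1 | h1 | h1
      · exact h1
      · cases h1
        exact absurd h.2.2 (lt_irrefl _)
      · exact absurd (M.weight_le_weight _ _ _ _ _ _ h1) (not_le.2 h.2.2)

end FloorDiagram

/-! ### The word of a marking as a complete invariant of its equivalence class. -/

namespace FloorDiagram

variable {d : ℕ} {D : FloorDiagram d} {α β : TangencySeq}

/-- `L` is the list of the labels of the vertices, in the order of the marking. -/
def Marking.IsWord (M : Marking D α β) (L : List Lab) : Prop :=
  ∃ (n : ℕ) (e : Fin n ≃ ExtVertex M.pair),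
    (∀ a b, a < b ↔ M.lt (e a) (e b)) ∧ L = List.ofFn fun a => (e a).label

namespace Marking

theorem exists_isWord (M : Marking D α β) : ∃ L, M.IsWord L := by
  classical
  have := M.isStrictTotalOrder
  let := linearOrderOfSTO M.lt
  let e := Fintype.orderIsoFinOfCardEq (ExtVertex M.pair) rfl
  exact ⟨_, _, e.toEquiv, fun a b => (e.lt_iff_lt (x := a) (y := b)).symm, rfl⟩

theorem equiv_eq_of_lt_iff {n : ℕ} {V : Type*} {r : V → V → Prop} {e e' : Fin n ≃ V}
    (he : ∀ a b, a < b ↔ r (e a) (e b)) (he' : ∀ a b, a < b ↔ r (e' a) (e' b)) : e = e' := by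
  let f : Fin n ≃o Fin n := OrderIso.ofRelIsoLT
    ⟨e.trans e'.symm, by intro a b; rw [he a b, he']; simp⟩
  have hf : f = OrderIso.refl _ := Subsingleton.elim _ _
  ext a
  have h : f a = a := by rw [hf]; rfl
  have h' : e'.symm (e a) = a := h
  rw [← e'.apply_symm_apply (e a), h']

theorem IsWord.unique {M : Marking D α β} {L L' : List Lab} (h : M.IsWord L) (h' : M.IsWord L') :
    L = L' := by
  obtain ⟨n, e, he, rfl⟩ := h
  obtain ⟨n', e', he', rfl⟩ := h'
  obtain rfl : n = n' := by simpa using Fintype.card_congr (e.trans e'.symm)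
  rw [equiv_eq_of_lt_iff he he']

theorem sum_map_of_isWord {A : Type*} [AddCommMonoid A] {M : Marking D α β} {L : List Lab}
    (h : M.IsWord L) (f : Lab → A) :
    (L.map f).sum = (∑ i : Fin d, f (.inl i) + (D.edges.map fun e => f (midLab e)).sum) +
      (∑ i : Fin d, ((M.pair.b i).sum fun j n => n • f (.inr (i, d, j))) +
        ∑ i : Fin d, ((M.pair.a i).sum fun j n => n • f (.inr (i, d + 1, j)))) := by
  obtain ⟨n, e, -, rfl⟩ := h
  rw [← ExtVertex.sum_label, ← e.sum_comp, List.map_ofFn, List.sum_ofFn]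
  rfl

open Classical in
theorem card_isAlpha (M : Marking D α β) :
    (Finset.univ.filter fun v : ExtVertex M.pair => v.IsAlpha).card =
      Fintype.card (Σ j : ℕ+, Fin (α j)) := by
  have h : ∑ v : ExtVertex M.pair, (fun x : Lab => if ∃ t, x = .inr t ∧ t.2.1 = d + 1 then 1 else 0) v.label
      = (Finset.univ.filter fun v : ExtVertex M.pair => v.IsAlpha).card := by
    rw [Finset.card_filter]
    simp only [ExtVertex.isAlpha_iff]
  have h2 := sum_sigma_fin α fun _ => (1 : ℕ)
  simp only [Finset.sum_const, Finset.card_univ, smul_eq_mul, mul_one] at h2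
  rw [← h]
  refine (ExtVertex.sum_label M.pair fun x : Lab =>
    if ∃ t, x = .inr t ∧ t.2.1 = d + 1 then 1 else 0).trans ?_
  rw [Finset.sum_eq_zero (by simp), Multiset.sum_eq_zero, Finset.sum_eq_zero (by simp), h2]
  · have h4 : α.sum (fun _ n => n) = (∑ i, M.pair.a i).sum fun _ n => n := by rw [M.pair.sum_a]
    rw [h4, ← Finsupp.sum_finsetSum_index (by simp) (by simp)]
    simp
  · simp only [Multiset.mem_map]
    rintro _ ⟨e, -, rfl⟩
    have := e.2.1.2
    rw [if_neg]
    rintro ⟨t, h1, h2⟩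
    simp only [midLab, Sum.inr.injEq] at h1
    subst h1
    simp only at h2
    omega

/-- An isomorphism is not assumed to respect the kind of an end. It does so because the `α`-vertices
form a final segment of the linear order, of the same size for both markings, and final segments of
equal size coincide. -/
theorem isAlpha_iff_of_equivalent {M N : Marking D α β} (f : ExtVertex M.pair ≃ ExtVertex N.pair)
    (hf : ∀ u v, M.lt u v ↔ N.lt (f u) (f v)) (v : ExtVertex M.pair) :
    v.IsAlpha ↔ (f v).IsAlpha := by
  classical
  have := M.isStrictTotalOrder
  have := N.isStrictTotalOrder
  let A : Finset (ExtVertex N.pair) := Finset.univ.filter fun v => (f.symm v).IsAlpha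
  let B : Finset (ExtVertex N.pair) := Finset.univ.filter fun v => v.IsAlpha
  have hA : A.card = B.card := by
    rw [N.card_isAlpha, ← M.card_isAlpha]
    exact Finset.card_equiv f.symm (by simp [A])
  have hAB : A = B := by
    by_cases h : A ⊆ B
    · exact Finset.eq_of_subset_of_card_le h hA.ge
    · refine (Finset.eq_of_subset_of_card_le (fun v hv => ?_) hA.le).symm
      obtain ⟨u, hu, hu'⟩ := Finset.not_subset.1 h
      simp only [A, B, Finset.mem_filter, Finset.mem_univ, true_and] at hu hu' hv ⊢
      by_contra hc
      have h1 := N.lt_of_isAlpha u v hu' hv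
      have h2 := M.lt_of_isAlpha _ _ hc hu
      rw [hf] at h2
      simp only [Equiv.apply_symm_apply] at h2
      exact asymm_of N.lt h1 h2
  have := Finset.ext_iff.1 hAB (f v)
  simpa [A, B] using this

/-- The floors are fixed, so the incoming edge reveals source and weight. A midpoint is recognised
by its outgoing edge, which also gives its target, and an `α`-vertex by its position at the end of
the order. -/
theorem label_of_equivalent {M N : Marking D α β} (f : ExtVertex M.pair ≃ ExtVertex N.pair)
    (h1 : ∀ i, f (.floor i) = .floor i)
    (h2 : ∀ u v w, ExtEdge M.pair u v w ↔ ExtEdge N.pair (f u) (f v) w)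
    (h3 : ∀ u v, M.lt u v ↔ N.lt (f u) (f v)) (v : ExtVertex M.pair) :
    (f v).label = v.label := by
  have hα := isAlpha_iff_of_equivalent f h3 v
  have key : ∀ i : Fin d, ∀ w, ExtEdge M.pair (.floor i) v w → ∃ j, (f v).label = .inr (i, j, w) := by
    intro i w h
    rw [h2, h1, ExtVertex.edge_iff] at h
    rcases hv : (f v).label with k | t <;> rw [hv] at h <;> simp only [ExtVertex.label, EdgeLab] at h
    exact ⟨t.2.1, by rw [← h.1, ← h.2]⟩
  have key' : ∀ i : Fin d, ∀ w, ExtEdge N.pair (f v) (.floor i) w → ExtEdge M.pair v (.floor i) w := by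
    intro i w h
    rw [h2, h1]; exact h
  rcases v with i | e | ⟨i, j, k⟩ | ⟨i, j, k⟩
  · rw [h1]; rfl
  · obtain ⟨j, hj⟩ := key _ _ (ExtEdge.toMid e)
    have h := ExtEdge.fromMid (p := M.pair) e
    rw [h2, h1, ExtVertex.edge_iff, hj] at h
    simp only [ExtVertex.label, EdgeLab] at h
    rw [hj, h.1]; rfl
  · obtain ⟨j', hj⟩ := key _ _ (ExtEdge.toBeta i j k)
    rcases hv : f (.beta i j k) with i' | e' | ⟨i', j', k'⟩ | ⟨i', j', k'⟩ <;> rw [hv] at hj hα key' <;>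
      simp only [ExtVertex.label, midLab, Sum.inr.injEq, Prod.mk.injEq, reduceCtorEq] at hj ⊢
    · have := key' _ _ (ExtEdge.fromMid e')
      cases this
    · simp [hj]
    · have := hα.2 ⟨_, _, _, rfl⟩
      obtain ⟨_, _, _, h⟩ := this
      cases h
  · have := hα.1 ⟨_, _, _, rfl⟩
    obtain ⟨i', j', k', h⟩ := this
    obtain ⟨l, hl⟩ := key _ _ (ExtEdge.toAlpha i j k)
    rw [h] at hl ⊢
    simp only [ExtVertex.label, Sum.inr.injEq, Prod.mk.injEq] at hl ⊢
    simp [hl]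

theorem IsWord.of_equivalent {M N : Marking D α β} {L : List Lab} (h : M.IsWord L)
    (hMN : M.Equivalent N) : N.IsWord L := by
  obtain ⟨f, h1, h2, h3⟩ := hMN
  obtain ⟨n, e, he, rfl⟩ := h
  refine ⟨n, e.trans f, fun a b => ?_, ?_⟩
  · rw [he, h3]; rfl
  · congr 1
    funext a
    exact (label_of_equivalent f h1 h2 h3 _).symm

/-- Matching vertices in equal positions preserves labels and order, and labels determine the edges
(`ExtVertex.edge_iff`). -/
theorem IsWord.equivalent {M N : Marking D α β} {L : List Lab} (h : M.IsWord L)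
    (h' : N.IsWord L) : M.Equivalent N := by
  obtain ⟨n, e, he, rfl⟩ := h
  obtain ⟨n', e', he', h⟩ := h'
  obtain rfl : n = n' := by simpa using congrArg List.length h
  have hl := List.ofFn_injective h
  have hlab : ∀ v, (e' (e.symm v)).label = v.label := by
    intro v
    have := congrFun hl (e.symm v)
    simp only [Equiv.apply_symm_apply] at this
    exact this.symm
  refine ⟨e.symm.trans e', fun i => ?_, fun u v w => ?_, fun u v => ?_⟩
  · have := hlab (.floor i)
    rcases hv : e' (e.symm (.floor i)) with i' | e' | ⟨i', j', k'⟩ | ⟨i', j', k'⟩ <;> rw [hv] at this <;>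
      simp [ExtVertex.label, midLab, Fin.val_inj] at this
    subst this
    exact hv
  · rw [ExtVertex.edge_iff, ExtVertex.edge_iff]
    simp only [Equiv.trans_apply, hlab]
  · simp only [Equiv.trans_apply]
    rw [← he', he]
    simp

end Marking
end FloorDiagram

/-! ### The multiset of labels and the divergence condition. -/

/-- The labels of the midpoints occurring in a list of labels. -/
def mids (d : ℕ) (L : List Lab) : Multiset Lab := (L : Multiset Lab).filter fun x => midInd d x = 1

namespace FloorDiagram

variable {d : ℕ} {α β : TangencySeq}

/-- The multiset of labels of the extended graph. -/
def labels (E : Multiset (Fin d × Fin d × ℕ+)) (a b : Fin d → TangencySeq) : Multiset Lab :=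
  (∑ i : Fin d, {.inl ↑i} + E.map midLab) +
    (∑ i : Fin d, ((b i).sum fun j n => n • {.inr (↑i, d, j)}) +
      ∑ i : Fin d, ((a i).sum fun j n => n • {.inr (↑i, d + 1, j)}))

theorem sum_map_labels {A : Type*} [AddCommMonoid A] (E : Multiset (Fin d × Fin d × ℕ+))
    (a b : Fin d → TangencySeq) (f : Lab → A) :
    ((labels E a b).map f).sum = (∑ i : Fin d, f (.inl i) + (E.map fun e => f (midLab e)).sum) +
      (∑ i : Fin d, ((b i).sum fun j n => n • f (.inr (i, d, j))) +
        ∑ i : Fin d, ((a i).sum fun j n => n • f (.inr (i, d + 1, j)))) := by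
  have h : ∀ s : Multiset Lab, (s.map f).sum =
      (Multiset.sumAddMonoidHom.comp (Multiset.mapAddMonoidHom f)) s := fun s => rfl
  rw [h, labels, map_add, map_add, map_add, map_sum, map_sum, map_sum]
  refine congrArg₂ (· + ·) (congrArg₂ (· + ·) (Finset.sum_congr rfl fun i _ => ?_) ?_)
    (congrArg₂ (· + ·) ?_ ?_)
  · rw [← h]; simp
  · rw [← h]; simp
  · refine Finset.sum_congr rfl fun i _ => ?_
    rw [map_finsuppSum]
    refine Finsupp.sum_congr fun j _ => ?_
    rw [map_nsmul, ← h]; simp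
  · refine Finset.sum_congr rfl fun i _ => ?_
    rw [map_finsuppSum]
    refine Finsupp.sum_congr fun j _ => ?_
    rw [map_nsmul, ← h]; simp

theorem Multiset.count_eq_sum_map {X : Type*} [DecidableEq X] (s : Multiset X) (x : X) :
    s.count x = (s.map fun y => if y = x then 1 else 0).sum := by
  induction s using Multiset.induction_on with
  | empty => simp
  | cons y s ih =>
    rw [Multiset.count_cons, ih, Multiset.map_cons, Multiset.sum_cons, add_comm]
    simp [eq_comm]

theorem finsupp_sum_ite (s : TangencySeq) (w : ℕ+) (P : Prop) [Decidable P] :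
    (s.sum fun j n => n • if P ∧ j = w then 1 else 0) = if P then s w else 0 := by
  by_cases hP : P
  · simp only [hP, true_and, smul_eq_mul, mul_ite, mul_one, mul_zero, if_true]
    rw [Finsupp.sum_ite_self_eq']
  · simp [hP]

theorem count_inl_labels (E : Multiset (Fin d × Fin d × ℕ+)) (a b : Fin d → TangencySeq) (i : ℕ) :
    (labels E a b).count (.inl i) = if i < d then 1 else 0 := by
  rw [Multiset.count_eq_sum_map, sum_map_labels]
  simp only [midLab, reduceCtorEq, if_false, smul_zero, Finsupp.sum, Finset.sum_const_zero, add_zero,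
    Multiset.map_const', Multiset.sum_replicate, Sum.inl.injEq]
  rw [Fin.sum_univ_eq_sum_range (fun k => if k = i then 1 else 0)]
  simp

theorem count_inr_labels (E : Multiset (Fin d × Fin d × ℕ+)) (a b : Fin d → TangencySeq)
    (s t : ℕ) (w : ℕ+) :
    (labels E a b).count (.inr (s, t, w)) = (E.map midLab).count (.inr (s, t, w)) +
      ((∑ i : Fin d, if (i : ℕ) = s ∧ d = t then b i w else 0) +
        ∑ i : Fin d, if (i : ℕ) = s ∧ d + 1 = t then a i w else 0) := by
  rw [Multiset.count_eq_sum_map, sum_map_labels, Multiset.count_eq_sum_map]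
  simp only [reduceCtorEq, if_false, Finset.sum_const_zero, zero_add, Sum.inr.injEq,
    Prod.mk.injEq, Multiset.map_map, Function.comp_def]
  congr 2
  · refine Finset.sum_congr rfl fun i _ => ?_
    simp only [← and_assoc]
    exact finsupp_sum_ite _ _ _
  · refine Finset.sum_congr rfl fun i _ => ?_
    simp only [← and_assoc]
    exact finsupp_sum_ite _ _ _

theorem edgeDivergence_eq (E : Multiset (Fin d × Fin d × ℕ+)) (i : Fin d) :
    edgeDivergence E i = (E.map fun e => flow i (midLab e)).sum := by
  induction E using Multiset.induction_on with
  | empty => simp [edgeDivergence]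
  | cons e E ih =>
    rw [Multiset.map_cons, Multiset.sum_cons, ← ih]
    simp only [edgeDivergence, Multiset.filter_cons, Multiset.map_add, Multiset.sum_add, flow,
      midLab, Fin.val_inj]
    split_ifs <;> simp <;> ring

theorem sum_flow_labels (E : Multiset (Fin d × Fin d × ℕ+)) (a b : Fin d → TangencySeq)
    (i : Fin d) : ((labels E a b).map (flow i)).sum =
      edgeDivergence E i + ((b i).weight + (a i).weight : ℕ) := by
  have key : ∀ (s : Fin d → TangencySeq) (t : ℕ), d ≤ t →
      ∑ k : Fin d, ((s k).sum fun j n => n • flow i (.inr (k, t, j))) = ((s i).weight : ℤ) := by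
    intro s t ht
    rw [Finset.sum_eq_single i]
    · simp only [flow, if_true, TangencySeq.weight, Finsupp.sum]
      push_cast
      refine Finset.sum_congr rfl fun j _ => ?_
      rw [if_neg (by have := i.2; omega)]
      simp; ring
    · intro k _ hk
      refine Finset.sum_eq_zero fun j _ => ?_
      simp only [flow]
      rw [if_neg (by rwa [Fin.val_inj]), if_neg (by have := i.2; omega)]
      simp
    · simp
  rw [sum_map_labels, edgeDivergence_eq, key b d le_rfl, key a (d + 1) (by omega)]
  simp [flow]

theorem sum_crossing_eq (L : List Lab) (hL : ∀ t, Sum.inr t ∈ L → t.1 < t.2.1) (g : ℕ) :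
    (((L.map (crossing g)).sum : ℕ) : ℤ) = ∑ i ∈ Finset.range (g + 1), (L.map (flow i)).sum := by
  induction L with
  | nil => simp
  | cons x L ih =>
    simp only [List.map_cons, List.sum_cons, Finset.sum_add_distrib]
    rw [Nat.cast_add, ← ih fun t ht => hL t (List.mem_cons_of_mem _ ht),
      crossing_eq_sum_flow g x fun t ht => hL t (by simp [ht])]

/-- The weight crossing the gap `g` is the sum of the flows out of the floors `0, …, g`, so flows
are differences of consecutive crossing weights. -/
theorem forall_crossing_iff {L : List Lab} (hL : ∀ t, Sum.inr t ∈ L → t.1 < t.2.1) (n : ℕ) :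
    (∀ g < n, (L.map (crossing g)).sum = g + 1) ↔ ∀ i < n, (L.map (flow i)).sum = 1 := by
  constructor
  · intro h i hi
    have h1 := sum_crossing_eq L hL i
    rw [h i hi, Finset.sum_range_succ] at h1
    rcases i with _ | i
    · simp at h1; omega
    · rw [← sum_crossing_eq L hL i, h i (by omega)] at h1
      push_cast at h1; omega
  · intro h g hg
    have h1 := sum_crossing_eq L hL g
    rw [Finset.sum_congr rfl fun i hi => h i (by have := Finset.mem_range.1 hi; omega)] at h1
    refine Nat.cast_injective (R := ℤ) (h1.trans ?_)
    simp

theorem filter_labels (E : Multiset (Fin d × Fin d × ℕ+)) (a b : Fin d → TangencySeq) :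
    (labels E a b).filter (fun x => midInd d x = 1) = E.map midLab := by
  ext x
  rw [Multiset.count_filter]
  rcases x with i | ⟨s, t, w⟩
  · rw [if_neg (by simp [midInd]), eq_comm, Multiset.count_eq_zero]
    simp [midLab]
  · by_cases h1 : t < d
    · rw [if_pos (by simp [midInd, h1])]
      rw [count_inr_labels, Finset.sum_eq_zero, Finset.sum_eq_zero]
      · rfl
      · exact fun i _ => if_neg (by omega)
      · exact fun i _ => if_neg (by omega)
    · rw [if_neg (by simp [midInd, h1]), eq_comm, Multiset.count_eq_zero]
      simp only [midLab, Multiset.mem_map, Sum.inr.injEq, Prod.mk.injEq, not_exists, not_and]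
      rintro e - - h
      have := e.2.1.2
      omega

variable {D : FloorDiagram d}

theorem Marking.coe_of_isWord {M : Marking D α β} {L : List Lab} (h : M.IsWord L) :
    (L : Multiset Lab) = labels D.edges M.pair.a M.pair.b := by
  have h1 := sum_map_of_isWord h fun x => ({x} : Multiset Lab)
  have h2 : (L.map fun x => ({x} : Multiset Lab)).sum = L := by
    rw [← Multiset.sum_coe, ← Multiset.map_coe, Multiset.sum_map_singleton]
  rw [← h2, h1, labels]
  congr 2
  rw [← Multiset.sum_map_singleton (D.edges.map midLab), Multiset.map_map]
  rfl

theorem Marking.mids_of_isWord {M : Marking D α β} {L : List Lab} (h : M.IsWord L) :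
    mids d L = D.edges.map midLab := by
  rw [mids, coe_of_isWord h, filter_labels]

theorem sum_endInd_labels (E : Multiset (Fin d × Fin d × ℕ+)) (a b : Fin d → TangencySeq) (w : ℕ+) :
    ((labels E a b).map (endInd d w)).sum = (∑ i, b i) w ∧
      ((labels E a b).map (endInd (d + 1) w)).sum = (∑ i, a i) w := by
  have h1 : ∀ e : Fin d × Fin d × ℕ+, endInd d w (midLab e) = 0 := fun e => by
    have := e.2.1.2
    simp only [endInd, midLab]
    rw [if_neg (by omega)]
  have h2 : ∀ e : Fin d × Fin d × ℕ+, endInd (d + 1) w (midLab e) = 0 := fun e => by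
    have := e.2.1.2
    simp only [endInd, midLab]
    rw [if_neg (by omega)]
  rw [sum_map_labels, sum_map_labels, Finsupp.finsetSum_apply, Finsupp.finsetSum_apply]
  simp only [h1, h2]
  have h3 : ∀ n : ℕ, (if n = 0 then 0 else n) = n := fun n => by split_ifs <;> simp [*]
  simp [endInd, h3]

theorem Marking.flatValid_of_isWord {M : Marking D α β} {L : List Lab} (h : M.IsWord L) :
    FlatValid d α β L := by
  have hL := coe_of_isWord h
  have hr : ∀ t, Sum.inr t ∈ L → t.1 < t.2.1 ∧ t.1 < d ∧ t.2.1 ≤ d + 1 := by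
    obtain ⟨n, e, he, rfl⟩ := h
    intro t ht
    obtain ⟨k, hk⟩ := (List.mem_ofFn).1 ht
    rcases hv : e k with i | e' | ⟨i, j, k⟩ | ⟨i, j, k⟩ <;> rw [hv] at hk <;>
      simp only [ExtVertex.label, midLab, Sum.inr.injEq, reduceCtorEq] at hk
    · subst hk
      have h1 := D.source_lt_target e'.1 (Multiset.coe_mem)
      have h2 := e'.1.1.2
      have h3 := e'.1.2.1.2
      rw [Fin.lt_def] at h1
      simp only
      omega
    · subst hk
      have := i.2
      simp only
      omega
    · subst hk
      have := i.2
      simp only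
      omega
  refine ⟨fun i hi => ?_, hr, fun i hi => ?_, ?_, fun w => ?_, fun w => ?_, ?_⟩
  · rw [← Multiset.mem_coe, hL, ← Multiset.count_pos, count_inl_labels] at hi
    by_contra hc
    simp [hc] at hi
  · rw [hL, count_inl_labels, if_pos hi]
  · obtain ⟨n, e, he, rfl⟩ := h
    rw [List.pairwise_ofFn]
    intro a b hab hc
    have := M.lt_of_before hc
    rw [← he] at this
    exact absurd this (not_lt.2 hab.le)
  · rw [← Multiset.sum_coe, ← Multiset.map_coe, hL, (sum_endInd_labels _ _ _ w).1, M.pair.sum_b]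
  · rw [← Multiset.sum_coe, ← Multiset.map_coe, hL, (sum_endInd_labels _ _ _ w).2, M.pair.sum_a]
  · rw [forall_crossing_iff fun t ht => (hr t ht).1]
    intro i hi
    rw [← Multiset.sum_coe, ← Multiset.map_coe, hL]
    have h1 := sum_flow_labels D.edges M.pair.a M.pair.b ⟨i, hi⟩
    have h2 := M.pair.weight_eq ⟨i, hi⟩
    rw [FloorDiagram.div] at h2
    simp only at h1
    rw [h1, add_comm ((M.pair.b ⟨i, hi⟩).weight), h2]
    ring

end FloorDiagram

theorem exists_equiv_of_coe_eq {X V : Type*} [DecidableEq X] [Fintype V] (L : List X) (l : V → X)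
    (h : (L : Multiset X) = (Finset.univ : Finset V).val.map l) :
    ∃ e : Fin L.length ≃ V, ∀ a, l (e a) = L.get a := by
  classical
  have key : ∀ x, Fintype.card {a // L.get a = x} = Fintype.card {v // l v = x} := by
    intro x
    rw [Fintype.card_subtype, Fintype.card_subtype]
    have h1 := congrArg (Multiset.count x) h
    rw [Multiset.count_map] at h1
    have h2 : (L : Multiset X) = (Finset.univ : Finset (Fin L.length)).val.map L.get := by
      rw [Fin.univ_val_map, List.ofFn_get]
    rw [h2, Multiset.count_map] at h1
    simp only [eq_comm (a := x)] at h1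
    exact h1
  let e := fun x => Fintype.equivOfCardEq (key x)
  exact ⟨Equiv.ofFiberEquiv e, fun a => Equiv.ofFiberEquiv_map e a⟩

/-! ### Reconstruction of a marked floor diagram from a valid word. -/

namespace FlatValid

variable {d : ℕ} {α β : TangencySeq} {L : List Lab}

/-- The counts of labels `(i, t, ·)` in a list. -/
noncomputable def countSeq (L : List Lab) (i t : ℕ) : TangencySeq :=
  Finsupp.ofSupportFinite (fun j => (L : Multiset Lab).count (.inr (i, t, j))) <| by
    refine Set.Finite.subset ((L.toFinset.finite_toSet).preimage
      (f := fun j : ℕ+ => (Sum.inr (i, t, j) : Lab)) ?_) ?_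
    · intro x _ y _ h
      simpa using h
    · intro j hj
      have : (Sum.inr (i, t, j) : Lab) ∈ (L : Multiset Lab) :=
        Multiset.count_ne_zero.1 (Function.mem_support.1 hj)
      simpa using this

theorem sum_countSeq (h : ∀ t, Sum.inr t ∈ L → t.1 < d) (t : ℕ) (w : ℕ+) :
    (L.map (endInd t w)).sum = (∑ i : Fin d, countSeq L i t) w := by
  rw [Finsupp.finsetSum_apply]
  simp only [countSeq, Finsupp.ofSupportFinite_coe]
  induction L with
  | nil => simp
  | cons x L ih =>
    rw [List.map_cons, List.sum_cons, ih fun t ht => h t (List.mem_cons_of_mem _ ht)]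
    simp only [← Multiset.cons_coe, Multiset.count_cons, Finset.sum_add_distrib]
    rw [add_comm]
    congr 1
    rcases x with i | ⟨s, t', w'⟩
    · simp [endInd]
    · have hs := h (s, t', w') (by simp)
      simp only [endInd, Sum.inr.injEq, Prod.mk.injEq]
      rw [Finset.sum_eq_single ⟨s, hs⟩]
      · simp [eq_comm]
      · intro k _ hk
        rw [if_neg]
        rintro ⟨h1, -⟩
        exact hk (Fin.ext h1)
      · simp

theorem coe_eq_labels (h : FlatValid d α β L) {E : Multiset (Fin d × Fin d × ℕ+)}
    (hE : mids d L = E.map FloorDiagram.midLab) :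
    (L : Multiset Lab) = FloorDiagram.labels E (fun i => countSeq L i (d + 1))
      fun i => countSeq L i d := by
  ext x
  rcases x with i | ⟨s, t, w⟩
  · rw [FloorDiagram.count_inl_labels]
    split_ifs with hi
    · exact h.count_floor i hi
    · rw [Multiset.count_eq_zero]
      exact fun hi' => hi (h.floor_lt i hi')
  · rw [FloorDiagram.count_inr_labels, ← hE, mids, Multiset.count_filter]
    have key : ∀ e, (∑ i : Fin d, if (i : ℕ) = s ∧ e = t then countSeq L i e w else 0) =
        if e = t then (L : Multiset Lab).count (.inr (s, t, w)) else 0 := by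
      intro e
      split_ifs with het
      · subst het
        by_cases hs : s < d
        · rw [Finset.sum_eq_single ⟨s, hs⟩]
          · simp [countSeq, Finsupp.ofSupportFinite_coe]
          · intro k _ hk
            rw [if_neg]
            rintro ⟨h1, -⟩
            exact hk (Fin.ext h1)
          · simp
        · rw [Finset.sum_eq_zero, eq_comm, Multiset.count_eq_zero]
          · exact fun h1 => hs (h.tok_range _ h1).2.1
          · intro i _
            rw [if_neg]
            have := i.2
            omega
      · exact Finset.sum_eq_zero fun i _ => if_neg (by simp [het])
    rw [key, key]
    by_cases hL : (Sum.inr (s, t, w) : Lab) ∈ (L : Multiset Lab)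
    · have := (h.tok_range _ (Multiset.mem_coe.1 hL)).2.2
      simp only [midInd] at this ⊢
      rcases lt_trichotomy t d with h1 | h1 | h1
      · simp [h1, h1.ne', show d + 1 ≠ t by omega]
      · simp [h1]
      · simp [show t = d + 1 by omega]
    · rw [Multiset.count_eq_zero.2 hL]
      simp

theorem tok_lt (h : FlatValid d α β L) (t : ℕ × ℕ × ℕ+) (ht : Sum.inr t ∈ L) : t.1 < t.2.1 :=
  (h.tok_range t ht).1

theorem weight_eq (h : FlatValid d α β L) {E : Multiset (Fin d × Fin d × ℕ+)}
    (hE : mids d L = E.map FloorDiagram.midLab) (i : Fin d) :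
    (((countSeq L i (d + 1)).weight + (countSeq L i d).weight : ℕ) : ℤ) = 1 - edgeDivergence E i := by
  have h1 := (FloorDiagram.forall_crossing_iff h.tok_lt d).1 h.cross i i.2
  rw [← Multiset.sum_coe, ← Multiset.map_coe, h.coe_eq_labels hE, FloorDiagram.sum_flow_labels] at h1
  push_cast at h1 ⊢
  linarith

/-- Occurrences of end labels give the compatible pair. Any label-preserving bijection between
positions and vertices then transports the order of the list, and the axioms hold because they
follow from constraints on labels. -/
theorem exists_isWord (h : FlatValid d α β L) {D : FloorDiagram d}
    (hE : mids d L = D.edges.map FloorDiagram.midLab) : ∃ M : D.Marking α β, M.IsWord L := by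
  let p : D.CompatiblePair α β :=
    { a := fun i => countSeq L i (d + 1)
      b := fun i => countSeq L i d
      sum_a := by
        ext w
        rw [← sum_countSeq (fun t ht => (h.tok_range t ht).2.1), h.alpha]
      sum_b := by
        ext w
        rw [← sum_countSeq (fun t ht => (h.tok_range t ht).2.1), h.beta]
      weight_eq := fun i => h.weight_eq hE i }
  have hL : (L : Multiset Lab) = (Finset.univ : Finset (FloorDiagram.ExtVertex p)).val.map
      FloorDiagram.ExtVertex.label := by
    rw [h.coe_eq_labels hE]
    have h1 := FloorDiagram.ExtVertex.sum_label p fun x => ({x} : Multiset Lab)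
    have h2 := FloorDiagram.sum_map_labels D.edges p.a p.b fun x => ({x} : Multiset Lab)
    rw [Multiset.sum_map_singleton] at h2
    refine h2.trans (h1.symm.trans ?_)
    rw [Finset.sum, ← Multiset.sum_map_singleton (Multiset.map FloorDiagram.ExtVertex.label _),
      Multiset.map_map]
    rfl
  obtain ⟨e, he⟩ := exists_equiv_of_coe_eq L _ hL
  have hlt : ∀ u v : FloorDiagram.ExtVertex p, Before d u.label v.label → e.symm u < e.symm v := by
    intro u v huv
    rcases lt_trichotomy (e.symm u) (e.symm v) with h1 | h1 | h1
    · exact h1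
    · rw [e.symm.injective h1] at huv
      exact absurd huv (before_irrefl d _)
    · have h2 := (List.pairwise_iff_get.1 h.order) _ _ h1
      rw [← he, ← he, e.apply_symm_apply, e.apply_symm_apply] at h2
      exact absurd huv h2
  have hord : IsStrictTotalOrder (FloorDiagram.ExtVertex p) fun u v => e.symm u < e.symm v :=
    { trichotomous := fun u v h1 h2 => e.symm.injective (le_antisymm (not_lt.1 h2) (not_lt.1 h1))
      irrefl := fun u => lt_irrefl _
      trans := fun u v w => lt_trans }
  refine ⟨⟨p, fun u v => e.symm u < e.symm v, hord, fun i j hij => hlt _ _ ?_,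
    fun u v w huv => hlt _ _ ?_, fun u v hu hv => hlt _ _ ?_, fun i j k i' j' k' hlt' => ?_⟩, L.length, e, ?_, ?_⟩
  · exact hij
  · rw [FloorDiagram.ExtVertex.edge_iff] at huv
    rcases hu : u.label with i | t <;> rcases hv : v.label with j | t' <;> rw [hu, hv] at huv <;>
      simp only [EdgeLab] at huv
    · exact Or.inl huv.1
    · exact huv.1
  · obtain ⟨t, ht, ht'⟩ := FloorDiagram.ExtVertex.isAlpha_iff.1 hv
    rw [FloorDiagram.ExtVertex.isAlpha_iff] at hu
    rw [ht]
    rcases hu' : u.label with i | t1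
    · exact Or.inr ht'
    · refine Or.inl ⟨fun hc => hu ⟨t1, hu', hc⟩, ht'⟩
  · by_contra hc
    refine absurd (hlt (.alpha i' j' k') (.alpha i j k) (Or.inr ⟨rfl, rfl, not_le.1 hc⟩)) ?_
    exact not_lt.2 hlt'.le
  · intro a b
    simp
  · refine (List.ofFn_get L).symm.trans ?_
    congr 1
    funext a
    exact (he a).symm

theorem mem_mids {x : Lab} (hx : x ∈ mids d L) : x ∈ L ∧ ∃ t, x = .inr t ∧ t.2.1 < d := by
  rw [mids, Multiset.mem_filter] at hx
  refine ⟨hx.1, ?_⟩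
  rcases x with i | t
  · simp [midInd] at hx
  · refine ⟨t, rfl, ?_⟩
    by_contra hc
    simp [midInd, hc] at hx

theorem exists_floorDiagram (h : FlatValid d α β L) :
    ∃ D : FloorDiagram d, mids d L = D.edges.map FloorDiagram.midLab := by
  have key : ∀ S : Multiset Lab, (∀ x ∈ S, x ∈ Set.range (FloorDiagram.midLab (d := d))) →
      ∃ E : Multiset (Fin d × Fin d × ℕ+), S = E.map FloorDiagram.midLab := by
    intro S
    induction S using Multiset.induction_on with
    | empty => exact fun _ => ⟨0, rfl⟩
    | cons x S ih =>
      intro hS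
      obtain ⟨E, rfl⟩ := ih fun y hy => hS y (Multiset.mem_cons_of_mem hy)
      obtain ⟨e, rfl⟩ := hS x (Multiset.mem_cons_self _ _)
      exact ⟨e ::ₘ E, by simp⟩
  obtain ⟨E, hE⟩ := key (mids d L) fun x hx => by
    obtain ⟨h1, t, rfl, h2⟩ := mem_mids hx
    exact ⟨(⟨t.1, (h.tok_range t h1).2.1⟩, ⟨t.2.1, h2⟩, t.2.2), rfl⟩
  refine ⟨⟨E, fun e he => ?_, fun j => ?_⟩, hE⟩
  · have h1 : FloorDiagram.midLab e ∈ mids d L := by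
      rw [hE]; exact Multiset.mem_map_of_mem _ he
    have h2 := h.tok_lt _ (mem_mids h1).1
    rw [Fin.lt_def]
    exact h2
  -- `1 - div` is the total weight of the ends at the floor, hence non-negative.
  · have := h.weight_eq hE j
    omega

end FlatValid

/-! ### The relative Severi degree as a sum over words. -/

namespace FloorDiagram

variable {d : ℕ} {α β : TangencySeq}

theorem numMarkings_eq (D : FloorDiagram d) (α β : TangencySeq) :
    D.numMarkings α β = {L | FlatValid d α β L ∧ mids d L = D.edges.map midLab}.ncard := by
  rw [numMarkings, ← Nat.card_coe_set_eq]
  let f : Quotient (markingSetoid D α β) →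
      {L | FlatValid d α β L ∧ mids d L = D.edges.map midLab} :=
    Quotient.lift (fun M => ⟨M.exists_isWord.choose,
      M.flatValid_of_isWord M.exists_isWord.choose_spec,
      M.mids_of_isWord M.exists_isWord.choose_spec⟩) fun M N hMN => by
        have h1 := M.exists_isWord.choose_spec.of_equivalent hMN
        exact Subtype.ext (h1.unique N.exists_isWord.choose_spec)
  refine Nat.card_congr (Equiv.ofBijective f ⟨?_, ?_⟩)
  · rintro ⟨M⟩ ⟨N⟩ h
    refine Quotient.sound ?_
    have h1 : M.exists_isWord.choose = N.exists_isWord.choose := congrArg Subtype.val h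
    have h2 := M.exists_isWord.choose_spec
    rw [h1] at h2
    exact h2.equivalent N.exists_isWord.choose_spec
  · rintro ⟨L, hL, hm⟩
    obtain ⟨M, hM⟩ := hL.exists_isWord hm
    exact ⟨Quotient.mk _ M, Subtype.ext (M.exists_isWord.choose_spec.unique hM)⟩

theorem sum_midInd (L : List Lab) : (L.map (midInd d)).sum = (mids d L).card := by
  induction L with
  | nil => rfl
  | cons x L ih =>
    rw [List.map_cons, List.sum_cons, ih, mids, mids, ← Multiset.cons_coe, Multiset.filter_cons,
      Multiset.card_add]
    congr 1
    rcases x with i | t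
    · simp [midInd]
    · by_cases h : t.2.1 < d <;> simp [midInd, h]

theorem prod_sqWeight (L : List Lab) :
    (L.map (sqWeight d)).prod = ((mids d L).map (sqWeight d)).prod := by
  induction L with
  | nil => rfl
  | cons x L ih =>
    rw [List.map_cons, List.prod_cons, ih, mids, mids, ← Multiset.cons_coe, Multiset.filter_cons,
      Multiset.map_add, Multiset.prod_add]
    congr 1
    rcases x with i | t
    · simp [midInd, sqWeight]
    · by_cases h : t.2.1 < d <;> simp [midInd, sqWeight, h]

theorem multiplicity_eq {D : FloorDiagram d} {L : List Lab} (h : mids d L = D.edges.map midLab) :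
    D.multiplicity = (L.map (sqWeight d)).prod := by
  rw [prod_sqWeight, h, Multiset.map_map, multiplicity]
  congr 1
  refine Multiset.map_congr rfl fun e _ => ?_
  simp [sqWeight, midLab]

theorem cogenus_eq_iff {D : FloorDiagram d} {L : List Lab} (h : mids d L = D.edges.map midLab)
    (δ : ℕ) : D.cogenus = (δ : ℤ) ↔ (L.map (midInd d)).sum + δ = d.choose 2 := by
  rw [cogenus_eq, sum_midInd, h, Multiset.card_map]
  omega

end FloorDiagram

-- The midpoints occurring in a word determine its floor diagram, so the double sum over diagrams
-- and classes of markings is a single sum over words. Finiteness is an assumption here; it comes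
-- out of the later count.
open FloorDiagram in
theorem relativeSeveriDegree_eq_sum_flat (δ : ℕ) (α β : TangencySeq) {d : ℕ}
    (hd : d = α.weight + β.weight)
    (hfin : {L | FlatValid d α β L ∧ (L.map (midInd d)).sum + δ = d.choose 2}.Finite) :
    relativeSeveriDegree δ α β = β.powProd * ∑ L ∈ hfin.toFinset, (L.map (sqWeight d)).prod := by
  classical
  subst hd
  rw [relativeSeveriDegree]
  have : Nonempty (FloorDiagram (α.weight + β.weight)) := ⟨⟨0, by simp, by simp [edgeDivergence]⟩⟩
  choose! dia hdia using fun L (hL : FlatValid (α.weight + β.weight) α β L) => hL.exists_floorDiagram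
  have hinj : ∀ {D D' : FloorDiagram (α.weight + β.weight)},
      D.edges.map midLab = D'.edges.map midLab → D = D' := fun h =>
    FloorDiagram.ext (Multiset.map_injective midLab_injective h)
  have hsum : ∀ D ∈ {D : FloorDiagram (α.weight + β.weight) | D.cogenus = (δ : ℤ)},
      β.powProd * D.multiplicity * D.numMarkings α β =
      β.powProd * ∑ L ∈ hfin.toFinset with dia L = D, (L.map (sqWeight (α.weight + β.weight))).prod := by
    intro D hD
    have hset : {L | FlatValid (α.weight + β.weight) α β L ∧
        mids (α.weight + β.weight) L = D.edges.map midLab} =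
        ((hfin.toFinset.filter fun L => dia L = D : Finset (List Lab)) : Set (List Lab)) := by
      ext L
      simp only [Set.mem_ofPred_eq, Finset.coe_filter, Set.Finite.mem_toFinset]
      constructor
      · rintro ⟨h1, h2⟩
        exact ⟨⟨h1, (cogenus_eq_iff h2 δ).1 hD⟩, hinj (by rw [← hdia L h1, h2])⟩
      · rintro ⟨⟨h1, -⟩, rfl⟩
        exact ⟨h1, hdia L h1⟩
    rw [numMarkings_eq, hset, Set.ncard_coe_finset, mul_assoc]
    congr 1
    rw [Finset.sum_congr rfl (g := fun _ => D.multiplicity), Finset.sum_const, smul_eq_mul, mul_comm]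
    intro L hL
    obtain ⟨h1, rfl⟩ := Finset.mem_filter.1 hL
    exact (multiplicity_eq (hdia L ((Set.Finite.mem_toFinset _).1 h1).1)).symm
  rw [finsum_mem_congr rfl hsum, finsum_mem_eq_sum_of_inter_support_eq (t := hfin.toFinset.image dia)]
  · rw [← Finset.mul_sum, ← Finset.sum_fiberwise_of_maps_to
      (fun L hL => Finset.mem_image_of_mem dia hL)]
  · ext D
    simp only [Set.mem_inter_iff, Set.mem_ofPred_eq, Function.mem_support, Finset.coe_image,
      Set.mem_image, SetLike.mem_coe]
    constructor
    · rintro ⟨h1, h2⟩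
      refine ⟨?_, h2⟩
      by_contra hc
      refine h2 ?_
      rw [Finset.sum_eq_zero, mul_zero]
      intro L hL
      exact absurd ⟨L, (Finset.mem_filter.1 hL).1, (Finset.mem_filter.1 hL).2⟩ hc
    · rintro ⟨⟨L, hL, rfl⟩, h2⟩
      refine ⟨?_, h2⟩
      have h3 := (Set.Finite.mem_toFinset _).1 hL
      exact (cogenus_eq_iff (hdia L h3.1) δ).2 h3.2

/-! ### Words cut at the floors into lists of tokens. -/

/-- A token `(a, b, w)` in the gap after the floor `g` stands for a vertex on an edge of weight `w`
from the floor `g - a` to the floor `g + 1 + b`. -/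
abbrev Tok := ℕ × ℕ × ℕ+

/-- The label described by a token. -/
def absTok (g : ℕ) (t : Tok) : Lab := .inr (g - t.1, g + 1 + t.2.1, t.2.2)

/-- The list of labels obtained from the lists of tokens in all gaps. -/
def joinWord (d : ℕ) (W : ℕ → List Tok) : List Lab :=
  ((List.range d).flatMap fun g => .inl g :: (W g).map (absTok g)) ++ (W d).map (absTok d)

/-- All tokens describe possible vertices: in the gaps before `d` midpoints and `β`-vertices, in
the last gap `α`-vertices. -/
def FitsWord (d : ℕ) (W : ℕ → List Tok) : Prop :=
  ∀ g, ∀ t ∈ W g, (g < d ∧ t.1 ≤ g ∧ g + t.2.1 < d) ∨ (g = d ∧ 1 ≤ t.1 ∧ t.1 ≤ d ∧ t.2.1 = 0)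

/-- The total weight crossing the gap `g`. -/
def crossWord (n : ℕ) (W : ℕ → List Tok) (g : ℕ) : ℕ :=
  ∑ p ∈ Finset.range n,
    ((W p).map fun t => if p ≤ g + t.1 ∧ g ≤ p + t.2.1 then (t.2.2 : ℕ) else 0).sum

/-- The lists of tokens coming from `(α, β)`-markings of floor diagrams of degree `d`. -/
structure ValidWord (d : ℕ) (α β : TangencySeq) (W : ℕ → List Tok) : Prop where
  fits : FitsWord d W
  sorted : (W d).Pairwise fun x y => x.2.2 ≤ y.2.2
  beta : ∀ w, ∑ g ∈ Finset.range d,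
    ((W g).map fun t => if g + 1 + t.2.1 = d ∧ t.2.2 = w then 1 else 0).sum = β w
  alpha : ∀ w, ((W d).map fun t => if t.2.2 = w then 1 else 0).sum = α w
  cross : ∀ g < d, crossWord (d + 1) W g = g + 1

/-- The number of midpoints. -/
def midCount (d : ℕ) (W : ℕ → List Tok) : ℕ :=
  ∑ g ∈ Finset.range d, ((W g).map fun t => if g + 1 + t.2.1 < d then 1 else 0).sum

/-- The contribution of a word to the relative Severi degree. -/
def wordWeight (d : ℕ) (W : ℕ → List Tok) : ℕ :=
  ∏ g ∈ Finset.range d,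
    ((W g).map fun t => if g + 1 + t.2.1 < d then (t.2.2 : ℕ) ^ 2 else 1).prod

theorem sum_map_joinWord {A : Type*} [AddCommMonoid A] (d : ℕ) (W : ℕ → List Tok) (f : Lab → A) :
    ((joinWord d W).map f).sum = ∑ g ∈ Finset.range d,
      (f (.inl g) + ((W g).map fun t => f (absTok g t)).sum) +
      ((W d).map fun t => f (absTok d t)).sum := by
  have key : ∀ m, (((List.range m).flatMap fun g => (Sum.inl g : Lab) :: (W g).map (absTok g)).map f).sum
      = ∑ g ∈ Finset.range m, (f (.inl g) + ((W g).map fun t => f (absTok g t)).sum) := by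
    intro m
    induction m with
    | zero => simp
    | succ m ih =>
      rw [List.range_succ, List.flatMap_append, List.map_append, List.sum_append, ih,
        Finset.sum_range_succ]
      simp [Function.comp_def]
  rw [joinWord, List.map_append, List.sum_append, key, List.map_map]
  rfl

theorem prod_map_joinWord (d : ℕ) (W : ℕ → List Tok) (f : Lab → ℕ) :
    ((joinWord d W).map f).prod = (∏ g ∈ Finset.range d,
      (f (.inl g) * ((W g).map fun t => f (absTok g t)).prod)) *
      ((W d).map fun t => f (absTok d t)).prod := by
  have key : ∀ m, (((List.range m).flatMap fun g => (Sum.inl g : Lab) :: (W g).map (absTok g)).map f).prod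
      = ∏ g ∈ Finset.range m, (f (.inl g) * ((W g).map fun t => f (absTok g t)).prod) := by
    intro m
    induction m with
    | zero => simp
    | succ m ih =>
      rw [List.range_succ, List.flatMap_append, List.map_append, List.prod_append, ih,
        Finset.prod_range_succ]
      simp [Function.comp_def]
  rw [joinWord, List.map_append, List.prod_append, key, List.map_map]
  rfl

theorem mem_joinWord {d : ℕ} {W : ℕ → List Tok} {x : Lab} : x ∈ joinWord d W ↔
    (∃ g < d, x = .inl g ∨ ∃ t ∈ W g, absTok g t = x) ∨ ∃ t ∈ W d, absTok d t = x := by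
  simp [joinWord]

theorem inr_mem_joinWord {d : ℕ} {W : ℕ → List Tok} {s : ℕ × ℕ × ℕ+}
    (h : (.inr s : Lab) ∈ joinWord d W) : ∃ g ≤ d, ∃ t ∈ W g, absTok g t = .inr s := by
  rcases mem_joinWord.1 h with ⟨g, hg, h | h⟩ | h
  · cases h
  · exact ⟨g, hg.le, h⟩
  · exact ⟨d, le_rfl, h⟩

theorem FitsWord.pairwise_joinWord {d : ℕ} {W : ℕ → List Tok} (h : FitsWord d W)
    (hs : (W d).Pairwise fun x y => x.2.2 ≤ y.2.2) :
    (joinWord d W).Pairwise fun x y => ¬ Before d y x := by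
  have h1 : ∀ g < d, ∀ t ∈ W g, t.1 ≤ g ∧ g + t.2.1 < d := by
    intro g hg t ht
    rcases h g t ht with h | h <;> omega
  have h2 : ∀ t ∈ W d, 1 ≤ t.1 ∧ t.1 ≤ d ∧ t.2.1 = 0 := by
    intro t ht
    rcases h d t ht with h | h <;> omega
  rw [joinWord, List.pairwise_append, List.pairwise_flatMap]
  refine ⟨⟨fun g hg => ?_, ?_⟩, ?_, ?_⟩
  · have hg' := List.mem_range.1 hg
    rw [List.pairwise_cons, List.pairwise_map]
    refine ⟨fun x hx => ?_, ?_⟩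
    · obtain ⟨t, ht, rfl⟩ := List.mem_map.1 hx
      simp only [absTok, Before]
      omega
    · refine List.Pairwise.imp_of_mem (R := fun _ _ => True) (fun {x y} hx hy _ => ?_)
        (List.pairwise_iff_get.2 fun _ _ _ => trivial)
      have := h1 g hg' x hx
      have := h1 g hg' y hy
      simp only [absTok, Before]
      omega
  · refine List.Pairwise.imp_of_mem ?_ (List.pairwise_lt_range (n := d))
    intro g g' hg hg' hlt x hx y hy
    have hg := List.mem_range.1 hg
    have hg' := List.mem_range.1 hg'
    rw [List.mem_cons, List.mem_map] at hx hy
    rcases hx with rfl | ⟨t, ht, rfl⟩ <;> rcases hy with rfl | ⟨t', ht', rfl⟩ <;>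
      simp only [absTok, Before]
    · omega
    · omega
    · have := h1 g hg t ht
      omega
    · have := h1 g hg t ht
      have := h1 g' hg' t' ht'
      omega
  · rw [List.pairwise_map]
    refine hs.imp_of_mem fun {x y} hx hy hxy => ?_
    have := h2 x hx
    have := h2 y hy
    simp only [absTok, Before]
    rintro (h | h)
    · omega
    · exact absurd h.2.2 (not_lt.2 hxy)
  · intro x hx y hy
    obtain ⟨t', ht', rfl⟩ := List.mem_map.1 hy
    obtain ⟨g, hg, hx⟩ := List.mem_flatMap.1 hx
    have hg := List.mem_range.1 hg
    have := h2 t' ht'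
    rw [List.mem_cons, List.mem_map] at hx
    rcases hx with rfl | ⟨t, ht, rfl⟩ <;> simp only [absTok, Before]
    · omega
    · have := h1 g hg t ht
      omega

theorem count_inl_joinWord (d : ℕ) (W : ℕ → List Tok) {i : ℕ} (hi : i < d) :
    (joinWord d W : Multiset Lab).count (.inl i) = 1 := by
  rw [FloorDiagram.Multiset.count_eq_sum_map, Multiset.map_coe, Multiset.sum_coe, sum_map_joinWord]
  simp [absTok, hi]

/-- With every token in an admissible gap, all order constraints hold by construction except the
monotonicity of the weights of the `α`-vertices. -/
theorem flatValid_joinWord {d : ℕ} {α β : TangencySeq} {W : ℕ → List Tok} (h : FitsWord d W) :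
    FlatValid d α β (joinWord d W) ↔ ValidWord d α β W := by
  have h1 : ∀ g ∈ Finset.range d, ∀ t ∈ W g, t.1 ≤ g ∧ g + t.2.1 < d := by
    intro g hg t ht
    have := Finset.mem_range.1 hg
    rcases h g t ht with h | h <;> omega
  have h2 : ∀ t ∈ W d, 1 ≤ t.1 ∧ t.1 ≤ d ∧ t.2.1 = 0 := by
    intro t ht
    rcases h d t ht with h | h <;> omega
  have hb : ∀ w, ((joinWord d W).map (endInd d w)).sum = ∑ g ∈ Finset.range d,
      ((W g).map fun t => if g + 1 + t.2.1 = d ∧ t.2.2 = w then 1 else 0).sum := by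
    intro w
    rw [sum_map_joinWord, List.sum_eq_zero]
    · simp [endInd, absTok]
    · intro x hx
      obtain ⟨t, ht, rfl⟩ := List.mem_map.1 hx
      simp only [endInd, absTok]
      rw [if_neg (by omega)]
  have ha : ∀ w, ((joinWord d W).map (endInd (d + 1) w)).sum =
      ((W d).map fun t => if t.2.2 = w then 1 else 0).sum := by
    intro w
    rw [sum_map_joinWord, Finset.sum_eq_zero, zero_add]
    · congr 1
      refine List.map_congr_left fun t ht => ?_
      simp [endInd, absTok, (h2 t ht).2.2]
    · intro g hg
      rw [List.sum_eq_zero]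
      · rfl
      · intro x hx
        obtain ⟨t, ht, rfl⟩ := List.mem_map.1 hx
        have := h1 g hg t ht
        simp only [endInd, absTok]
        rw [if_neg (by omega)]
  have hc : ∀ g, ((joinWord d W).map (crossing g)).sum = crossWord (d + 1) W g := by
    intro g
    rw [sum_map_joinWord, crossWord, Finset.sum_range_succ]
    congr 1
    · refine Finset.sum_congr rfl fun p hp => ?_
      simp only [crossing, zero_add]
      congr 1
      refine List.map_congr_left fun t ht => ?_
      have := h1 p hp t ht
      simp only [absTok]
      congr 1
      rw [eq_iff_iff]
      omega
    · congr 1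
      refine List.map_congr_left fun t ht => ?_
      have := h2 t ht
      simp only [absTok, crossing]
      congr 1
      rw [eq_iff_iff]
      omega
  constructor
  · intro hv
    refine ⟨h, ?_, fun w => (hb w).symm.trans (hv.beta w), fun w => (ha w).symm.trans (hv.alpha w),
      fun g hg => (hc g).symm.trans (hv.cross g hg)⟩
    have h3 := hv.order
    rw [joinWord, List.pairwise_append] at h3
    have h4 := h3.2.1
    rw [List.pairwise_map] at h4
    refine h4.imp_of_mem fun {x y} hx hy hxy => ?_
    by_contra hc
    refine hxy (Or.inr ⟨?_, ?_, not_le.1 hc⟩)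
    · have := h2 y hy; simp only; omega
    · have := h2 x hx; simp only; omega
  · intro hv
    refine ⟨fun i hi => ?_, fun t ht => ?_, fun i hi => count_inl_joinWord d W hi,
      h.pairwise_joinWord hv.sorted, fun w => (hb w).trans (hv.beta w),
      fun w => (ha w).trans (hv.alpha w), fun g hg => (hc g).trans (hv.cross g hg)⟩
    · rcases mem_joinWord.1 hi with ⟨g, hg, h | ⟨t, -, h⟩⟩ | ⟨t, -, h⟩
      · cases h; exact hg
      · cases h
      · cases h
    · obtain ⟨g, hg, t', ht', h5⟩ := inr_mem_joinWord ht
      cases h5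
      rcases h g t' ht' with h | h <;> simp only <;> omega

theorem eq_filter_append_filter {X : Type*} (p : X → Bool) (L : List X)
    (h : L.Pairwise fun x y => p x → p y) : L = L.filter (fun x => !p x) ++ L.filter p := by
  induction L with
  | nil => rfl
  | cons x L ih =>
    rw [List.pairwise_cons] at h
    by_cases hx : p x
    · have h1 : ∀ y ∈ L, p y := fun y hy => h.1 y hy hx
      rw [List.filter_cons_of_neg (by simp [hx]), List.filter_cons_of_pos hx,
        List.filter_eq_self.2 h1, List.filter_eq_nil_iff.2 (by simpa using h1)]
      rfl
    · rw [List.filter_cons_of_pos (by simp [hx]), List.filter_cons_of_neg hx, List.cons_append,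
        ← ih h.2]

/-- The floors occurring in a list of labels. -/
def floorsOf (L : List Lab) : List ℕ := L.filterMap Sum.getLeft?

/-- The entries `pre` before the first floor are there for the induction along the list; in a valid
word they are absent, since every vertex follows its source. -/
theorem exists_blocks (L : List Lab) : ∀ (m k : ℕ), floorsOf L = List.range' k m →
    ∃ (pre : List (ℕ × ℕ × ℕ+)) (V : ℕ → List (ℕ × ℕ × ℕ+)),
      L = pre.map .inr ++ (List.range' k m).flatMap fun g => .inl g :: (V g).map .inr := by
  induction L with
  | nil =>
    intro m k h
    have hm : m = 0 := by simpa [floorsOf] using (congrArg List.length h).symm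
    subst hm
    exact ⟨[], fun _ => [], rfl⟩
  | cons x L ih =>
    intro m k h
    rcases x with i | t
    · have h' : i :: floorsOf L = List.range' k m := h
      rcases m with _ | m
      · simp at h'
      · rw [List.range'_succ, List.cons.injEq] at h'
        obtain ⟨rfl, h'⟩ := h'
        obtain ⟨pre, V, hV⟩ := ih m _ h'
        refine ⟨[], fun g => if g = i then pre else V g, ?_⟩
        rw [List.range'_succ, List.flatMap_cons, hV]
        simp only [List.map_nil, List.nil_append, if_true, List.cons_append]
        congr 2
        refine List.flatMap_congr fun g hg => ?_
        rw [if_neg]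
        have := (List.mem_range'_1.1 hg).1
        omega
    · obtain ⟨pre, V, hV⟩ := ih m k h
      exact ⟨t :: pre, V, by rw [hV]; rfl⟩

theorem blocks_injective (m : ℕ) : ∀ (k : ℕ) (pre pre' : List (ℕ × ℕ × ℕ+))
    (V V' : ℕ → List (ℕ × ℕ × ℕ+)),
    (pre.map (.inr : _ → Lab) ++ (List.range' k m).flatMap fun g => .inl g :: (V g).map .inr) =
      (pre'.map .inr ++ (List.range' k m).flatMap fun g => .inl g :: (V' g).map .inr) →
    pre = pre' ∧ ∀ g, k ≤ g → g < k + m → V g = V' g := by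
  induction m with
  | zero =>
    intro k pre pre' V V' h
    simp only [List.range'_zero, List.flatMap_nil, List.append_nil] at h
    exact ⟨List.map_injective_iff.2 Sum.inr_injective h, fun g h1 h2 => by omega⟩
  | succ m ih =>
    intro k pre
    induction pre with
    | nil =>
      intro pre' V V' h
      rcases pre' with _ | ⟨t, pre'⟩
      · simp only [List.map_nil, List.nil_append, List.range'_succ, List.flatMap_cons,
          List.cons_append, List.cons.injEq, true_and] at h
        obtain ⟨h1, h2⟩ := ih _ _ _ _ _ h
        refine ⟨rfl, fun g hg hg' => ?_⟩
        rcases eq_or_lt_of_le hg with rfl | hg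
        · exact h1
        · exact h2 g (by omega) (by omega)
      · simp [List.range'_succ] at h
    | cons t pre ihp =>
      intro pre' V V' h
      rcases pre' with _ | ⟨t', pre'⟩
      · simp [List.range'_succ] at h
      · simp only [List.map_cons, List.cons_append, List.cons.injEq, Sum.inr.injEq] at h
        obtain ⟨h1, h2⟩ := ihp _ _ _ h.2
        exact ⟨by rw [h.1, h1], h2⟩

theorem count_floorsOf (L : List Lab) (i : ℕ) :
    (floorsOf L : Multiset ℕ).count i = (L : Multiset Lab).count (.inl i) := by
  induction L with
  | nil => rfl
  | cons x L ih =>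
    rcases x with j | t
    · have h : floorsOf (.inl j :: L) = j :: floorsOf L := rfl
      rw [h, ← Multiset.cons_coe, ← Multiset.cons_coe, Multiset.count_cons, Multiset.count_cons, ih]
      simp
    · have h : floorsOf (.inr t :: L) = floorsOf L := rfl
      rw [h, ← Multiset.cons_coe, Multiset.count_cons, ih]
      simp

theorem exists_map_absTok (g : ℕ) (P : Tok → Prop) (S : List Lab)
    (h : ∀ x ∈ S, ∃ t, P t ∧ absTok g t = x) :
    ∃ l : List Tok, (∀ t ∈ l, P t) ∧ l.map (absTok g) = S := by
  induction S with
  | nil => exact ⟨[], by simp, rfl⟩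
  | cons x S ih =>
    obtain ⟨l, h1, rfl⟩ := ih fun y hy => h y (List.mem_cons_of_mem _ hy)
    obtain ⟨t, h2, rfl⟩ := h x List.mem_cons_self
    refine ⟨t :: l, fun s hs => ?_, rfl⟩
    rcases List.mem_cons.1 hs with rfl | hs
    · exact h2
    · exact h1 s hs

theorem FlatValid.floorsOf_eq {d : ℕ} {α β : TangencySeq} {L : List Lab} (h : FlatValid d α β L) :
    floorsOf L = List.range d := by
  have hmem : ∀ i, i ∈ floorsOf L ↔ i < d := by
    intro i
    rw [← Multiset.mem_coe, ← Multiset.count_pos, count_floorsOf]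
    constructor
    · intro h1
      exact h.floor_lt i (Multiset.mem_coe.1 (Multiset.count_pos.1 h1))
    · intro h1
      rw [h.count_floor i h1]
      exact one_pos
  have hnd : (floorsOf L).Nodup := by
    rw [← Multiset.coe_nodup, Multiset.nodup_iff_count_le_one]
    intro i
    by_cases hi : i < d
    · rw [count_floorsOf, h.count_floor i hi]
    · rw [Multiset.count_eq_zero.2 fun hc => hi ((hmem i).1 hc)]
      exact Nat.zero_le _
  refine List.Perm.eq_of_pairwise (le := fun i j => i ≤ j) (fun a b _ _ => le_antisymm) ?_ ?_
    ((List.perm_ext_iff_of_nodup hnd List.nodup_range).2 fun i => by rw [hmem, List.mem_range])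
  · rw [floorsOf, List.pairwise_filterMap]
    refine h.order.imp ?_
    rintro (i | t) (j | t') hxy a ha b hb <;> simp at ha hb
    subst ha hb
    exact not_lt.1 hxy
  · exact (List.pairwise_lt_range).imp le_of_lt

/-- Being the label of an `α`-vertex. -/
def isAlphaLab (d : ℕ) : Lab → Bool
  | .inl _ => false
  | .inr t => t.2.1 == d + 1

theorem isAlphaLab_iff {d : ℕ} {x : Lab} :
    isAlphaLab d x = true ↔ ∃ t, x = .inr t ∧ t.2.1 = d + 1 := by
  rcases x with i | t <;> simp [isAlphaLab]

/-- No floor separates the `α`-vertices from the gap before them, so they are split off first, as a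
final segment. The remaining list is cut at its floors, and the order constraints put each token
between its source and its target. -/
theorem FlatValid.exists_joinWord {d : ℕ} {α β : TangencySeq} {L : List Lab}
    (h : FlatValid d α β L) : ∃ W, FitsWord d W ∧ joinWord d W = L := by
  have hL : L = L.filter (fun x => !isAlphaLab d x) ++ L.filter (isAlphaLab d) := by
    refine eq_filter_append_filter _ L (h.order.imp ?_)
    intro x y hxy hx
    obtain ⟨t, rfl, ht⟩ := isAlphaLab_iff.1 hx
    rcases y with i | t'
    · exact absurd (Or.inr ht) hxy
    · by_contra hc
      rw [isAlphaLab_iff] at hc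
      exact hxy (Or.inl ⟨fun h1 => hc ⟨t', rfl, h1⟩, ht⟩)
  set L1 := L.filter (fun x => !isAlphaLab d x) with hL1
  set L2 := L.filter (isAlphaLab d) with hL2
  have hf2 : floorsOf L2 = [] := by
    rw [floorsOf, List.filterMap_eq_nil_iff]
    intro x hx
    obtain ⟨t, rfl, -⟩ := isAlphaLab_iff.1 (List.mem_filter.1 hx).2
    rfl
  have hf : floorsOf L1 = List.range' 0 d := by
    have h1 := h.floorsOf_eq
    rw [hL, floorsOf, List.filterMap_append] at h1
    change floorsOf L1 ++ floorsOf L2 = _ at h1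
    rw [hf2, List.append_nil] at h1
    rw [h1, List.range_eq_range']
  obtain ⟨pre, V, hV⟩ := exists_blocks L1 d 0 hf
  rw [← List.range_eq_range'] at hV
  have hp1 : L1.Pairwise fun x y => ¬ Before d y x := h.order.sublist List.filter_sublist
  have hmem1 : ∀ x ∈ L1, x ∈ L ∧ isAlphaLab d x = false := fun x hx => by
    simpa [hL1] using hx
  obtain rfl : pre = [] := by
    rcases pre with _ | ⟨t, pre⟩
    · rfl
    · exfalso
      have h1 : (.inr t : Lab) ∈ L1 := by rw [hV]; simp
      have h2 := (h.tok_range t (hmem1 _ h1).1).2.1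
      rw [hV, List.pairwise_append] at hp1
      refine hp1.2.2 (.inr t) (by simp) (.inl t.1) ?_ (Or.inl rfl)
      exact List.mem_flatMap.2 ⟨t.1, List.mem_range.2 h2, List.mem_cons_self⟩
  rw [List.map_nil, List.nil_append] at hV
  have hrange : ∀ g < d, ∀ t ∈ V g, t.1 ≤ g ∧ g < t.2.1 ∧ t.2.1 ≤ d := by
    intro g hg t ht
    have hb : (.inr t : Lab) ∈ (Sum.inl g : Lab) :: (V g).map .inr :=
      List.mem_cons_of_mem _ (List.mem_map_of_mem ht)
    have h1 : (.inr t : Lab) ∈ L1 := by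
      rw [hV]
      exact List.mem_flatMap.2 ⟨g, List.mem_range.2 hg, hb⟩
    obtain ⟨h2, h3⟩ := hmem1 _ h1
    obtain ⟨h4, h5, h6⟩ := h.tok_range t h2
    have h7 : t.2.1 ≠ d + 1 := fun hc => by simp [isAlphaLab, hc] at h3
    have hp2 := hp1
    rw [hV, List.pairwise_flatMap] at hp2
    obtain ⟨hp3, hp4⟩ := hp2
    have hcross : ∀ g g', g < g' → g' < d → ∀ x ∈ (Sum.inl g : Lab) :: (V g).map .inr,
        ∀ y ∈ (Sum.inl g' : Lab) :: (V g').map .inr, ¬ Before d y x := by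
      intro g g' hgg hg' x hx y hy
      have := List.pairwise_iff_getElem.1 hp4 g g' (by simp; omega) (by simpa using hg') hgg
      simp only [List.getElem_range] at this
      exact this x hx y hy
    refine ⟨?_, ?_, by omega⟩
    · by_contra hc
      exact hcross g t.1 (by omega) h5 _ hb _ List.mem_cons_self (Or.inl rfl)
    · by_contra hc
      rcases eq_or_lt_of_le (not_lt.1 hc) with h8 | h8
      · have h9 := hp3 g (List.mem_range.2 hg)
        rw [List.pairwise_cons] at h9
        exact h9.1 (.inr t) (List.mem_map_of_mem ht) h8
      · exact hcross t.2.1 g h8 hg _ List.mem_cons_self _ hb rfl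
  have hW : ∀ g, ∃ l : List Tok, (∀ t ∈ l, (g < d ∧ t.1 ≤ g ∧ g + t.2.1 < d) ∨
      (g = d ∧ 1 ≤ t.1 ∧ t.1 ≤ d ∧ t.2.1 = 0)) ∧
      (g < d → l.map (absTok g) = (V g).map .inr) ∧ (g = d → l.map (absTok g) = L2) := by
    intro g
    rcases lt_trichotomy g d with hg | hg | hg
    · obtain ⟨l, h1, h2⟩ := exists_map_absTok g (fun t => (g < d ∧ t.1 ≤ g ∧ g + t.2.1 < d) ∨
        (g = d ∧ 1 ≤ t.1 ∧ t.1 ≤ d ∧ t.2.1 = 0)) ((V g).map .inr) fun x hx => by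
        obtain ⟨t, ht, rfl⟩ := List.mem_map.1 hx
        have := hrange g hg t ht
        refine ⟨(g - t.1, t.2.1 - 1 - g, t.2.2), Or.inl ⟨hg, by simp only; omega, by simp only; omega⟩, ?_⟩
        simp only [absTok, Sum.inr.injEq]
        ext <;> simp only <;> omega
      exact ⟨l, h1, fun _ => h2, fun hc => by omega⟩
    · obtain ⟨l, h1, h2⟩ := exists_map_absTok g (fun t => (g < d ∧ t.1 ≤ g ∧ g + t.2.1 < d) ∨
        (g = d ∧ 1 ≤ t.1 ∧ t.1 ≤ d ∧ t.2.1 = 0)) L2 fun x hx => by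
        obtain ⟨h1, h2⟩ := List.mem_filter.1 hx
        obtain ⟨t, rfl, ht⟩ := isAlphaLab_iff.1 h2
        have := h.tok_range t h1
        refine ⟨(d - t.1, 0, t.2.2), Or.inr ⟨hg, by simp only; omega, by simp only; omega, rfl⟩, ?_⟩
        simp only [absTok, Sum.inr.injEq]
        ext <;> simp only <;> omega
      exact ⟨l, h1, fun hc => by omega, fun _ => h2⟩
    · exact ⟨[], by simp, fun hc => by omega, fun hc => by omega⟩
  choose W hW1 hW2 hW3 using hW
  refine ⟨W, hW1, ?_⟩
  rw [hL, joinWord, hW3 d rfl, hV]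
  congr 1
  refine List.flatMap_congr fun g hg => ?_
  rw [hW2 g (List.mem_range.1 hg)]

/-- The truncated difference `g - t.1` determines `t.1` only when `t.1 ≤ g`, which `FitsWord`
ensures. -/
theorem absTok_injOn (g : ℕ) {t t' : Tok} (ht : t.1 ≤ g) (ht' : t'.1 ≤ g)
    (h : absTok g t = absTok g t') : t = t' := by
  simp only [absTok, Sum.inr.injEq, Prod.mk.injEq] at h
  ext
  · omega
  · omega
  · rw [h.2.2]

theorem map_absTok_injective (g : ℕ) : ∀ {l l' : List Tok}, (∀ t ∈ l, t.1 ≤ g) →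
    (∀ t ∈ l', t.1 ≤ g) → l.map (absTok g) = l'.map (absTok g) → l = l'
  | [], [], _, _, _ => rfl
  | [], _ :: _, _, _, h => by simp at h
  | _ :: _, [], _, _, h => by simp at h
  | t :: l, t' :: l', h, h', e => by
    simp only [List.map_cons, List.cons.injEq] at e
    rw [absTok_injOn g (h t List.mem_cons_self) (h' t' List.mem_cons_self) e.1,
      map_absTok_injective g (fun s hs => h s (List.mem_cons_of_mem _ hs))
        (fun s hs => h' s (List.mem_cons_of_mem _ hs)) e.2]

theorem filter_joinWord {d : ℕ} {W : ℕ → List Tok} (h : FitsWord d W) :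
    (joinWord d W).filter (isAlphaLab d) = (W d).map (absTok d) ∧
    (joinWord d W).filter (fun x => !isAlphaLab d x) =
      (List.range d).flatMap fun g => .inl g :: (W g).map (absTok g) := by
  have h1 : ∀ x ∈ (List.range d).flatMap fun g => (.inl g : Lab) :: (W g).map (absTok g),
      isAlphaLab d x = false := by
    intro x hx
    obtain ⟨g, hg, hx⟩ := List.mem_flatMap.1 hx
    have hg := List.mem_range.1 hg
    rw [List.mem_cons, List.mem_map] at hx
    rcases hx with rfl | ⟨t, ht, rfl⟩
    · rfl
    · have := h g t ht
      simp only [absTok, isAlphaLab, beq_eq_false_iff_ne]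
      omega
  have h2 : ∀ x ∈ (W d).map (absTok d), isAlphaLab d x = true := by
    intro x hx
    obtain ⟨t, ht, rfl⟩ := List.mem_map.1 hx
    have := h d t ht
    simp only [absTok, isAlphaLab, beq_iff_eq]
    omega
  rw [joinWord, List.filter_append, List.filter_append, List.filter_eq_self.2 h2,
    List.filter_eq_nil_iff.2 (by simpa using h1), List.filter_eq_self.2 (by simpa using h1),
    List.filter_eq_nil_iff.2 (by simpa using h2)]
  simp

theorem joinWord_injOn (d : ℕ) : Set.InjOn (joinWord d) {W | FitsWord d W} := by
  intro W hW W' hW' h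
  have hle : ∀ {W : ℕ → List Tok}, FitsWord d W → ∀ g, ∀ t ∈ W g, t.1 ≤ g := by
    intro W hW g t ht
    have := hW g t ht
    omega
  obtain ⟨h1, h2⟩ := filter_joinWord hW
  obtain ⟨h1', h2'⟩ := filter_joinWord hW'
  rw [h, h1'] at h1
  rw [h, h2'] at h2
  funext g
  rcases lt_trichotomy g d with hg | hg | hg
  · let U : (ℕ → List Tok) → ℕ → List (ℕ × ℕ × ℕ+) := fun W g =>
      (W g).map fun t => (g - t.1, g + 1 + t.2.1, t.2.2)
    have hU : ∀ W g, (W g).map (absTok g) = (U W g).map (.inr : _ → Lab) := by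
      intro W g
      rw [List.map_map]
      rfl
    simp only [hU, List.range_eq_range'] at h2
    have h3 := (blocks_injective d 0 [] [] (U W') (U W) (by simpa using h2)).2 g (by omega) (by omega)
    refine map_absTok_injective g (hle hW g) (hle hW' g) ?_
    rw [hU, hU, h3]
  · subst hg
    exact map_absTok_injective g (hle hW g) (hle hW' g) h1.symm
  · have : ∀ {W : ℕ → List Tok}, FitsWord d W → W g = [] := by
      intro W hW
      refine List.eq_nil_iff_forall_not_mem.2 fun t ht => ?_
      have := hW g t ht
      omega
    rw [this hW, this hW']

theorem relativeSeveriDegree_eq_sum_word (δ : ℕ) (α β : TangencySeq) {d : ℕ}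
    (hd : d = α.weight + β.weight)
    (hfin : {W | ValidWord d α β W ∧ midCount d W + δ = d.choose 2}.Finite) :
    relativeSeveriDegree δ α β = β.powProd * ∑ W ∈ hfin.toFinset, wordWeight d W := by
  have hmid : ∀ W, FitsWord d W → ((joinWord d W).map (midInd d)).sum = midCount d W := by
    intro W hW
    rw [sum_map_joinWord, midCount, List.sum_eq_zero]
    · simp [midInd, absTok]
    · intro x hx
      obtain ⟨t, ht, rfl⟩ := List.mem_map.1 hx
      simp [midInd, absTok]
      omega
  have hwt : ∀ W, FitsWord d W → ((joinWord d W).map (sqWeight d)).prod = wordWeight d W := by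
    intro W hW
    rw [prod_map_joinWord, wordWeight, List.prod_eq_one (l := (W d).map _)]
    · simp [sqWeight, absTok]
    · intro x hx
      obtain ⟨t, ht, rfl⟩ := List.mem_map.1 hx
      simp only [sqWeight, absTok]
      rw [if_neg (by omega)]
  have himg : joinWord d '' {W | ValidWord d α β W ∧ midCount d W + δ = d.choose 2} =
      {L | FlatValid d α β L ∧ (L.map (midInd d)).sum + δ = d.choose 2} := by
    ext L
    constructor
    · rintro ⟨W, ⟨h1, h2⟩, rfl⟩
      exact ⟨(flatValid_joinWord h1.fits).2 h1, by rw [hmid W h1.fits, h2]⟩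
    · rintro ⟨h1, h2⟩
      obtain ⟨W, h3, rfl⟩ := h1.exists_joinWord
      exact ⟨W, ⟨(flatValid_joinWord h3).1 h1, by rw [← hmid W h3, h2]⟩, rfl⟩
  have hfin' : {L | FlatValid d α β L ∧ (L.map (midInd d)).sum + δ = d.choose 2}.Finite := by
    rw [← himg]; exact hfin.image _
  rw [relativeSeveriDegree_eq_sum_flat δ α β hd hfin']
  congr 1
  symm
  refine Finset.sum_bij (fun W _ => joinWord d W) ?_ ?_ ?_ ?_
  · intro W hW
    rw [Set.Finite.mem_toFinset, ← himg]
    exact ⟨W, (Set.Finite.mem_toFinset _).1 hW, rfl⟩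
  · intro W hW W' hW' h
    exact joinWord_injOn d ((Set.Finite.mem_toFinset _).1 hW).1.fits
      ((Set.Finite.mem_toFinset _).1 hW').1.fits h
  · intro L hL
    rw [Set.Finite.mem_toFinset, ← himg] at hL
    obtain ⟨W, hW, rfl⟩ := hL
    exact ⟨W, (Set.Finite.mem_toFinset _).2 hW, rfl⟩
  · intro W hW
    exact (hwt W ((Set.Finite.mem_toFinset _).1 hW).1.fits).symm

/-! ### Counting lists with prescribed nontrivial entries. -/

section ListCounting

variable {X : Type*} [DecidableEq X]

/-- The list is determined by the positions of the entries of `l` among `N`. Distinguishing whether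
the head is `x₀` gives Pascal's rule. -/
theorem exists_finset_filter_length (nt : X → Bool) (x₀ : X) (h₀ : ∀ x, nt x = false ↔ x = x₀) :
    ∀ (N : ℕ) (l : List X), (∀ x ∈ l, nt x = true) → ∃ F : Finset (List X),
      (∀ L, L ∈ F ↔ L.filter nt = l ∧ L.length = N) ∧ F.card = N.choose l.length := by
  have hx₀ : nt x₀ = false := (h₀ x₀).2 rfl
  intro N
  induction N with
  | zero =>
    rintro (_ | ⟨y, l⟩) hl
    · refine ⟨{[]}, fun L => ?_, rfl⟩
      rw [Finset.mem_singleton]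
      constructor
      · rintro rfl; simp
      · exact fun h => List.length_eq_zero_iff.1 h.2
    · refine ⟨∅, fun L => ?_, by simp⟩
      simp only [Finset.notMem_empty, false_iff, not_and]
      intro h1 h2
      rw [List.length_eq_zero_iff.1 h2] at h1
      simp at h1
  | succ N ih =>
    rintro (_ | ⟨y, l⟩) hl
    · obtain ⟨F, hF, hc⟩ := ih [] (by simp)
      refine ⟨F.image (List.cons x₀), fun L => ?_, ?_⟩
      · rw [Finset.mem_image]
        constructor
        · rintro ⟨L', h1, rfl⟩
          obtain ⟨h2, h3⟩ := (hF L').1 h1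
          simp [hx₀, h2, h3]
        · rintro ⟨h1, h2⟩
          rcases L with _ | ⟨x, L⟩
          · simp at h2
          · rcases hx : nt x with _ | _
            · obtain rfl := (h₀ x).1 hx
              rw [List.filter_cons_of_neg (by simp [hx])] at h1
              exact ⟨L, (hF L).2 ⟨h1, by simpa using h2⟩, rfl⟩
            · simp [hx] at h1
      · rw [Finset.card_image_of_injective _ List.cons_injective, hc]
        simp
    · obtain ⟨F, hF, hc⟩ := ih (y :: l) hl
      obtain ⟨G, hG, hd⟩ := ih l fun x hx => hl x (List.mem_cons_of_mem _ hx)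
      have hy : nt y = true := hl y List.mem_cons_self
      refine ⟨F.image (List.cons x₀) ∪ G.image (List.cons y), fun L => ?_, ?_⟩
      · rw [Finset.mem_union, Finset.mem_image, Finset.mem_image]
        constructor
        · rintro (⟨L', h1, rfl⟩ | ⟨L', h1, rfl⟩)
          · obtain ⟨h2, h3⟩ := (hF L').1 h1
            rw [List.filter_cons_of_neg (by simp [hx₀]), h2, List.length_cons, h3]
            simp
          · obtain ⟨h2, h3⟩ := (hG L').1 h1
            rw [List.filter_cons_of_pos hy, h2, List.length_cons, h3]
            simp
        · rintro ⟨h1, h2⟩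
          rcases L with _ | ⟨x, L⟩
          · simp at h2
          · rcases hx : nt x with _ | _
            · obtain rfl := (h₀ x).1 hx
              rw [List.filter_cons_of_neg (by simp [hx])] at h1
              exact Or.inl ⟨L, (hF L).2 ⟨h1, by simpa using h2⟩, rfl⟩
            · rw [List.filter_cons_of_pos hx, List.cons.injEq] at h1
              obtain ⟨rfl, h1⟩ := h1
              exact Or.inr ⟨L, (hG L).2 ⟨h1, by simpa using h2⟩, rfl⟩
      · rw [Finset.card_union_of_disjoint, Finset.card_image_of_injective _ List.cons_injective,
          Finset.card_image_of_injective _ List.cons_injective, hc, hd, List.length_cons,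
          Nat.choose_succ_succ, add_comm]
        rw [Finset.disjoint_left]
        intro L h1 h2
        obtain ⟨L1, -, rfl⟩ := Finset.mem_image.1 h1
        obtain ⟨L2, -, h3⟩ := Finset.mem_image.1 h2
        rw [List.cons.injEq] at h3
        rw [h3.1, hx₀] at hy
        simp at hy

end ListCounting

/-- The number of entries of weight `w` of a list. -/
def weightCount {X : Type*} (wt : X → ℕ+) (w : ℕ+) (l : List X) : ℕ :=
  (l.map fun x => if wt x = w then 1 else 0).sum

theorem weightCount_cons {X : Type*} (wt : X → ℕ+) (w : ℕ+) (x : X) (l : List X) :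
    weightCount wt w (x :: l) = (if wt x = w then 1 else 0) + weightCount wt w l := by
  simp [weightCount]

theorem weightCount_eq_zero {X : Type*} {wt : X → ℕ+} {w : ℕ+} {l : List X} :
    weightCount wt w l = 0 ↔ ∀ x ∈ l, wt x ≠ w := by
  induction l with
  | nil => simp [weightCount]
  | cons x l ih => rw [weightCount_cons, Nat.add_eq_zero_iff, ih]; simp

namespace TangencySeq

theorem size_sub_single {m : TangencySeq} {w : ℕ+} (hw : m w ≠ 0) :
    (m - Finsupp.single w 1).size + 1 = m.size := by
  have h : m - Finsupp.single w 1 + Finsupp.single w 1 = m :=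
    tsub_add_cancel_of_le (Finsupp.single_le_iff.2 (Nat.pos_of_ne_zero hw))
  conv_rhs => rw [← h]
  rw [size, size, Finsupp.sum_add_index' (by simp) (by simp)]
  simp

theorem fact_eq_prod {m : TangencySeq} {U : Finset ℕ+} (h : m.support ⊆ U) :
    m.fact = ∏ w ∈ U, (m w)! :=
  Finsupp.prod_of_support_subset _ h _ (by simp)

theorem fact_sub_single {m : TangencySeq} {w : ℕ+} (hw : m w ≠ 0) :
    (m - Finsupp.single w 1).fact * m w = m.fact := by
  have hw' : w ∈ m.support := Finsupp.mem_support_iff.2 hw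
  have hs : (m - Finsupp.single w 1).support ⊆ m.support := by
    intro v hv
    simp only [Finsupp.mem_support_iff, Finsupp.tsub_apply] at hv ⊢
    omega
  rw [fact_eq_prod hs, fact_eq_prod subset_rfl, ← Finset.mul_prod_erase _ _ hw',
    ← Finset.mul_prod_erase _ _ hw']
  have h1 : ∏ x ∈ m.support.erase w, ((m - Finsupp.single w 1 : TangencySeq) x)! =
      ∏ x ∈ m.support.erase w, (m x)! := by
    refine Finset.prod_congr rfl fun x hx => ?_
    rw [Finsupp.tsub_apply, Finsupp.single_eq_of_ne (Finset.ne_of_mem_erase hx), tsub_zero]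
  rw [h1]
  obtain ⟨k, hk⟩ := Nat.exists_eq_add_one_of_ne_zero hw
  rw [Finsupp.tsub_apply, Finsupp.single_eq_same, hk, Nat.add_sub_cancel, Nat.factorial_succ]
  ring

theorem size_eq_zero_iff {m : TangencySeq} : m.size = 0 ↔ m = 0 := by
  constructor
  · intro h
    rw [size, Finsupp.sum, Finset.sum_eq_zero_iff] at h
    ext w
    by_contra hc
    exact hc (h w (Finsupp.mem_support_iff.2 hc))
  · rintro rfl
    simp [size]

end TangencySeq

section ListCounting

variable {X : Type*} [DecidableEq X]

/-- A multinomial coefficient: `l` has a fixed order and `m w` indistinguishable copies of `τ w` are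
mixed in. Sorting by the head, the copies of `τ w` contribute `m w * N !` and the head of `l`
contributes `l.length * N !`, with sum `(N + 1)!`. The product form avoids divisions. -/
theorem exists_finset_shuffle (nt : X → Bool) (wt : X → ℕ+) (τ : ℕ+ → X)
    (h1 : ∀ w, nt (τ w) = false) (h2 : ∀ w, wt (τ w) = w) :
    ∀ (N : ℕ) (l : List X) (m : TangencySeq), (∀ x ∈ l, nt x = true) → l.length + m.size = N →
      ∃ F : Finset (List X), (∀ L, L ∈ F ↔ L.filter nt = l ∧
        (∀ x ∈ L, nt x = false → x = τ (wt x)) ∧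
        ∀ w, weightCount wt w L = weightCount wt w l + m w) ∧
        F.card * (l.length ! * m.fact) = N ! := by
  intro N
  induction N with
  | zero =>
    intro l m hl hN
    obtain rfl : l = [] := List.length_eq_zero_iff.1 (by omega)
    obtain rfl : m = 0 := TangencySeq.size_eq_zero_iff.1 (by omega)
    refine ⟨{[]}, fun L => ?_, by simp [TangencySeq.fact]⟩
    rw [Finset.mem_singleton]
    constructor
    · rintro rfl; simp
    · rintro ⟨-, -, h3⟩
      rcases L with _ | ⟨x, L⟩
      · rfl
      · have := h3 (wt x)
        rw [weightCount_cons, if_pos rfl] at this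
        simp [weightCount] at this
  | succ N ih =>
    intro l m hl hN
    have hF : ∀ w : ℕ+, ∃ F : Finset (List X), m w ≠ 0 → (∀ L, L ∈ F ↔ L.filter nt = l ∧
        (∀ x ∈ L, nt x = false → x = τ (wt x)) ∧
        ∀ v, weightCount wt v L = weightCount wt v l + (m - Finsupp.single w 1 : TangencySeq) v) ∧
        F.card * (l.length ! * m.fact) = m w * N ! := by
      intro w
      by_cases hw : m w = 0
      · exact ⟨∅, fun hc => absurd hw hc⟩
      · have h3 := TangencySeq.size_sub_single hw
        obtain ⟨F, h4, h5⟩ := ih l (m - Finsupp.single w 1) hl (by omega)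
        refine ⟨F, fun _ => ⟨h4, ?_⟩⟩
        rw [← h5, ← TangencySeq.fact_sub_single hw]
        ring
    choose F hF using hF
    have hG : ∃ G : Finset (List X), (∀ L, L ∈ G ↔ ∃ y l' L', l = y :: l' ∧ L = y :: L' ∧
        L'.filter nt = l' ∧ (∀ x ∈ L', nt x = false → x = τ (wt x)) ∧
        ∀ v, weightCount wt v L' = weightCount wt v l' + m v) ∧
        G.card * (l.length ! * m.fact) = l.length * N ! := by
      rcases l with _ | ⟨y, l⟩
      · exact ⟨∅, by simp, by simp⟩
      · rw [List.length_cons] at hN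
        obtain ⟨G, h4, h5⟩ := ih l m (fun x hx => hl x (List.mem_cons_of_mem _ hx)) (by omega)
        refine ⟨G.image (List.cons y), fun L => ?_, ?_⟩
        · rw [Finset.mem_image]
          constructor
          · rintro ⟨L', h6, rfl⟩
            exact ⟨y, l, L', rfl, rfl, (h4 L').1 h6⟩
          · rintro ⟨y', l', L', h6, rfl, h7⟩
            cases h6
            exact ⟨L', (h4 L').2 h7, rfl⟩
        · rw [Finset.card_image_of_injective _ List.cons_injective, ← h5, List.length_cons,
            Nat.factorial_succ]
          ring
    obtain ⟨G, hG, hGc⟩ := hG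
    refine ⟨(m.support.biUnion fun w => (F w).image (List.cons (τ w))) ∪ G, fun L => ?_, ?_⟩
    · rw [Finset.mem_union, Finset.mem_biUnion]
      constructor
      · rintro (⟨w, hw, hL⟩ | hL)
        · obtain ⟨L', hL', rfl⟩ := Finset.mem_image.1 hL
          have hw' := Finsupp.mem_support_iff.1 hw
          obtain ⟨h3, h4, h5⟩ := ((hF w hw').1 L').1 hL'
          refine ⟨?_, fun x hx hx' => ?_, fun v => ?_⟩
          · rw [List.filter_cons_of_neg (by simp [h1]), h3]
          · rcases List.mem_cons.1 hx with rfl | hx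
            · rw [h2]
            · exact h4 x hx hx'
          · rw [weightCount_cons, h2, h5, Finsupp.tsub_apply, Finsupp.single_apply]
            split_ifs with hv
            · subst hv; omega
            · omega
        · obtain ⟨y, l', L', rfl, rfl, h3, h4, h5⟩ := (hG L).1 hL
          have hy := hl y List.mem_cons_self
          refine ⟨?_, fun x hx hx' => ?_, fun v => ?_⟩
          · rw [List.filter_cons_of_pos hy, h3]
          · rcases List.mem_cons.1 hx with rfl | hx
            · rw [hy] at hx'; cases hx'
            · exact h4 x hx hx'
          · rw [weightCount_cons, weightCount_cons, h5, add_assoc]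
      · rintro ⟨h3, h4, h5⟩
        rcases L with _ | ⟨x, L⟩
        · exfalso
          rw [List.filter_nil] at h3
          subst h3
          have : m = 0 := by
            ext w
            have := h5 w
            simp [weightCount] at this
            simp [this]
          rw [this] at hN
          simp [TangencySeq.size] at hN
        · rcases hx : nt x with _ | _
          · have hx' := h4 x List.mem_cons_self hx
            rw [List.filter_cons_of_neg (by simp [hx])] at h3
            have hw : m (wt x) ≠ 0 := by
              have := h5 (wt x)
              have h6 : weightCount wt (wt x) l ≤ weightCount wt (wt x) L := by
                rw [← h3]
                exact ((List.filter_sublist (p := nt) (l := L)).map _).sum_le_sum (by simp)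
              rw [weightCount_cons, if_pos rfl] at this
              omega
            refine Or.inl ⟨wt x, Finsupp.mem_support_iff.2 hw, Finset.mem_image.2 ⟨L, ?_, by rw [← hx']⟩⟩
            refine ((hF _ hw).1 L).2 ⟨h3, fun y hy => h4 y (List.mem_cons_of_mem _ hy), fun v => ?_⟩
            have := h5 v
            rw [weightCount_cons] at this
            rw [Finsupp.tsub_apply, Finsupp.single_apply]
            split_ifs at this ⊢ with hv
            · subst hv; omega
            · omega
          · rw [List.filter_cons_of_pos hx] at h3
            refine Or.inr ((hG _).2 ⟨x, _, L, h3.symm, rfl, rfl,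
              fun y hy => h4 y (List.mem_cons_of_mem _ hy), fun v => ?_⟩)
            have := h5 v
            rw [weightCount_cons, ← h3, weightCount_cons] at this
            omega
    · rw [Finset.card_union_of_disjoint, Finset.card_biUnion, add_mul, hGc, Finset.sum_mul,
        Finset.sum_congr rfl (g := fun w => m w * N !), ← Finset.sum_mul, Nat.factorial_succ, ← hN,
        add_comm l.length, add_mul]
      · rfl
      · intro w hw
        rw [Finset.card_image_of_injective _ List.cons_injective,
          (hF w (Finsupp.mem_support_iff.1 hw)).2]
      · intro v _ w _ hvw
        rw [Function.onFun, Finset.disjoint_left]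
        intro L h3 h4
        obtain ⟨L1, -, rfl⟩ := Finset.mem_image.1 h3
        obtain ⟨L2, -, h5⟩ := Finset.mem_image.1 h4
        rw [List.cons.injEq] at h5
        refine hvw ?_
        rw [← h2 v, ← h2 w, h5.1]
      · rw [Finset.disjoint_left]
        intro L h3 h4
        obtain ⟨w, -, h3⟩ := Finset.mem_biUnion.1 h3
        obtain ⟨L1, -, rfl⟩ := Finset.mem_image.1 h3
        obtain ⟨y, l', L', rfl, h5, -⟩ := (hG _).1 h4
        rw [List.cons.injEq] at h5
        have := hl y List.mem_cons_self
        rw [← h5.1, h1] at this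
        cases this

/-- In a sorted list the entries of each weight are consecutive, and for each weight `w` one chooses
which of the `α w` places hold entries of `l`. The induction removes the head, necessarily of the
least weight occurring in `α`, and uses Pascal's rule when `l` starts with that weight. -/
theorem exists_finset_sorted (nt : X → Bool) (wt : X → ℕ+) (τ : ℕ+ → X)
    (h1 : ∀ w, nt (τ w) = false) (h2 : ∀ w, wt (τ w) = w) (U : Finset ℕ+) :
    ∀ (N : ℕ) (l : List X) (α : TangencySeq), (∀ x ∈ l, nt x = true) → (∀ x ∈ l, wt x ∈ U) →
      l.Pairwise (fun x y => wt x ≤ wt y) → α.size = N →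
      ∃ F : Finset (List X), (∀ L, L ∈ F ↔ L.filter nt = l ∧
        (∀ x ∈ L, nt x = false → x = τ (wt x)) ∧ L.Pairwise (fun x y => wt x ≤ wt y) ∧
        ∀ w, weightCount wt w L = α w) ∧
        F.card = ∏ w ∈ U, (α w).choose (weightCount wt w l) := by
  intro N
  induction N with
  | zero =>
    intro l α hl hU hs hN
    obtain rfl : α = 0 := TangencySeq.size_eq_zero_iff.1 hN
    have hnil : ∀ L : List X, (∀ w, weightCount wt w L = (0 : TangencySeq) w) → L = [] := by
      rintro (_ | ⟨x, L⟩) h3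
      · rfl
      · have := h3 (wt x)
        rw [weightCount_cons, if_pos rfl] at this
        simp at this
    rcases l with _ | ⟨y, l⟩
    · refine ⟨{[]}, fun L => ?_, by simp [weightCount]⟩
      rw [Finset.mem_singleton]
      constructor
      · rintro rfl; simp [weightCount]
      · rintro ⟨-, -, -, h3⟩
        exact hnil L h3
    · refine ⟨∅, fun L => ?_, ?_⟩
      · simp only [Finset.notMem_empty, false_iff]
        rintro ⟨h3, -, -, h4⟩
        rw [hnil L h4] at h3
        simp at h3
      · rw [eq_comm, Finset.card_empty]
        refine Finset.prod_eq_zero (hU y List.mem_cons_self) ?_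
        rw [weightCount_cons, if_pos rfl, add_comm]
        simp
  | succ N ih =>
    intro l α hl hU hs hN
    have hα : α.support.Nonempty := by
      rw [Finsupp.support_nonempty_iff]
      rintro rfl
      simp [TangencySeq.size] at hN
    set w₀ := α.support.min' hα with hw₀
    have hmem : α w₀ ≠ 0 := Finsupp.mem_support_iff.1 (Finset.min'_mem _ hα)
    have hmin : ∀ w, α w ≠ 0 → w₀ ≤ w := fun w hw =>
      Finset.min'_le _ _ (Finsupp.mem_support_iff.2 hw)
    set α' := α - Finsupp.single w₀ 1 with hα'
    have hN' : α'.size = N := by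
      have : α'.size + 1 = α.size := TangencySeq.size_sub_single hmem
      omega
    have hα'w : ∀ w, α w = (if w₀ = w then 1 else 0) + α' w := by
      intro w
      rw [hα', Finsupp.tsub_apply, Finsupp.single_apply]
      split_ifs with hw
      · rw [← hw]; omega
      · omega
    have hcons : ∀ x L, wt x = w₀ → (∀ w, weightCount wt w L = α' w) →
        L.Pairwise (fun x y => wt x ≤ wt y) → (x :: L).Pairwise (fun x y => wt x ≤ wt y) := by
      intro x L hx h3 h4
      refine List.pairwise_cons.2 ⟨fun y hy => ?_, h4⟩
      rw [hx]
      refine hmin _ ?_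
      have h5 : weightCount wt (wt y) L ≠ 0 := fun hc => weightCount_eq_zero.1 hc y hy rfl
      rw [hα'w, ← h3]
      omega
    have hhead : ∀ x L, (∀ w, weightCount wt w (x :: L) = α w) →
        (x :: L).Pairwise (fun x y => wt x ≤ wt y) → wt x = w₀ := by
      intro x L h3 h4
      refine le_antisymm ?_ (hmin _ ?_)
      · have h5 : weightCount wt w₀ (x :: L) ≠ 0 := by rw [h3]; exact hmem
        rw [Ne, weightCount_eq_zero] at h5
        push Not at h5
        obtain ⟨y, hy, hy'⟩ := h5
        rcases List.mem_cons.1 hy with rfl | hy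
        · exact hy'.le
        · rw [← hy']
          exact (List.pairwise_cons.1 h4).1 y hy
      · rw [← h3, weightCount_cons, if_pos rfl]
        omega
    obtain ⟨F, hF, hFc⟩ := ih l α' hl hU hs hN'
    by_cases hlh : ∃ y l', l = y :: l' ∧ wt y = w₀
    · obtain ⟨y, l, rfl, hy⟩ := hlh
      have hny := hl y List.mem_cons_self
      obtain ⟨G, hG, hGc⟩ := ih l α' (fun x hx => hl x (List.mem_cons_of_mem _ hx))
        (fun x hx => hU x (List.mem_cons_of_mem _ hx)) (List.pairwise_cons.1 hs).2 hN'
      refine ⟨F.image (List.cons (τ w₀)) ∪ G.image (List.cons y), fun L => ?_, ?_⟩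
      · rw [Finset.mem_union, Finset.mem_image, Finset.mem_image]
        constructor
        · rintro (⟨L', h3, rfl⟩ | ⟨L', h3, rfl⟩)
          · obtain ⟨h4, h5, h6, h7⟩ := (hF L').1 h3
            refine ⟨?_, fun x hx hx' => ?_, hcons _ _ (h2 _) h7 h6, fun w => ?_⟩
            · rw [List.filter_cons_of_neg (by simp [h1]), h4]
            · rcases List.mem_cons.1 hx with rfl | hx
              · rw [h2]
              · exact h5 x hx hx'
            · rw [weightCount_cons, h2, h7, hα'w]
          · obtain ⟨h4, h5, h6, h7⟩ := (hG L').1 h3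
            refine ⟨?_, fun x hx hx' => ?_, hcons _ _ hy h7 h6, fun w => ?_⟩
            · rw [List.filter_cons_of_pos hny, h4]
            · rcases List.mem_cons.1 hx with rfl | hx
              · rw [hny] at hx'; cases hx'
              · exact h5 x hx hx'
            · rw [weightCount_cons, hy, h7, hα'w]
        · rintro ⟨h4, h5, h6, h7⟩
          rcases L with _ | ⟨x, L⟩
          · simp at h4
          · have hx := hhead x L h7 h6
            have h8 : ∀ w, weightCount wt w L = α' w := by
              intro w
              have := h7 w
              rw [weightCount_cons, hx, hα'w] at this
              omega
            rcases hx' : nt x with _ | _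
            · rw [List.filter_cons_of_neg (by simp [hx'])] at h4
              have h9 := h5 x List.mem_cons_self hx'
              rw [hx] at h9
              exact Or.inl ⟨L, (hF L).2 ⟨h4, fun z hz => h5 z (List.mem_cons_of_mem _ hz),
                (List.pairwise_cons.1 h6).2, h8⟩, by rw [h9]⟩
            · rw [List.filter_cons_of_pos hx', List.cons.injEq] at h4
              obtain ⟨rfl, h4⟩ := h4
              exact Or.inr ⟨L, (hG L).2 ⟨h4, fun z hz => h5 z (List.mem_cons_of_mem _ hz),
                (List.pairwise_cons.1 h6).2, h8⟩, rfl⟩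
      · have hw₀U : w₀ ∈ U := hy ▸ hU y List.mem_cons_self
        rw [Finset.card_union_of_disjoint, Finset.card_image_of_injective _ List.cons_injective,
          Finset.card_image_of_injective _ List.cons_injective, hFc, hGc,
          ← Finset.mul_prod_erase _ _ hw₀U, ← Finset.mul_prod_erase _ _ hw₀U,
          ← Finset.mul_prod_erase _ _ hw₀U]
        · have h9 : ∀ (l : List X), ∏ x ∈ U.erase w₀, (α' x).choose (weightCount wt x l) =
              ∏ x ∈ U.erase w₀, (α x).choose (weightCount wt x l) := by
            intro l
            refine Finset.prod_congr rfl fun x hx => ?_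
            rw [hα'w x, if_neg (Finset.ne_of_mem_erase hx).symm, zero_add]
          have h10 : ∏ x ∈ U.erase w₀, (α x).choose (weightCount wt x (y :: l)) =
              ∏ x ∈ U.erase w₀, (α x).choose (weightCount wt x l) := by
            refine Finset.prod_congr rfl fun x hx => ?_
            rw [weightCount_cons, hy, if_neg (Finset.ne_of_mem_erase hx).symm, zero_add]
          rw [h9, h9, h10, weightCount_cons, if_pos hy, hα'w w₀, if_pos rfl, add_comm 1 (α' w₀),
            add_comm 1 (weightCount _ _ _), Nat.choose_succ_succ]
          ring
        · rw [Finset.disjoint_left]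
          intro L h3 h4
          obtain ⟨L1, -, rfl⟩ := Finset.mem_image.1 h3
          obtain ⟨L2, -, h5⟩ := Finset.mem_image.1 h4
          rw [List.cons.injEq] at h5
          rw [h5.1, h1] at hny
          cases hny
    · refine ⟨F.image (List.cons (τ w₀)), fun L => ?_, ?_⟩
      · rw [Finset.mem_image]
        constructor
        · rintro ⟨L', h3, rfl⟩
          obtain ⟨h4, h5, h6, h7⟩ := (hF L').1 h3
          refine ⟨?_, fun x hx hx' => ?_, hcons _ _ (h2 _) h7 h6, fun w => ?_⟩
          · rw [List.filter_cons_of_neg (by simp [h1]), h4]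
          · rcases List.mem_cons.1 hx with rfl | hx
            · rw [h2]
            · exact h5 x hx hx'
          · rw [weightCount_cons, h2, h7, hα'w]
        · rintro ⟨h4, h5, h6, h7⟩
          rcases L with _ | ⟨x, L⟩
          · exfalso
            have := h7 w₀
            simp [weightCount] at this
            exact hmem this.symm
          · have hx := hhead x L h7 h6
            have h8 : ∀ w, weightCount wt w L = α' w := by
              intro w
              have := h7 w
              rw [weightCount_cons, hx, hα'w] at this
              omega
            rcases hx' : nt x with _ | _
            · rw [List.filter_cons_of_neg (by simp [hx'])] at h4
              have h9 := h5 x List.mem_cons_self hx'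
              rw [hx] at h9
              exact ⟨L, (hF L).2 ⟨h4, fun z hz => h5 z (List.mem_cons_of_mem _ hz),
                (List.pairwise_cons.1 h6).2, h8⟩, by rw [h9]⟩
            · rw [List.filter_cons_of_pos hx'] at h4
              exact absurd ⟨x, _, h4.symm, hx⟩ hlh
      · rw [Finset.card_image_of_injective _ List.cons_injective, hFc]
        rcases l with _ | ⟨y, l⟩
        · simp [weightCount]
        · have hyne : wt y ≠ w₀ := fun hc => hlh ⟨y, l, rfl, hc⟩
          rcases lt_or_gt_of_ne hyne with hlt | hgt
          · have h0 : α (wt y) = 0 := by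
              by_contra hc
              exact absurd (hmin _ hc) (not_le.2 hlt)
            have h0' : α' (wt y) = 0 := by
              have := hα'w (wt y)
              omega
            rw [Finset.prod_eq_zero (hU y List.mem_cons_self), Finset.prod_eq_zero (hU y List.mem_cons_self)]
            · rw [h0, weightCount_cons, if_pos rfl, add_comm]; simp
            · rw [h0', weightCount_cons, if_pos rfl, add_comm]; simp
          · refine Finset.prod_congr rfl fun w _ => ?_
            by_cases hw : w₀ = w
            · subst hw
              rw [weightCount_eq_zero.2, Nat.choose_zero_right, Nat.choose_zero_right]
              intro x hx
              rcases List.mem_cons.1 hx with rfl | hx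
              · exact hyne
              · exact (lt_of_lt_of_le hgt ((List.pairwise_cons.1 hs).1 x hx)).ne'
            · rw [hα'w w, if_neg hw, zero_add]

end ListCounting

/-! ### Erasing trivial tokens, and the conditions on each gap. -/

/-- The tokens which are not erased: in the gaps `g < e` the trivial token is `(0, 0, 1)`, in the
gap `e` trivial tokens describe `β`-vertices, and in the gap `e + 1` `α`-vertices, attached to the
last floor `e`. -/
def nontriv (e g : ℕ) (t : Tok) : Bool :=
  if g < e then decide (t ≠ (0, 0, 1)) else if g = e then decide (t.1 ≠ 0) else decide (t.1 ≠ 1)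

/-- Words of degree `e + 1` all of whose tokens are nontrivial. -/
structure EndConf (e : ℕ) (C : ℕ → List Tok) : Prop where
  fits : FitsWord (e + 1) C
  nontriv : ∀ g, ∀ t ∈ C g, nontriv e g t = true
  sorted : (C (e + 1)).Pairwise fun x y => x.2.2 ≤ y.2.2

/-- The total weight of the nontrivial tokens crossing the gap `g`. -/
def lam (e : ℕ) (C : ℕ → List Tok) (g : ℕ) : ℕ := crossWord (e + 2) C g

/-- The number of `β`-vertices of weight `w` before the last floor. -/
def earlyEnds (e : ℕ) (C : ℕ → List Tok) (w : ℕ+) : ℕ :=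
  ∑ g ∈ Finset.range e, ((C g).map fun t => if g + t.2.1 = e ∧ t.2.2 = w then 1 else 0).sum

/-- The number of `β`-vertices before the last floor. -/
def earlyCount (e : ℕ) (C : ℕ → List Tok) : ℕ :=
  ∑ g ∈ Finset.range e, ((C g).map fun t => if g + t.2.1 = e then 1 else 0).sum

/-- The contribution of the nontrivial tokens to the cogenus. -/
def endCost (e : ℕ) (C : ℕ → List Tok) : ℕ :=
  ∑ g ∈ Finset.range e, (lam e C g - (C g).length) + earlyCount e C

/-- The word obtained by erasing all trivial tokens. -/
def eraseTriv (e : ℕ) (W : ℕ → List Tok) (g : ℕ) : List Tok := (W g).filter (nontriv e g)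

theorem sum_map_filter_add {X : Type*} (p : X → Bool) (f : X → ℕ) (l : List X) :
    ((l.filter p).map f).sum + ((l.filter fun x => !p x).map f).sum = (l.map f).sum := by
  induction l with
  | nil => rfl
  | cons x l ih =>
    rcases hx : p x with _ | _
    · rw [List.filter_cons_of_neg (by simp [hx]), List.filter_cons_of_pos (by simp [hx])]
      simp only [List.map_cons, List.sum_cons]
      omega
    · rw [List.filter_cons_of_pos (by simp [hx]), List.filter_cons_of_neg (by simp [hx])]
      simp only [List.map_cons, List.sum_cons]
      omega

theorem sum_map_filter_of_eq_zero {X : Type*} (p : X → Bool) (f : X → ℕ) (l : List X)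
    (h : ∀ x ∈ l, p x = false → f x = 0) : ((l.filter p).map f).sum = (l.map f).sum := by
  rw [← sum_map_filter_add p f l, Nat.left_eq_add]
  refine List.sum_eq_zero fun y hy => ?_
  obtain ⟨x, hx, rfl⟩ := List.mem_map.1 hy
  obtain ⟨h1, h2⟩ := List.mem_filter.1 hx
  exact h x h1 (by simpa using h2)

theorem sum_mul_weightIndicator {X : Type*} (wt : X → ℕ+) (P : X → Prop) [DecidablePred P]
    (F : ℕ+ → ℕ) (U : Finset ℕ+) (l : List X) (hl : ∀ x ∈ l, P x → wt x ∈ U) :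
    ∑ w ∈ U, F w * (l.map fun x => if P x ∧ wt x = w then 1 else 0).sum =
      (l.map fun x => if P x then F (wt x) else 0).sum := by
  induction l with
  | nil => simp
  | cons x l ih =>
    simp only [List.map_cons, List.sum_cons, mul_add, Finset.sum_add_distrib]
    rw [ih fun y hy => hl y (List.mem_cons_of_mem _ hy)]
    congr 1
    by_cases hx : P x
    · simp [hx, hl x List.mem_cons_self hx]
    · simp [hx]

/-- Summing a function of the weight over tokens whose numbers of weights are known. -/
theorem sum_of_weight_counts (s : TangencySeq) (n : ℕ) (W : ℕ → List Tok) (P : ℕ → Tok → Prop)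
    [∀ g, DecidablePred (P g)] (F : ℕ+ → ℕ)
    (h : ∀ w, ∑ g ∈ Finset.range n,
      ((W g).map fun t => if P g t ∧ t.2.2 = w then 1 else 0).sum = s w) :
    ∑ g ∈ Finset.range n, ((W g).map fun t => if P g t then F t.2.2 else 0).sum =
      s.sum fun w a => F w * a := by
  have h1 : ∀ g ∈ Finset.range n, ∀ t ∈ W g, P g t → t.2.2 ∈ s.support := by
    intro g hg t ht hP
    rw [Finsupp.mem_support_iff, ← h]
    refine (Nat.lt_of_lt_of_le ?_ (Finset.single_le_sum (f := fun g =>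
      ((W g).map fun t' => if P g t' ∧ t'.2.2 = t.2.2 then 1 else 0).sum)
      (fun _ _ => Nat.zero_le _) hg)).ne'
    refine Nat.lt_of_lt_of_le one_pos (List.single_le_sum (by simp) 1 ?_)
    exact List.mem_map.2 ⟨t, ht, by simp [hP]⟩
  rw [Finsupp.sum, Finset.sum_congr rfl fun g hg =>
    (sum_mul_weightIndicator (fun t : Tok => t.2.2) (P g) F s.support (W g) (h1 g hg)).symm,
    Finset.sum_comm]
  refine Finset.sum_congr rfl fun w _ => ?_
  rw [← Finset.mul_sum, h]

section Fiber

variable {e : ℕ} {W : ℕ → List Tok}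

theorem FitsWord.lt_bound (h : FitsWord (e + 1) W) {g : ℕ} (hg : g ≤ e) {t : Tok} (ht : t ∈ W g) :
    t.1 ≤ g ∧ g + t.2.1 ≤ e := by
  have := h g t ht
  omega

theorem FitsWord.last_bound (h : FitsWord (e + 1) W) {t : Tok} (ht : t ∈ W (e + 1)) :
    1 ≤ t.1 ∧ t.1 ≤ e + 1 ∧ t.2.1 = 0 := by
  have := h (e + 1) t ht
  omega

theorem FitsWord.eq_nil (h : FitsWord (e + 1) W) {g : ℕ} (hg : e + 1 < g) : W g = [] := by
  refine List.eq_nil_iff_forall_not_mem.2 fun t ht => ?_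
  have := h g t ht
  omega

theorem nontriv_eq_false_lt {g : ℕ} (hg : g < e) {t : Tok} : nontriv e g t = false ↔ t = (0, 0, 1) := by
  simp [nontriv, hg]

theorem nontriv_eq_false_eq {t : Tok} : nontriv e e t = false ↔ t.1 = 0 := by
  simp [nontriv]

theorem nontriv_eq_false_last {t : Tok} : nontriv e (e + 1) t = false ↔ t.1 = 1 := by
  simp [nontriv]

/-- A trivial token in a gap before `e` has weight one and crosses only its own gap, and the trivial
ends start at the floor `e`. So erasing lowers the weight crossing the gap `g` by the number of
tokens erased there. -/
theorem FitsWord.crossWord_lt (h : FitsWord (e + 1) W) {g : ℕ} (hg : g < e) :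
    crossWord (e + 2) W g + (eraseTriv e W g).length = lam e (eraseTriv e W) g + (W g).length := by
  have key : ∀ p ∈ Finset.range (e + 2),
      ((W p).map fun t => if p ≤ g + t.1 ∧ g ≤ p + t.2.1 then (t.2.2 : ℕ) else 0).sum =
      ((eraseTriv e W p).map fun t => if p ≤ g + t.1 ∧ g ≤ p + t.2.1 then (t.2.2 : ℕ) else 0).sum +
        if p = g then ((W p).filter fun t => !nontriv e p t).length else 0 := by
    intro p hp
    rw [← sum_map_filter_add (nontriv e p) _ (W p)]
    congr 1
    have hz : ∀ l : List Tok, (∀ t ∈ l, (if p ≤ g + t.1 ∧ g ≤ p + t.2.1 then (t.2.2 : ℕ) else 0) =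
        if p = g then 1 else 0) →
        (l.map fun t => if p ≤ g + t.1 ∧ g ≤ p + t.2.1 then (t.2.2 : ℕ) else 0).sum =
        if p = g then l.length else 0 := by
      intro l hl
      rw [List.map_congr_left hl]
      split_ifs <;> simp
    refine hz _ fun t ht => ?_
    obtain ⟨ht1, ht2⟩ := List.mem_filter.1 ht
    have ht3 : nontriv e p t = false := by simpa using ht2
    have hp' := Finset.mem_range.1 hp
    rcases lt_trichotomy p e with hpe | hpe | hpe
    · rw [nontriv_eq_false_lt hpe] at ht3
      subst ht3
      simp only [PNat.val_ofNat]
      congr 1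
      rw [eq_iff_iff]
      omega
    · subst hpe
      rw [nontriv_eq_false_eq] at ht3
      rw [if_neg (by omega), if_neg (by omega)]
    · obtain rfl : p = e + 1 := by omega
      rw [nontriv_eq_false_last] at ht3
      rw [if_neg (by omega), if_neg (by omega)]
  rw [crossWord, Finset.sum_congr rfl key, Finset.sum_add_distrib, Finset.sum_ite_eq',
    if_pos (Finset.mem_range.2 (by omega)), lam, crossWord, add_assoc]
  congr 1
  have h1 := sum_map_filter_add (nontriv e g) (fun _ => 1) (W g)
  simp only [List.map_const', List.sum_replicate, smul_eq_mul, mul_one] at h1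
  rw [← h1, add_comm]
  rfl

/-- The edges crossing the gap after the last floor are exactly those of the ends. The crossing
condition at this gap is thus just the formula for the degree. -/
theorem FitsWord.crossWord_last (h : FitsWord (e + 1) W) {α β : TangencySeq}
    (hβ : ∀ w, ∑ g ∈ Finset.range (e + 1),
      ((W g).map fun t => if g + 1 + t.2.1 = e + 1 ∧ t.2.2 = w then 1 else 0).sum = β w)
    (hα : ∀ w, ((W (e + 1)).map fun t => if t.2.2 = w then 1 else 0).sum = α w) :
    crossWord (e + 2) W e = α.weight + β.weight := by
  have h1 := sum_of_weight_counts β (e + 1) W (fun g t => g + 1 + t.2.1 = e + 1) (fun w => w) hβ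
  have h2 := sum_of_weight_counts α 1 (fun _ => W (e + 1)) (fun _ _ => True) (fun w => w)
    (by simpa using hα)
  simp only [Finset.sum_range_one, if_true] at h2
  rw [crossWord, Finset.sum_range_succ, add_comm, TangencySeq.weight, TangencySeq.weight, ← h2, ← h1]
  congr 1
  · congr 1
    refine List.map_congr_left fun t ht => if_pos ?_
    have := h.last_bound ht
    omega
  · refine Finset.sum_congr rfl fun g hg => ?_
    congr 1
    refine List.map_congr_left fun t ht => ?_
    have hg' := Finset.mem_range.1 hg
    have := h.lt_bound (by omega) ht
    congr 1
    rw [eq_iff_iff]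
    omega

/-- Each token crosses its own gap with positive weight; hence the truncated subtractions in
`endCost` are exact. -/
theorem length_le_lam {C : ℕ → List Tok} {g : ℕ} (hg : g < e + 2) : (C g).length ≤ lam e C g := by
  refine le_trans ?_ (Finset.single_le_sum (f := fun p => ((C p).map fun t =>
    if p ≤ g + t.1 ∧ g ≤ p + t.2.1 then (t.2.2 : ℕ) else 0).sum)
      (fun _ _ => Nat.zero_le _) (Finset.mem_range.2 hg))
  have : ((C g).map fun t => if g ≤ g + t.1 ∧ g ≤ g + t.2.1 then (t.2.2 : ℕ) else 0) =
      (C g).map fun t => (t.2.2 : ℕ) :=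
    List.map_congr_left fun t _ => if_pos ⟨by omega, by omega⟩
  simp only [this]
  generalize C g = l
  induction l with
  | nil => simp
  | cons t l ih =>
    simp only [List.map_cons, List.sum_cons, List.length_cons]
    have := t.2.2.pos
    omega

theorem FitsWord.sum_early (h : FitsWord (e + 1) W) (w : ℕ+) :
    ∑ g ∈ Finset.range (e + 1),
      ((W g).map fun t => if g + 1 + t.2.1 = e + 1 ∧ t.2.2 = w then 1 else 0).sum =
    weightCount (fun t : Tok => t.2.2) w (W e) + earlyEnds e (eraseTriv e W) w := by
  rw [Finset.sum_range_succ, add_comm]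
  congr 1
  · rw [weightCount]
    congr 1
    refine List.map_congr_left fun t ht => ?_
    have := h.lt_bound le_rfl ht
    congr 1
    rw [eq_iff_iff, and_iff_right]
    omega
  · refine Finset.sum_congr rfl fun g hg => ?_
    have hg' := Finset.mem_range.1 hg
    rw [eraseTriv, sum_map_filter_of_eq_zero]
    · congr 1
      refine List.map_congr_left fun t ht => ?_
      congr 2
      rw [eq_iff_iff]
      omega
    · intro t _ ht
      rw [nontriv_eq_false_lt hg'] at ht
      subst ht
      rw [if_neg]
      simp only
      omega

theorem FitsWord.midCount_add (h : FitsWord (e + 1) W) :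
    midCount (e + 1) W + earlyCount e (eraseTriv e W) = ∑ g ∈ Finset.range e, (W g).length := by
  rw [midCount, Finset.sum_range_succ]
  have h1 : ((W e).map fun t => if e + 1 + t.2.1 < e + 1 then 1 else 0).sum = 0 := by
    refine List.sum_eq_zero fun y hy => ?_
    obtain ⟨t, -, rfl⟩ := List.mem_map.1 hy
    rw [if_neg (by omega)]
  rw [h1, add_zero, earlyCount, ← Finset.sum_add_distrib]
  refine Finset.sum_congr rfl fun g hg => ?_
  have hg' := Finset.mem_range.1 hg
  rw [eraseTriv, sum_map_filter_of_eq_zero]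
  · rw [← List.sum_map_add, List.map_congr_left (g := fun _ => 1)]
    · simp
    · intro t ht
      have := h.lt_bound hg'.le ht
      split_ifs <;> omega
  · intro t _ ht
    rw [nontriv_eq_false_lt hg'] at ht
    subst ht
    rw [if_neg]
    simp only
    omega

theorem sum_range_succ_eq_choose (e : ℕ) : ∑ g ∈ Finset.range e, (g + 1) = (e + 1).choose 2 := by
  induction e with
  | zero => rfl
  | succ e ih =>
    rw [Finset.sum_range_succ, ih, Nat.choose_succ_succ' (e + 1) 1, Nat.choose_one_right,
      add_comm]

/-- The required weights `g + 1` of the gaps before `e` add up to `(e + 1).choose 2`. A trivial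
token there uses one unit of weight and is one midpoint, so it cancels; early `β`-vertices are
tokens but not midpoints, which accounts for `earlyCount`. -/
theorem FitsWord.midCount_iff (h : FitsWord (e + 1) W)
    (hc : ∀ g < e, (W g).length + lam e (eraseTriv e W) g = g + 1 + (eraseTriv e W g).length)
    (δ : ℕ) : midCount (e + 1) W + δ = (e + 1).choose 2 ↔ endCost e (eraseTriv e W) = δ := by
  have h1 := h.midCount_add
  have h2 : ∑ g ∈ Finset.range e, (W g).length +
      ∑ g ∈ Finset.range e, (lam e (eraseTriv e W) g - (eraseTriv e W g).length) =
      (e + 1).choose 2 := by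
    rw [← sum_range_succ_eq_choose, ← Finset.sum_add_distrib]
    refine Finset.sum_congr rfl fun g hg => ?_
    have hg' := Finset.mem_range.1 hg
    have h3 := hc g hg'
    have h4 := length_le_lam (C := eraseTriv e W) (show g < e + 2 by omega)
    omega
  rw [endCost]
  omega

/-- The possible lists of tokens in the gap `g` of a valid word, given the nontrivial tokens. -/
def IsSlot (e : ℕ) (α β : TangencySeq) (C : ℕ → List Tok) (g : ℕ) (L : List Tok) : Prop :=
  L.filter (nontriv e g) = C g ∧
  (g < e → L.length + lam e C g = g + 1 + (C g).length) ∧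
  (g = e → (∀ x ∈ L, nontriv e g x = false → x = (0, 0, x.2.2)) ∧
    ∀ w, weightCount (fun t : Tok => t.2.2) w L + earlyEnds e C w = β w) ∧
  (g = e + 1 → (∀ x ∈ L, nontriv e g x = false → x = (1, 0, x.2.2)) ∧
    L.Pairwise (fun x y => x.2.2 ≤ y.2.2) ∧ ∀ w, weightCount (fun t : Tok => t.2.2) w L = α w) ∧
  (e + 1 < g → L = [])

/-- With the nontrivial tokens fixed, every condition concerns a single gap: the crossing condition
prescribes the length before the gap `e`, while the last two gaps are governed by the numbers of
`β`- and `α`-vertices. Hence a fibre of `eraseTriv` is a product. -/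
theorem validWord_iff_slots {C : ℕ → List Tok} (hC : EndConf e C) {α β : TangencySeq}
    (hd : e + 1 = α.weight + β.weight) (δ : ℕ) :
    (ValidWord (e + 1) α β W ∧ midCount (e + 1) W + δ = (e + 1).choose 2) ∧ eraseTriv e W = C ↔
      endCost e C = δ ∧ ∀ g, IsSlot e α β C g (W g) := by
  constructor
  · rintro ⟨⟨hW, hδ⟩, rfl⟩
    have hlen : ∀ g < e, (W g).length + lam e (eraseTriv e W) g =
        g + 1 + (eraseTriv e W g).length := by
      intro g hg
      have h1 := hW.cross g (by omega)
      have h2 := hW.fits.crossWord_lt hg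
      change crossWord (e + 2) W g = _ at h1
      omega
    refine ⟨(hW.fits.midCount_iff hlen δ).1 hδ, fun g => ⟨rfl, hlen g, ?_, ?_, ?_⟩⟩
    · rintro rfl
      refine ⟨fun x hx hx' => ?_, fun w => ?_⟩
      · have := hW.fits.lt_bound le_rfl hx
        rw [nontriv_eq_false_eq] at hx'
        ext <;> simp only <;> omega
      · rw [← hW.fits.sum_early, hW.beta]
    · rintro rfl
      refine ⟨fun x hx hx' => ?_, hW.sorted, hW.alpha⟩
      have := hW.fits.last_bound hx
      rw [nontriv_eq_false_last] at hx'
      ext <;> simp only <;> omega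
    · exact fun hg => hW.fits.eq_nil hg
  · rintro ⟨hδ, hs⟩
    have herase : eraseTriv e W = C := funext fun g => (hs g).1
    have hfits : FitsWord (e + 1) W := by
      intro g t ht
      rcases hx : nontriv e g t with _ | _
      · rcases lt_trichotomy g e with hg | hg | hg
        · rw [nontriv_eq_false_lt hg] at hx
          subst hx
          simp only
          omega
        · have h1 := ((hs g).2.2.1 hg).1 t ht hx
          rw [h1]
          simp only
          omega
        · rcases eq_or_lt_of_le (Nat.succ_le_of_lt hg) with hg' | hg'
          · have h1 := ((hs g).2.2.2.1 hg'.symm).1 t ht hx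
            have h2 : t.1 = 1 := by rw [h1]
            have h3 : t.2.1 = 0 := by rw [h1]
            exact Or.inr ⟨hg'.symm, by omega, by omega, h3⟩
          · rw [(hs g).2.2.2.2 hg'] at ht
            simp at ht
      · refine hC.fits g t ?_
        rw [← (hs g).1]
        exact List.mem_filter.2 ⟨ht, hx⟩
    have hlen : ∀ g < e, (W g).length + lam e (eraseTriv e W) g =
        g + 1 + (eraseTriv e W g).length := by
      intro g hg
      rw [herase]
      exact (hs g).2.1 hg
    have hβ : ∀ w, ∑ g ∈ Finset.range (e + 1),
        ((W g).map fun t => if g + 1 + t.2.1 = e + 1 ∧ t.2.2 = w then 1 else 0).sum = β w := by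
      intro w
      rw [hfits.sum_early, herase]
      exact ((hs e).2.2.1 rfl).2 w
    have hα := ((hs (e + 1)).2.2.2.1 rfl).2.2
    refine ⟨⟨⟨hfits, ((hs (e + 1)).2.2.2.1 rfl).2.1, hβ, hα, fun g hg => ?_⟩, ?_⟩, herase⟩
    · rcases Nat.lt_succ_iff_lt_or_eq.1 hg with hg | rfl
      · have h1 := hlen g hg
        have h2 := hfits.crossWord_lt hg
        change crossWord (e + 2) W g = _
        omega
      · change crossWord (g + 2) W g = _
        rw [hfits.crossWord_last hβ hα, hd]
    · rw [hfits.midCount_iff hlen, herase, hδ]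

end Fiber

/-! ### Lower bounds for the cogenus, token by token. -/

/-- The token `t` in the gap `p` describes a vertex with an edge passing over the floor `v`. -/
def Covers (p : ℕ) (t : Tok) (v : ℕ) : Prop := p < v + t.1 ∧ v ≤ p + t.2.1

instance (p : ℕ) (t : Tok) (v : ℕ) : Decidable (Covers p t v) :=
  inferInstanceAs (Decidable (_ ∧ _))

/-- Some token passes over the floor `v`. -/
def Covered (C : ℕ → List Tok) (v : ℕ) : Prop := ∃ p, ∃ t ∈ C p, Covers p t v

/-- The sum of a function over all tokens in the gaps up to `e + 1`. -/
def tokSum (e : ℕ) (C : ℕ → List Tok) (f : ℕ → Tok → ℕ) : ℕ :=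
  ∑ p ∈ Finset.range (e + 2), ((C p).map (f p)).sum

/-- The contribution of the gaps from `x` on to the cogenus. -/
def costFrom (e : ℕ) (C : ℕ → List Tok) (x : ℕ) : ℕ :=
  ∑ g ∈ Finset.Ico x e, (lam e C g - (C g).length) + earlyCount e C

/-- The weights with which a token crosses the gaps from `x` on. -/
def crossFrom (e x p : ℕ) (t : Tok) : ℕ :=
  ∑ i ∈ Finset.Ico x e, if p ≤ i + t.1 ∧ i ≤ p + t.2.1 then (t.2.2 : ℕ) else 0

theorem sum_list_sum_comm {X ι : Type*} (s : Finset ι) (l : List X) (f : ι → X → ℕ) :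
    ∑ i ∈ s, (l.map (f i)).sum = (l.map fun x => ∑ i ∈ s, f i x).sum := by
  induction l with
  | nil => simp
  | cons x l ih => simp [Finset.sum_add_distrib, ih]

section TokSum

variable {e : ℕ} {C : ℕ → List Tok} {f f' : ℕ → Tok → ℕ}

theorem tokSum_le_tokSum (h : ∀ p < e + 2, ∀ t ∈ C p, f p t ≤ f' p t) :
    tokSum e C f ≤ tokSum e C f' :=
  Finset.sum_le_sum fun p hp => List.sum_le_sum fun t ht => h p (Finset.mem_range.1 hp) t ht

theorem tokSum_add : tokSum e C (fun p t => f p t + f' p t) = tokSum e C f + tokSum e C f' := by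
  simp only [tokSum, List.sum_map_add, Finset.sum_add_distrib]

theorem le_tokSum {p : ℕ} (hp : p < e + 2) {t : Tok} (ht : t ∈ C p) : f p t ≤ tokSum e C f :=
  le_trans (List.single_le_sum (by simp) _ (List.mem_map_of_mem ht))
    (Finset.single_le_sum (f := fun p => ((C p).map (f p)).sum) (fun _ _ => Nat.zero_le _)
      (Finset.mem_range.2 hp))

theorem sum_tokSum {ι : Type*} (s : Finset ι) (F : ι → ℕ → Tok → ℕ) :
    ∑ i ∈ s, tokSum e C (F i) = tokSum e C fun p t => ∑ i ∈ s, F i p t := by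
  simp only [tokSum]
  rw [Finset.sum_comm]
  exact Finset.sum_congr rfl fun p _ => sum_list_sum_comm s (C p) fun i => F i p

theorem length_le_tokSum {g : ℕ} (hg : g < e + 2) :
    (C g).length ≤ tokSum e C fun _ _ => 1 := by
  refine le_trans ?_ (Finset.single_le_sum (f := fun p => ((C p).map (fun _ => 1)).sum)
      (fun _ _ => Nat.zero_le _) (Finset.mem_range.2 hg))
  simp

/-- Exchanging the sums over gaps and tokens gives each token its own share of the cost. The term
subtracted in the cost, one for each token in the gaps considered, stands on the left to avoid
truncation. -/
theorem costFrom_add (x : ℕ) :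
    costFrom e C x + tokSum e C (fun p _ => if x ≤ p ∧ p < e then 1 else 0) =
      tokSum e C fun p t => crossFrom e x p t + if p < e ∧ p + t.2.1 = e then 1 else 0 := by
  have h1 : tokSum e C (fun p _ => if x ≤ p ∧ p < e then 1 else 0) =
      ∑ g ∈ Finset.Ico x e, (C g).length := by
    simp only [tokSum, List.map_const', List.sum_replicate, smul_eq_mul, mul_ite, mul_one, mul_zero]
    rw [← Finset.sum_filter]
    refine Finset.sum_congr ?_ fun _ _ => rfl
    ext p
    simp only [Finset.mem_filter, Finset.mem_range, Finset.mem_Ico]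
    omega
  have h2 : tokSum e C (crossFrom e x) = ∑ g ∈ Finset.Ico x e, lam e C g :=
    (sum_tokSum (Finset.Ico x e) fun i p t =>
      if p ≤ i + t.1 ∧ i ≤ p + t.2.1 then (t.2.2 : ℕ) else 0).symm
  have h3 : tokSum e C (fun p t => if p < e ∧ p + t.2.1 = e then 1 else 0) = earlyCount e C := by
    rw [tokSum, earlyCount, Finset.sum_range_succ, Finset.sum_range_succ]
    simp only [lt_self_iff_false, false_and, if_false, show ¬ e + 1 < e by omega, List.map_const',
      List.sum_replicate, smul_zero, add_zero]
    refine Finset.sum_congr rfl fun p hp => ?_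
    simp only [Finset.mem_range.1 hp, true_and]
  rw [tokSum_add, h1, h2, h3, costFrom, add_right_comm, ← Finset.sum_add_distrib]
  congr 1
  refine Finset.sum_congr rfl fun g hg => ?_
  have := Finset.mem_Ico.1 hg
  exact Nat.sub_add_cancel (length_le_lam (by omega))

end TokSum

theorem endCost_eq_costFrom (e : ℕ) (C : ℕ → List Tok) : endCost e C = costFrom e C 0 := by
  rw [endCost, costFrom, Finset.range_eq_Ico]

/-- Charge each floor `v` passed over to the gap `v - 1`, which the edge crosses as well. The last
gap crossed, `p + t.2.1`, precedes the target and remains uncharged, so its full weight is still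
available. -/
theorem covers_add_le_crossFrom (e x p : ℕ) (t : Tok) :
    ((Finset.Ico (x + 1) (e + 1)).filter (Covers p t)).card +
      (if x ≤ p + t.2.1 ∧ p + t.2.1 < e then (t.2.2 : ℕ) else 0) ≤ crossFrom e x p t := by
  have h1 : ((Finset.Ico (x + 1) (e + 1)).filter (Covers p t)).card =
      ∑ i ∈ Finset.Ico x e, if Covers p t (i + 1) then 1 else 0 := by
    rw [Finset.card_filter, Finset.sum_Ico_add' (fun i => if Covers p t i then 1 else 0)]
  have h2 : (if x ≤ p + t.2.1 ∧ p + t.2.1 < e then (t.2.2 : ℕ) else 0) =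
      ∑ i ∈ Finset.Ico x e, if p + t.2.1 = i then (t.2.2 : ℕ) else 0 := by
    simp
  rw [h1, h2, ← Finset.sum_add_distrib]
  refine Finset.sum_le_sum fun i _ => ?_
  have := t.2.2.pos
  by_cases h3 : Covers p t (i + 1)
  · have h4 := h3
    rw [Covers] at h4
    rw [if_pos h3, if_neg (by omega), if_pos (by omega)]
    omega
  · rw [if_neg h3]
    by_cases h4 : p + t.2.1 = i
    · rw [if_pos h4, if_pos (by omega), zero_add]
    · rw [if_neg h4]
      exact Nat.zero_le _

section Cost

variable {e : ℕ} {C : ℕ → List Tok}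

theorem card_le_tokSum_covers (hC : EndConf e C) (x : ℕ) (V : Finset ℕ)
    (hV : ∀ v ∈ V, x < v ∧ v ≤ e ∧ Covered C v) : V.card ≤ tokSum e C fun p t =>
      ((Finset.Ico (x + 1) (e + 1)).filter (Covers p t)).card := by
  simp only [Finset.card_filter]
  rw [← sum_tokSum, Finset.card_eq_sum_ones]
  refine le_trans (Finset.sum_le_sum fun v hv => ?_)
    (Finset.sum_le_sum_of_subset (s := V) fun v hv => ?_)
  · obtain ⟨-, -, p, t, ht, hc⟩ := hV v hv
    have hp : p < e + 2 := by
      have := hC.fits p t ht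
      omega
    refine le_trans ?_ (le_tokSum hp ht)
    rw [if_pos hc]
  · have := hV v hv
    exact Finset.mem_Ico.2 ⟨this.1, by omega⟩

/-- A token in a gap from `x` to `e - 1` lowers the cost by one, but regains this through the weight
in its last gap or, if it is an early `β`-vertex, through `earlyCount`. The number of floors it
passes over is left as a lower bound. -/
theorem covered_le_costFrom (hC : EndConf e C) (x : ℕ) (V : Finset ℕ)
    (hV : ∀ v ∈ V, x < v ∧ v ≤ e ∧ Covered C v) : V.card ≤ costFrom e C x := by
  have h1 := card_le_tokSum_covers hC x V hV
  have h2 := costFrom_add (e := e) (C := C) x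
  have h3 : tokSum e C (fun p t => ((Finset.Ico (x + 1) (e + 1)).filter (Covers p t)).card +
      if x ≤ p ∧ p < e then 1 else 0) ≤
      tokSum e C fun p t => crossFrom e x p t + if p < e ∧ p + t.2.1 = e then 1 else 0 := by
    refine tokSum_le_tokSum fun p hp t ht => ?_
    have h4 := covers_add_le_crossFrom e x p t
    have h5 := hC.fits p t ht
    have := t.2.2.pos
    split_ifs at h4 ⊢ <;> omega
  rw [tokSum_add] at h3
  omega

/-- An edge of weight at least `2` leaving from the gap before the floor `e` improves the bound. -/
theorem covered_lt_costFrom (hC : EndConf e C) {x : ℕ} (hx : x < e) (V : Finset ℕ)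
    (hV : ∀ v ∈ V, x < v ∧ v ≤ e ∧ Covered C v)
    (hh : ∃ p, ∃ t ∈ C p, p + t.2.1 + 1 = e ∧ 2 ≤ (t.2.2 : ℕ)) : V.card < costFrom e C x := by
  have h1 := card_le_tokSum_covers hC x V hV
  have h2 := costFrom_add (e := e) (C := C) x
  have h6 : 1 ≤ tokSum e C fun p t => if p + t.2.1 + 1 = e ∧ 2 ≤ (t.2.2 : ℕ) then 1 else 0 := by
    obtain ⟨p, t, ht, hc⟩ := hh
    refine le_trans ?_ (le_tokSum (show p < e + 2 by omega) ht)
    rw [if_pos hc]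
  -- The last gap of a heavy token is `e - 1`, which is at least `x`; its weight of at least two
  -- leaves one unit beyond the compensation.
  have h3 : tokSum e C (fun p t => (((Finset.Ico (x + 1) (e + 1)).filter (Covers p t)).card +
      if x ≤ p ∧ p < e then 1 else 0) + if p + t.2.1 + 1 = e ∧ 2 ≤ (t.2.2 : ℕ) then 1 else 0) ≤
      tokSum e C fun p t => crossFrom e x p t + if p < e ∧ p + t.2.1 = e then 1 else 0 := by
    refine tokSum_le_tokSum fun p hp t ht => ?_
    have h4 := covers_add_le_crossFrom e x p t
    have h5 := hC.fits p t ht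
    have := t.2.2.pos
    split_ifs at h4 ⊢ <;> omega
  rw [tokSum_add, tokSum_add] at h3
  omega

/-- An end of weight `w` crosses a gap before `e` with weight `w`, and the unit subtracted for an
early one is returned by `earlyCount`. A midpoint keeps `w - 1` from its last gap; being nontrivial,
it passes over a floor or has `w ≥ 2`. -/
theorem cost_token (hC : EndConf e C) {p : ℕ} {t : Tok} (ht : t ∈ C p) :
    (if 0 ≤ p ∧ p < e then 1 else 0) +
        max 1 (if e ≤ p + t.2.1 then (t.2.2 : ℕ) else t.2.2 - 1) ≤
      crossFrom e 0 p t + if p < e ∧ p + t.2.1 = e then 1 else 0 := by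
  have h1 := covers_add_le_crossFrom e 0 p t
  have h2 := hC.fits p t ht
  have h3 := hC.nontriv p t ht
  have hw := t.2.2.pos
  have hsingle : ∀ i < e, p ≤ i + t.1 → i ≤ p + t.2.1 → (t.2.2 : ℕ) ≤ crossFrom e 0 p t := by
    intro i hi h h'
    refine le_trans ?_ (Finset.single_le_sum
      (f := fun i => if p ≤ i + t.1 ∧ i ≤ p + t.2.1 then (t.2.2 : ℕ) else 0)
      (fun _ _ => Nat.zero_le _) (Finset.mem_Ico.2 ⟨Nat.zero_le i, hi⟩))
    rw [if_pos ⟨h, h'⟩]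
  have hcov : ∀ v, 1 ≤ v → v ≤ e → Covers p t v →
      1 ≤ ((Finset.Ico (0 + 1) (e + 1)).filter (Covers p t)).card := by
    intro v h1 h2 h3
    exact Finset.card_pos.2 ⟨v, Finset.mem_filter.2 ⟨Finset.mem_Ico.2 ⟨by omega, by omega⟩, h3⟩⟩
  rcases lt_trichotomy p e with hp | hp | hp
  · have hsp := hsingle p hp (by omega) (by omega)
    by_cases hb : p + t.2.1 = e
    · rw [if_pos ⟨Nat.zero_le _, hp⟩, if_pos hb.ge, if_pos ⟨hp, hb⟩]
      omega
    · have hb' : p + t.2.1 < e := by omega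
      rw [if_pos ⟨Nat.zero_le _, hp⟩, if_neg (by omega), if_neg (by omega)]
      rw [if_pos ⟨Nat.zero_le _, hb'⟩] at h1
      have h4 : t ≠ (0, 0, 1) := by
        intro h
        rw [← Bool.not_eq_false, nontriv_eq_false_lt hp] at h3
        exact h3 h
      by_cases ha : 1 ≤ t.1
      · have := hcov p (by omega) (by omega) ⟨by omega, by omega⟩
        omega
      · by_cases hb : 1 ≤ t.2.1
        · have := hcov (p + 1) (by omega) (by omega) ⟨by omega, by omega⟩
          omega
        · have : (t.2.2 : ℕ) ≠ 1 := by
            intro hw1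
            refine h4 (Prod.ext ?_ (Prod.ext ?_ (PNat.eq hw1)))
            · simp only
              omega
            · simp only
              omega
          omega
  · subst hp
    rw [← Bool.not_eq_false, nontriv_eq_false_eq] at h3
    have := hsingle (p - 1) (by omega) (by omega) (by omega)
    rw [if_neg (by omega), if_pos (by omega)]
    omega
  · obtain rfl : p = e + 1 := by omega
    rw [← Bool.not_eq_false, nontriv_eq_false_last] at h3
    have := hsingle (e - 1) (by omega) (by omega) (by omega)
    rw [if_neg (by omega), if_pos (by omega)]
    omega

theorem tokSum_le_endCost (hC : EndConf e C) :
    tokSum e C (fun p t => max 1 (if e ≤ p + t.2.1 then (t.2.2 : ℕ) else t.2.2 - 1)) ≤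
      endCost e C := by
  have h1 := costFrom_add (e := e) (C := C) 0
  have h2 := tokSum_le_tokSum (e := e) fun p _ t ht => cost_token hC (p := p) (t := t) ht
  rw [tokSum_add] at h2
  rw [endCost_eq_costFrom]
  omega

theorem EndConf.lt_of_mem (hC : EndConf e C) {p : ℕ} {t : Tok} (ht : t ∈ C p) : p < e + 2 := by
  have := hC.fits p t ht
  omega

theorem EndConf.eq_nil (hC : EndConf e C) {p : ℕ} (hp : e + 2 ≤ p) : C p = [] :=
  hC.fits.eq_nil (by omega)

theorem weight_le_endCost_add (hC : EndConf e C) {p : ℕ} {t : Tok} (ht : t ∈ C p) :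
    (t.2.2 : ℕ) ≤ endCost e C + 1 := by
  have h := (le_tokSum (f := fun p t => max 1 (if e ≤ p + t.2.1 then (t.2.2 : ℕ) else t.2.2 - 1))
    (hC.lt_of_mem ht) ht).trans (tokSum_le_endCost hC)
  split_ifs at h <;> omega

/-- This bound on the weights of nontrivial ends is the reason why only the `α_i` and `β_i` with `i
≤ δ` occur individually. -/
theorem weight_le_endCost (hC : EndConf e C) {p : ℕ} {t : Tok} (ht : t ∈ C p)
    (hp : e ≤ p + t.2.1) : (t.2.2 : ℕ) ≤ endCost e C := by
  have h := (le_tokSum (f := fun p t => max 1 (if e ≤ p + t.2.1 then (t.2.2 : ℕ) else t.2.2 - 1))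
    (hC.lt_of_mem ht) ht).trans (tokSum_le_endCost hC)
  rw [if_pos hp] at h
  omega

theorem length_le_endCost (hC : EndConf e C) (g : ℕ) : (C g).length ≤ endCost e C := by
  by_cases hg : g < e + 2
  · refine (length_le_tokSum hg).trans (le_trans (tokSum_le_tokSum fun _ _ _ _ => ?_)
      (tokSum_le_endCost hC))
    exact le_max_left _ _
  · rw [hC.eq_nil (by omega)]
    exact Nat.zero_le _

theorem EndConf.eq_nil_of_endCost_eq_zero (hC : EndConf e C) (h : endCost e C = 0) :
    C = fun _ => [] := by
  ext1 g
  have := length_le_endCost hC g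
  exact List.eq_nil_of_length_eq_zero (by omega)

end Cost

/-! ### Finiteness of the set of configurations. -/

/-- The functions choosing an element from each of finitely many finite sets. -/
theorem exists_finset_forall_mem {X : Type*} [DecidableEq X] (x₀ : X) (n : ℕ) (S : ℕ → Finset X)
    (hS : ∀ g, n ≤ g → S g = {x₀}) :
    ∃ F : Finset (ℕ → X), (∀ f, f ∈ F ↔ ∀ g, f g ∈ S g) ∧
      F.card = ∏ g ∈ Finset.range n, (S g).card := by
  let ext : (∀ g ∈ Finset.range n, X) → ℕ → X := fun f g =>
    if h : g ∈ Finset.range n then f g h else x₀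
  have hinj : Function.Injective ext := by
    intro f f' h
    ext g hg
    have := congrFun h g
    simpa only [ext, dif_pos hg] using this
  refine ⟨((Finset.range n).pi S).map ⟨ext, hinj⟩, fun f => ?_, ?_⟩
  · rw [Finset.mem_map]
    constructor
    · rintro ⟨f, hf, rfl⟩ g
      simp only [Function.Embedding.coeFn_mk, ext]
      split_ifs with h
      · exact Finset.mem_pi.1 hf g h
      · rw [hS g (by simpa using h)]
        exact Finset.mem_singleton_self _
    · intro hf
      refine ⟨fun g _ => f g, Finset.mem_pi.2 fun g _ => hf g, ?_⟩
      ext1 g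
      simp only [Function.Embedding.coeFn_mk, ext]
      split_ifs with h
      · rfl
      · have := hf g
        rw [hS g (by simpa using h), Finset.mem_singleton] at this
        exact this.symm
  · rw [Finset.card_map, Finset.card_pi]

theorem finite_lists {X : Type*} {B : Set X} (hB : B.Finite) (k : ℕ) :
    {l : List X | l.length ≤ k ∧ ∀ x ∈ l, x ∈ B}.Finite := by
  induction k with
  | zero =>
    refine (Set.finite_singleton []).subset fun l hl => ?_
    exact List.eq_nil_of_length_eq_zero (Nat.le_zero.1 hl.1)
  | succ k ih =>
    refine ((Set.finite_singleton []).union (Set.Finite.image2 List.cons hB ih)).subset ?_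
    rintro (_ | ⟨x, l⟩) hl
    · exact Or.inl rfl
    · refine Or.inr ⟨x, hl.2 x List.mem_cons_self, l, ⟨?_, ?_⟩, rfl⟩
      · have := hl.1
        simp only [List.length_cons] at this
        omega
      · exact fun y hy => hl.2 y (List.mem_cons_of_mem _ hy)

theorem finite_endConf (e k : ℕ) : {C | EndConf e C ∧ endCost e C = k}.Finite := by
  classical
  have hB : {t : Tok | t.1 ≤ e + 1 ∧ t.2.1 ≤ e ∧ (t.2.2 : ℕ) ≤ k + 1}.Finite := by
    refine (((Set.finite_Iic (e + 1)).prod ((Set.finite_Iic e).prod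
      (Set.finite_Iic (⟨k + 1, k.succ_pos⟩ : ℕ+))))).subset ?_
    rintro ⟨a, b, w⟩ ⟨h1, h2, h3⟩
    exact ⟨h1, h2, h3⟩
  have hl := finite_lists hB k
  obtain ⟨F, hF, -⟩ := exists_finset_forall_mem ([] : List Tok) (e + 2)
    (fun g => if g < e + 2 then hl.toFinset else {[]}) (fun g hg => if_neg (by omega))
  refine F.finite_toSet.subset ?_
  rintro C ⟨hC, hk⟩
  refine (hF C).2 fun g => ?_
  split_ifs with hg
  · rw [Set.Finite.mem_toFinset]
    refine ⟨hk ▸ length_le_endCost hC g, fun t ht => ?_⟩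
    have h1 := hC.fits g t ht
    have h2 := weight_le_endCost_add hC ht
    refine ⟨?_, ?_, ?_⟩ <;> omega
  · rw [hC.eq_nil (by omega)]
    exact Finset.mem_singleton_self _

/-- The words of degree `e + 1` with nontrivial tokens only, contributing `k` to the cogenus. -/
noncomputable def endConfs (e k : ℕ) : Finset (ℕ → List Tok) := (finite_endConf e k).toFinset

theorem mem_endConfs {e k : ℕ} {C : ℕ → List Tok} :
    C ∈ endConfs e k ↔ EndConf e C ∧ endCost e C = k := by
  simp [endConfs]

/-! ### The number of words with given nontrivial tokens. -/

/-- The number of ways to insert trivial tokens into a list of `r` tokens in a gap which `x` units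
of weight have to cross, `l` of them with nontrivial tokens. -/
def gapFactor (x l r : ℕ) : ℕ := if l ≤ x + r then (x + r - l).choose r else 0

/-- The contribution of all gaps but the last two, the gaps being preceded by `s` others. -/
def confVal (s e : ℕ) (C : ℕ → List Tok) : ℚ :=
  wordWeight (e + 1) C * ∏ g ∈ Finset.range e, (gapFactor (s + g + 1) (lam e C g) (C g).length : ℚ)

/-- The number of nontrivial `β`-vertices of weight `w`. -/
def usedBeta (e : ℕ) (C : ℕ → List Tok) (w : ℕ+) : ℕ :=
  earlyEnds e C w + weightCount (fun t : Tok => t.2.2) w (C e)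

/-- The number of nontrivial `α`-vertices of weight `w`. -/
def usedAlpha (e : ℕ) (C : ℕ → List Tok) (w : ℕ+) : ℕ :=
  weightCount (fun t : Tok => t.2.2) w (C (e + 1))

/-- The contribution of the last two gaps, up to the factor `(|β| - δ)! / β!`. -/
def endFactor (δ : ℕ) (U : Finset ℕ+) (α β : TangencySeq) (e : ℕ) (C : ℕ → List Tok) : ℚ :=
  (β.size - earlyCount e C).descFactorial (δ - earlyCount e C) / (C e).length ! *
    ((∏ w ∈ U, ((β w).descFactorial (usedBeta e C w) : ℚ)) *
      ∏ w ∈ U, ((α w).choose (usedAlpha e C w) : ℚ))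

theorem weightCount_filter_add {X : Type*} (wt : X → ℕ+) (w : ℕ+) (p : X → Bool) (l : List X) :
    weightCount wt w (l.filter p) ≤ weightCount wt w l := by
  rw [weightCount, weightCount, ← sum_map_filter_add p _ l]
  exact Nat.le_add_right _ _

theorem sum_weightCount {X : Type*} (wt : X → ℕ+) (U : Finset ℕ+) (l : List X)
    (h : ∀ x ∈ l, wt x ∈ U) : ∑ w ∈ U, weightCount wt w l = l.length := by
  have := sum_mul_weightIndicator wt (fun _ => True) (fun _ => 1) U l fun x hx _ => h x hx
  simpa [weightCount] using this

theorem sum_earlyEnds (e : ℕ) (C : ℕ → List Tok) (U : Finset ℕ+)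
    (h : ∀ g < e, ∀ t ∈ C g, g + t.2.1 = e → t.2.2 ∈ U) :
    ∑ w ∈ U, earlyEnds e C w = earlyCount e C := by
  simp only [earlyEnds]
  rw [Finset.sum_comm, earlyCount]
  refine Finset.sum_congr rfl fun g hg => ?_
  have := sum_mul_weightIndicator (fun t : Tok => t.2.2) (fun t => g + t.2.1 = e) (fun _ => 1) U
    (C g) (h g (Finset.mem_range.1 hg))
  simpa using this

section Slots

variable {e : ℕ} {C : ℕ → List Tok}

theorem exists_slot_lt (hC : EndConf e C) (α β : TangencySeq) {g : ℕ} (hg : g < e) :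
    ∃ F : Finset (List Tok), (∀ L, L ∈ F ↔ IsSlot e α β C g L) ∧
      F.card = gapFactor (g + 1) (lam e C g) (C g).length := by
  have hiff : ∀ L, IsSlot e α β C g L ↔
      L.filter (nontriv e g) = C g ∧ L.length + lam e C g = g + 1 + (C g).length := by
    intro L
    refine ⟨fun h => ⟨h.1, h.2.1 hg⟩, fun h => ⟨h.1, fun _ => h.2, ?_, ?_, ?_⟩⟩ <;>
      · intro h
        omega
  -- If `lam` exceeds `g + 1` but not this bound, no word exists and the binomial coefficient
  -- vanishes by itself.
  by_cases h : lam e C g ≤ g + 1 + (C g).length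
  · obtain ⟨F, hF, hcard⟩ := exists_finset_filter_length (nontriv e g) (0, 0, 1)
      (fun x => nontriv_eq_false_lt hg) (g + 1 + (C g).length - lam e C g) (C g) (hC.nontriv g)
    refine ⟨F, fun L => ?_, ?_⟩
    · rw [hF, hiff]
      refine and_congr_right fun _ => ?_
      omega
    · rw [hcard, gapFactor, if_pos h]
  · refine ⟨∅, fun L => ?_, ?_⟩
    · rw [hiff]
      simp only [Finset.notMem_empty, false_iff]
      rintro ⟨-, h'⟩
      omega
    · rw [gapFactor, if_neg h, Finset.card_empty]

theorem usedBeta_eq_zero (U : Finset ℕ+) (hU1 : ∀ t ∈ C e, t.2.2 ∈ U)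
    (hU2 : ∀ g < e, ∀ t ∈ C g, g + t.2.1 = e → t.2.2 ∈ U) {w : ℕ+} (hw : w ∉ U) :
    usedBeta e C w = 0 := by
  have h0 : weightCount (fun t : Tok => t.2.2) w (C e) = 0 := by
    refine weightCount_eq_zero.2 ?_
    rintro x hx rfl
    exact hw (hU1 x hx)
  rw [usedBeta, earlyEnds, h0, add_zero]
  refine Finset.sum_eq_zero fun g hg => List.sum_eq_zero fun y hy => ?_
  obtain ⟨t, ht, rfl⟩ := List.mem_map.1 hy
  rw [if_neg]
  rintro ⟨h1, rfl⟩
  exact hw (hU2 g (Finset.mem_range.1 hg) t ht h1)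

/-- The gap `e` holds `|β| - b` tokens, `b` being the number of early `β`-vertices: the `r`
nontrivial ones in their given order and `β w - usedBeta w` trivial ones of each weight. The
multinomial count is multiplied by `r! * β!`, and `β!` divided by the factorials of the trivial
multiplicities is a product of falling factorials. Both sides vanish if some weight is overused. -/
theorem exists_slot_eq (hC : EndConf e C) (α β : TangencySeq) (U : Finset ℕ+)
    (hU1 : ∀ t ∈ C e, t.2.2 ∈ U) (hU2 : ∀ g < e, ∀ t ∈ C g, g + t.2.1 = e → t.2.2 ∈ U) :
    ∃ F : Finset (List Tok), (∀ L, L ∈ F ↔ IsSlot e α β C e L) ∧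
      F.card * ((C e).length ! * β.fact) =
        (β.size - earlyCount e C)! * ∏ w ∈ U, (β w).descFactorial (usedBeta e C w) := by
  have hiff : ∀ L, IsSlot e α β C e L ↔ L.filter (nontriv e e) = C e ∧
      (∀ x ∈ L, nontriv e e x = false → x = (0, 0, x.2.2)) ∧
        ∀ w, weightCount (fun t : Tok => t.2.2) w L + earlyEnds e C w = β w := by
    intro L
    refine ⟨fun h => ⟨h.1, h.2.2.1 rfl⟩, fun h => ⟨h.1, ?_, fun _ => h.2, ?_, ?_⟩⟩ <;>
      · intro h
        omega
  by_cases hle : ∀ w, usedBeta e C w ≤ β w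
  · let m : TangencySeq := Finsupp.onFinset β.support (fun w => β w - usedBeta e C w) (by
      intro w hw
      rw [Finsupp.mem_support_iff]
      omega)
    have hm : ∀ w, m w = β w - usedBeta e C w := fun w => rfl
    have hsum : ∑ w ∈ U, usedBeta e C w = earlyCount e C + (C e).length := by
      simp only [usedBeta]
      rw [Finset.sum_add_distrib, sum_earlyEnds e C U hU2, sum_weightCount _ U _ hU1]
    have hused : ∀ w ∉ U, usedBeta e C w = 0 := fun w => usedBeta_eq_zero U hU1 hU2
    have hsize : (C e).length + m.size = β.size - earlyCount e C := by
      have h1 : β.size = ∑ w ∈ β.support ∪ U, β w :=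
        Finsupp.sum_of_support_subset _ Finset.subset_union_left _ (by simp)
      have h2 : m.size = ∑ w ∈ β.support ∪ U, m w :=
        Finsupp.sum_of_support_subset _
          (Finsupp.support_onFinset_subset.trans Finset.subset_union_left) _ (by simp)
      have h3 : ∑ w ∈ β.support ∪ U, usedBeta e C w = ∑ w ∈ U, usedBeta e C w :=
        (Finset.sum_subset Finset.subset_union_right fun w _ hw => hused w hw).symm
      have h4 : ∑ w ∈ β.support ∪ U, m w + ∑ w ∈ β.support ∪ U, usedBeta e C w =
          ∑ w ∈ β.support ∪ U, β w := by
        rw [← Finset.sum_add_distrib]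
        exact Finset.sum_congr rfl fun w _ => Nat.sub_add_cancel (hle w)
      omega
    have hfact : m.fact * ∏ w ∈ U, (β w).descFactorial (usedBeta e C w) = β.fact := by
      rw [TangencySeq.fact_eq_prod (U := β.support ∪ U) Finset.subset_union_left,
        TangencySeq.fact_eq_prod (m := m)
          (Finsupp.support_onFinset_subset.trans Finset.subset_union_left),
        Finset.prod_subset (s₁ := U) (s₂ := β.support ∪ U) Finset.subset_union_right fun w _ hw => by
          rw [hused w hw, Nat.descFactorial_zero], ← Finset.prod_mul_distrib]
      exact Finset.prod_congr rfl fun w _ => Nat.factorial_mul_descFactorial (hle w)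
    obtain ⟨F, hF, hcard⟩ := exists_finset_shuffle (nontriv e e) (fun t : Tok => t.2.2)
      (fun w => (0, 0, w)) (fun w => nontriv_eq_false_eq.2 rfl) (fun _ => rfl) _ (C e) m
      (hC.nontriv e) hsize
    refine ⟨F, fun L => ?_, ?_⟩
    · rw [hF, hiff]
      refine and_congr_right fun _ => and_congr_right fun _ => forall_congr' fun w => ?_
      have := hle w
      rw [usedBeta] at this
      rw [hm, usedBeta]
      omega
    · rw [← hfact, ← hcard]
      ring
  · obtain ⟨w, hw⟩ := not_forall.1 hle
    refine ⟨∅, fun L => ?_, ?_⟩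
    · rw [hiff]
      simp only [Finset.notMem_empty, false_iff]
      rintro ⟨h1, -, h2⟩
      refine hw ?_
      rw [usedBeta, ← h2 w, ← h1, add_comm]
      exact Nat.add_le_add_right (weightCount_filter_add _ _ _ _) _
    · have hwU : w ∈ U := by
        by_contra hwU
        have := usedBeta_eq_zero U hU1 hU2 hwU
        omega
      rw [Finset.prod_eq_zero hwU (Nat.descFactorial_eq_zero_iff_lt.2 (not_le.1 hw))]
      simp

theorem exists_slot_last (hC : EndConf e C) (α β : TangencySeq) (U : Finset ℕ+)
    (hU : ∀ t ∈ C (e + 1), t.2.2 ∈ U) :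
    ∃ F : Finset (List Tok), (∀ L, L ∈ F ↔ IsSlot e α β C (e + 1) L) ∧
      F.card = ∏ w ∈ U, (α w).choose (usedAlpha e C w) := by
  obtain ⟨F, hF, hcard⟩ := exists_finset_sorted (nontriv e (e + 1)) (fun t : Tok => t.2.2)
    (fun w => (1, 0, w)) (fun w => nontriv_eq_false_last.2 rfl) (fun _ => rfl) U _ (C (e + 1)) α
    (hC.nontriv _) hU hC.sorted rfl
  refine ⟨F, fun L => ?_, hcard⟩
  rw [hF]
  refine ⟨fun h => ⟨h.1, ?_, ?_, fun _ => h.2, ?_⟩, fun h => ⟨h.1, h.2.2.2.1 rfl⟩⟩ <;>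
    · intro h
      omega

theorem isSlot_of_lt (hC : EndConf e C) (α β : TangencySeq) {g : ℕ} (hg : e + 1 < g)
    (L : List Tok) : IsSlot e α β C g L ↔ L = [] := by
  refine ⟨fun h => h.2.2.2.2 hg, ?_⟩
  rintro rfl
  refine ⟨(hC.eq_nil (by omega)).symm, ?_, ?_, ?_, fun _ => rfl⟩ <;>
    · intro h
      omega

theorem exists_fiber (hC : EndConf e C) (α β : TangencySeq) (U : Finset ℕ+) {δ : ℕ}
    (hU : ∀ w : ℕ+, (w : ℕ) ≤ δ → w ∈ U) (hδ : endCost e C = δ) (hβ : δ ≤ β.size) :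
    ∃ F : Finset (ℕ → List Tok), (∀ W, W ∈ F ↔ ∀ g, IsSlot e α β C g (W g)) ∧
      (wordWeight (e + 1) C * F.card : ℚ) =
        ((β.size - δ)! : ℕ) / β.fact * (confVal 0 e C * endFactor δ U α β e C) := by
  classical
  have hw : ∀ p, ∀ t ∈ C p, e ≤ p + t.2.1 → t.2.2 ∈ U := fun p t ht h =>
    hU _ (hδ ▸ weight_le_endCost hC ht h)
  obtain ⟨F1, hF1, hc1⟩ := exists_slot_eq hC α β U (fun t ht => hw e t ht (by omega))
    (fun g _ t ht h => hw g t ht h.ge)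
  obtain ⟨F2, hF2, hc2⟩ := exists_slot_last hC α β U (fun t ht => hw _ t ht (by omega))
  choose! F0 hF0 hc0 using fun g (hg : g < e) => exists_slot_lt hC α β hg
  let S : ℕ → Finset (List Tok) := fun g =>
    if g < e then F0 g else if g = e then F1 else if g = e + 1 then F2 else {[]}
  have hS : ∀ g L, L ∈ S g ↔ IsSlot e α β C g L := by
    intro g L
    simp only [S]
    split_ifs with h1 h2 h3
    · exact hF0 g h1 L
    · rw [h2]
      exact hF1 L
    · rw [h3]
      exact hF2 L
    · rw [isSlot_of_lt hC α β (by omega), Finset.mem_singleton]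
  obtain ⟨F, hF, hcard⟩ := exists_finset_forall_mem ([] : List Tok) (e + 2) S (fun g hg => by
    simp only [S]
    rw [if_neg (by omega), if_neg (by omega), if_neg (by omega)])
  refine ⟨F, fun W => ?_, ?_⟩
  · rw [hF]
    exact forall_congr' fun g => hS g _
  · have hcard' : F.card = (∏ g ∈ Finset.range e, gapFactor (g + 1) (lam e C g) (C g).length) *
        F1.card * ∏ w ∈ U, (α w).choose (usedAlpha e C w) := by
      rw [hcard, Finset.prod_range_succ, Finset.prod_range_succ, ← hc2]
      congr 2
      · refine Finset.prod_congr rfl fun g hg => ?_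
        simp only [S, if_pos (Finset.mem_range.1 hg)]
        exact hc0 g (Finset.mem_range.1 hg)
      · simp [S]
      · simp [S]
    have hb : earlyCount e C ≤ δ := by
      rw [← hδ, endCost]
      omega
    -- The normalising factor `(|β| - δ)!` is split off here, using `earlyCount e C ≤ δ ≤ |β|`; a
    -- falling factorial, polynomial in `|β|`, remains.
    have hdesc : (β.size - earlyCount e C)! =
        (β.size - δ)! * (β.size - earlyCount e C).descFactorial (δ - earlyCount e C) := by
      rw [← Nat.factorial_mul_descFactorial
        (show δ - earlyCount e C ≤ β.size - earlyCount e C by omega)]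
      congr 2
      omega
    have hr : ((C e).length ! : ℚ) ≠ 0 := Nat.cast_ne_zero.2 (Nat.factorial_ne_zero _)
    have hf : (β.fact : ℚ) ≠ 0 := by
      rw [TangencySeq.fact_eq_prod subset_rfl]
      exact Nat.cast_ne_zero.2 (Finset.prod_ne_zero_iff.2 fun w _ => Nat.factorial_ne_zero _)
    have hc1' : (F1.card : ℚ) = ((β.size - δ)! : ℕ) *
        (β.size - earlyCount e C).descFactorial (δ - earlyCount e C) *
          (∏ w ∈ U, ((β w).descFactorial (usedBeta e C w) : ℚ)) / ((C e).length ! * β.fact) := by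
      rw [eq_div_iff (mul_ne_zero hr hf)]
      rw [hdesc] at hc1
      exact_mod_cast hc1
    rw [hcard', Nat.cast_mul, Nat.cast_mul, hc1', confVal, endFactor, Nat.cast_prod, Nat.cast_prod]
    simp only [zero_add]
    field_simp

end Slots

theorem ValidWord.endConf_eraseTriv {e : ℕ} {α β : TangencySeq} {W : ℕ → List Tok}
    (h : ValidWord (e + 1) α β W) : EndConf e (eraseTriv e W) where
  fits g t ht := h.fits g t (List.mem_filter.1 ht).1
  nontriv _ _ ht := (List.mem_filter.1 ht).2
  sorted := h.sorted.filter _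

theorem wordWeight_eraseTriv (e : ℕ) (W : ℕ → List Tok) :
    wordWeight (e + 1) (eraseTriv e W) = wordWeight (e + 1) W := by
  refine Finset.prod_congr rfl fun g hg => ?_
  have hg' := Finset.mem_range.1 hg
  rw [eraseTriv]
  generalize W g = l
  induction l with
  | nil => rfl
  | cons t l ih =>
    rcases ht : nontriv e g t with _ | _
    · rw [List.filter_cons_of_neg (by simp [ht]), ih, List.map_cons, List.prod_cons]
      rcases Nat.lt_succ_iff_lt_or_eq.1 hg' with h | rfl
      · rw [nontriv_eq_false_lt h] at ht
        subst ht
        simp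
      · rw [if_neg (by omega), one_mul]
    · rw [List.filter_cons_of_pos (by simp [ht]), List.map_cons, List.prod_cons, ih, List.map_cons,
        List.prod_cons]

/-- Words are grouped by their nontrivial tokens, which already determine the multiplicity since
trivial midpoints have weight one. Finitely many finite fibres also provide the finiteness needed
for the sum over words. -/
theorem relativeSeveriDegree_eq_sum_endConfs {δ e : ℕ} (α β : TangencySeq)
    (hd : e + 1 = α.weight + β.weight) (hβ : δ ≤ β.size) (U : Finset ℕ+)
    (hU : ∀ w : ℕ+, (w : ℕ) ≤ δ → w ∈ U) :
    (relativeSeveriDegree δ α β : ℚ) = β.powProd * ((β.size - δ)! : ℕ) / β.fact *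
      ∑ C ∈ endConfs e δ, confVal 0 e C * endFactor δ U α β e C := by
  classical
  choose! F hF hcard using fun C (hC : C ∈ endConfs e δ) =>
    exists_fiber (mem_endConfs.1 hC).1 α β U hU (mem_endConfs.1 hC).2 hβ
  have hmem : ∀ W, (ValidWord (e + 1) α β W ∧ midCount (e + 1) W + δ = (e + 1).choose 2) ↔
      ∃ C ∈ endConfs e δ, W ∈ F C ∧ eraseTriv e W = C := by
    intro W
    constructor
    · intro h
      have h1 := (validWord_iff_slots h.1.endConf_eraseTriv hd δ).1 ⟨h, rfl⟩
      have h2 := mem_endConfs.2 ⟨h.1.endConf_eraseTriv, h1.1⟩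
      exact ⟨_, h2, (hF _ h2 W).2 h1.2, rfl⟩
    · rintro ⟨C, hC, hW, -⟩
      have h1 := mem_endConfs.1 hC
      exact ((validWord_iff_slots h1.1 hd δ).2 ⟨h1.2, (hF C hC W).1 hW⟩).1
  have hfin : {W | ValidWord (e + 1) α β W ∧ midCount (e + 1) W + δ = (e + 1).choose 2}.Finite := by
    refine ((endConfs e δ).biUnion F).finite_toSet.subset fun W hW => ?_
    obtain ⟨C, hC, hW, -⟩ := (hmem W).1 hW
    exact Finset.mem_biUnion.2 ⟨C, hC, hW⟩
  have hfilter : ∀ C ∈ endConfs e δ, hfin.toFinset.filter (fun W => eraseTriv e W = C) = F C := by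
    intro C hC
    ext W
    have h1 := mem_endConfs.1 hC
    rw [Finset.mem_filter, Set.Finite.mem_toFinset, hF C hC]
    exact (validWord_iff_slots h1.1 hd δ).trans (and_iff_right h1.2)
  rw [relativeSeveriDegree_eq_sum_word δ α β hd hfin, Nat.cast_mul, mul_div_assoc, mul_assoc,
    Finset.mul_sum]
  congr 1
  rw [Nat.cast_sum, ← Finset.sum_fiberwise_of_maps_to (g := eraseTriv e) (t := endConfs e δ)]
  · refine Finset.sum_congr rfl fun C hC => ?_
    rw [← hcard C hC, hfilter C hC, mul_comm (wordWeight (e + 1) C : ℚ), ← nsmul_eq_mul,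
      ← Finset.sum_const]
    refine Finset.sum_congr rfl fun W hW => ?_
    rw [← hfilter C hC] at hW
    rw [← wordWeight_eraseTriv e W, (Finset.mem_filter.1 hW).2]
  · intro W hW
    obtain ⟨C, hC, -, rfl⟩ := (hmem W).1 (hfin.mem_toFinset.1 hW)
    exact hC

/-! ### Splitting at a floor over which no token passes. -/

/-- The part of a word before the floor `v`. -/
def leftPart (v : ℕ) (C : ℕ → List Tok) (g : ℕ) : List Tok := if g < v then C g else []

/-- The part of a word after the floor `v`. -/
def rightPart (v : ℕ) (C : ℕ → List Tok) (g : ℕ) : List Tok := C (v + g)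

/-- The concatenation of two words. -/
def glue (v : ℕ) (C₁ C₂ : ℕ → List Tok) (g : ℕ) : List Tok := if g < v then C₁ g else C₂ (g - v)

theorem glue_leftPart_rightPart (v : ℕ) (C : ℕ → List Tok) :
    glue v (leftPart v C) (rightPart v C) = C := by
  ext1 g
  rw [glue, leftPart, rightPart]
  split_ifs with h
  · rfl
  · rw [Nat.add_sub_cancel' (not_lt.1 h)]

theorem rightPart_glue (v : ℕ) (C₁ C₂ : ℕ → List Tok) : rightPart v (glue v C₁ C₂) = C₂ := by
  ext1 g
  rw [rightPart, glue, if_neg (by omega), Nat.add_sub_cancel_left]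

theorem leftPart_glue {v : ℕ} {C₁ : ℕ → List Tok} (h : ∀ p, v ≤ p → C₁ p = [])
    (C₂ : ℕ → List Tok) : leftPart v (glue v C₁ C₂) = C₁ := by
  ext1 g
  rw [leftPart, glue]
  split_ifs with h'
  · rfl
  · exact (h g (not_lt.1 h')).symm

section Uncovered

variable {C : ℕ → List Tok} {v : ℕ}

theorem right_lt_of_not_covered (h : ¬ Covered C v) {p : ℕ} (hp : p < v) {t : Tok} (ht : t ∈ C p) :
    p + t.2.1 < v := by
  by_contra hc
  exact h ⟨p, t, ht, by omega, by omega⟩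

theorem left_le_of_not_covered (h : ¬ Covered C v) {p : ℕ} (hp : v ≤ p) {t : Tok} (ht : t ∈ C p) :
    v + t.1 ≤ p := by
  by_contra hc
  exact h ⟨p, t, ht, by omega, by omega⟩

theorem EndConf.not_covered_zero {e : ℕ} (hC : EndConf e C) : ¬ Covered C 0 := by
  rintro ⟨p, t, ht, hc, -⟩
  have := hC.fits p t ht
  omega

/-- A nontrivial token in one of the last two gaps starts before the last floor, hence passes over
it. -/
theorem EndConf.eq_nil_of_not_covered (hC : EndConf v C) (h : ¬ Covered C v) (p : ℕ) (hp : v ≤ p) :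
    C p = [] := by
  refine List.eq_nil_iff_forall_not_mem.2 fun t ht => ?_
  have h1 := left_le_of_not_covered h hp ht
  have h2 := hC.nontriv p t ht
  have h3 := hC.fits p t ht
  rw [← Bool.not_eq_false] at h2
  rcases eq_or_lt_of_le hp with rfl | hp'
  · rw [nontriv_eq_false_eq] at h2
    omega
  · obtain rfl : p = v + 1 := by omega
    rw [nontriv_eq_false_last] at h2
    omega

theorem nontriv_add (v e g : ℕ) (t : Tok) : nontriv (v + e) (v + g) t = nontriv e g t := by
  simp [nontriv]

theorem not_covered_leftPart (h : ¬ Covered C v) : ¬ Covered (leftPart v C) v := by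
  rintro ⟨p, t, ht, hc⟩
  rw [leftPart] at ht
  split_ifs at ht with hp
  · exact h ⟨p, t, ht, hc⟩
  · simp at ht

theorem covered_rightPart (h : ¬ Covered C v) {u : ℕ} (hu : 1 ≤ u) :
    Covered (rightPart v C) u ↔ Covered C (v + u) := by
  constructor
  · rintro ⟨p, t, ht, h1, h2⟩
    exact ⟨v + p, t, ht, by omega, by omega⟩
  · rintro ⟨p, t, ht, h1, h2⟩
    by_cases hp : p < v
    · have := right_lt_of_not_covered h hp ht
      omega
    · refine ⟨p - v, t, ?_, by omega, by omega⟩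
      rwa [rightPart, Nat.add_sub_cancel' (not_lt.1 hp)]

theorem EndConf.leftPart {e : ℕ} (hC : EndConf (v + e) C) (h : ¬ Covered C v) :
    EndConf v (leftPart v C) where
  fits g t ht := by
    rw [_root_.leftPart] at ht
    split_ifs at ht with hg
    · have h1 := right_lt_of_not_covered h hg ht
      have h2 := hC.fits g t ht
      omega
    · simp at ht
  nontriv g t ht := by
    rw [_root_.leftPart] at ht
    split_ifs at ht with hg
    · have h1 := hC.nontriv g t ht
      rw [← Bool.not_eq_false, nontriv_eq_false_lt (by omega)] at h1 ⊢
      exact h1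
    · simp at ht
  sorted := by
    rw [_root_.leftPart, if_neg (by omega)]
    exact List.Pairwise.nil

theorem EndConf.rightPart {e : ℕ} (hC : EndConf (v + e) C) (h : ¬ Covered C v) :
    EndConf e (rightPart v C) where
  fits g t ht := by
    have h1 := left_le_of_not_covered h (Nat.le_add_right v g) ht
    have h2 := hC.fits _ t ht
    omega
  nontriv g t ht := by
    rw [← nontriv_add v]
    exact hC.nontriv _ t ht
  sorted := hC.sorted

theorem EndConf.glue {e : ℕ} {C₁ C₂ : ℕ → List Tok} (h₁ : EndConf v C₁) (h : ¬ Covered C₁ v)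
    (h₂ : EndConf e C₂) : EndConf (v + e) (glue v C₁ C₂) where
  fits g t ht := by
    rw [_root_.glue] at ht
    split_ifs at ht with hg
    · have := h₁.fits g t ht
      have := right_lt_of_not_covered h hg ht
      omega
    · have := h₂.fits _ t ht
      omega
  nontriv g t ht := by
    rw [_root_.glue] at ht
    split_ifs at ht with hg
    · have h1 := h₁.nontriv g t ht
      rw [← Bool.not_eq_false, nontriv_eq_false_lt (by omega)] at h1 ⊢
      exact h1
    · have h2 := h₂.nontriv _ t ht
      rwa [← nontriv_add v, Nat.add_sub_cancel' (not_lt.1 hg)] at h2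
  sorted := by
    rw [_root_.glue, if_neg (by omega), add_assoc, Nat.add_sub_cancel_left]
    exact h₂.sorted

theorem not_covered_glue {e : ℕ} {C₁ C₂ : ℕ → List Tok} (h : ¬ Covered C₁ v) (h₂ : EndConf e C₂) :
    ¬ Covered (glue v C₁ C₂) v := by
  rintro ⟨p, t, ht, h1, h3⟩
  rw [glue] at ht
  split_ifs at ht with hg
  · exact h ⟨p, t, ht, h1, h3⟩
  · have := h₂.fits _ t ht
    omega

theorem sum_map_ite_eq_zero {X : Type*} (l : List X) (P : X → Prop) [DecidablePred P] (f : X → ℕ)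
    (h : ∀ x ∈ l, ¬ P x) : (l.map fun x => if P x then f x else 0).sum = 0 := by
  refine List.sum_eq_zero fun y hy => ?_
  obtain ⟨x, hx, rfl⟩ := List.mem_map.1 hy
  exact if_neg (h x hx)

theorem lam_leftPart {e : ℕ} (h : ¬ Covered C v) {g : ℕ} (hg : g < v) :
    lam (v + e) C g = lam v (leftPart v C) g := by
  rw [lam, lam, crossWord, crossWord, add_assoc, Finset.sum_range_add _ v (e + 2),
    Finset.sum_range_add _ v 2]
  congr 1
  · refine Finset.sum_congr rfl fun p hp => ?_
    rw [leftPart, if_pos (Finset.mem_range.1 hp)]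
  · trans 0
    · refine Finset.sum_eq_zero fun p _ => sum_map_ite_eq_zero _ _ _ fun t ht => ?_
      have := left_le_of_not_covered h (Nat.le_add_right v p) ht
      omega
    · refine (Finset.sum_eq_zero fun p _ => ?_).symm
      rw [leftPart, if_neg (by omega)]
      rfl

theorem lam_rightPart {e : ℕ} (h : ¬ Covered C v) (g : ℕ) :
    lam (v + e) C (v + g) = lam e (rightPart v C) g := by
  rw [lam, lam, crossWord, crossWord, add_assoc, Finset.sum_range_add _ v (e + 2),
    Finset.sum_eq_zero fun p hp => ?_, zero_add]
  · refine Finset.sum_congr rfl fun p _ => ?_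
    simp only [rightPart, add_assoc, add_le_add_iff_left]
  · refine sum_map_ite_eq_zero _ _ _ fun t ht => ?_
    have := right_lt_of_not_covered h (Finset.mem_range.1 hp) ht
    omega

theorem earlyCount_leftPart (h : ¬ Covered C v) : earlyCount v (leftPart v C) = 0 := by
  refine Finset.sum_eq_zero fun p hp => sum_map_ite_eq_zero _ _ _ fun t ht => ?_
  have hp' := Finset.mem_range.1 hp
  rw [leftPart, if_pos hp'] at ht
  have := right_lt_of_not_covered h hp' ht
  omega

theorem earlyCount_rightPart {e : ℕ} (h : ¬ Covered C v) :
    earlyCount (v + e) C = earlyCount e (rightPart v C) := by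
  rw [earlyCount, earlyCount, Finset.sum_range_add, Finset.sum_eq_zero fun p hp => ?_, zero_add]
  · simp only [rightPart, add_assoc, add_right_inj]
  · refine sum_map_ite_eq_zero _ _ _ fun t ht => ?_
    have := right_lt_of_not_covered h (Finset.mem_range.1 hp) ht
    omega

theorem endCost_eq_add {e : ℕ} (h : ¬ Covered C v) :
    endCost (v + e) C = endCost v (leftPart v C) + endCost e (rightPart v C) := by
  rw [endCost, endCost, endCost, Finset.sum_range_add, earlyCount_leftPart h, earlyCount_rightPart h,
    add_zero, add_assoc]
  congr 1
  · refine Finset.sum_congr rfl fun g hg => ?_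
    rw [lam_leftPart h (Finset.mem_range.1 hg), leftPart, if_pos (Finset.mem_range.1 hg)]
  · congr 1
    refine Finset.sum_congr rfl fun g _ => ?_
    rw [lam_rightPart h, rightPart]

theorem wordWeight_eq_mul {e : ℕ} (h : ¬ Covered C v) :
    wordWeight (v + e + 1) C = wordWeight (v + 1) (leftPart v C) *
      wordWeight (e + 1) (rightPart v C) := by
  have h1 : wordWeight (v + 1) (leftPart v C) =
      ∏ g ∈ Finset.range v, ((C g).map fun t => (t.2.2 : ℕ) ^ 2).prod := by
    rw [wordWeight, Finset.prod_range_succ, leftPart, if_neg (lt_irrefl v), List.map_nil,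
      List.prod_nil, mul_one]
    refine Finset.prod_congr rfl fun g hg => ?_
    have hg' := Finset.mem_range.1 hg
    rw [leftPart, if_pos hg']
    congr 1
    refine List.map_congr_left fun t ht => if_pos ?_
    have := right_lt_of_not_covered h hg' ht
    omega
  rw [h1, wordWeight, add_assoc, Finset.prod_range_add]
  congr 1
  · refine Finset.prod_congr rfl fun g hg => ?_
    congr 1
    refine List.map_congr_left fun t ht => if_pos ?_
    have := right_lt_of_not_covered h (Finset.mem_range.1 hg) ht
    omega
  · refine Finset.prod_congr rfl fun g _ => ?_
    simp only [rightPart, add_assoc, add_lt_add_iff_left]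

/-- Tokens on one side of `v` do not cross gaps on the other. The right factor depends on the left
part only through the number of preceding gaps, which enters the gap factors as a shift. -/
theorem confVal_eq_mul {e : ℕ} (s : ℕ) (h : ¬ Covered C v) :
    confVal s (v + e) C = confVal s v (leftPart v C) * confVal (s + v) e (rightPart v C) := by
  rw [confVal, confVal, confVal, wordWeight_eq_mul h, Finset.prod_range_add, Nat.cast_mul,
    mul_mul_mul_comm]
  congr 2
  · refine Finset.prod_congr rfl fun g hg => ?_
    rw [lam_leftPart h (Finset.mem_range.1 hg), leftPart, if_pos (Finset.mem_range.1 hg)]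
  · refine Finset.prod_congr rfl fun g _ => ?_
    rw [lam_rightPart h, rightPart, add_assoc s v g]

end Uncovered

open Classical in
/-- The words contributing `k` to the cogenus in which tokens pass over all floors `1, …, q`. -/
noncomputable def blocks (e q k : ℕ) : Finset (ℕ → List Tok) :=
  (endConfs e k).filter fun C => ∀ u, 1 ≤ u → u ≤ q → Covered C u

open Classical in
/-- The sum over all words in which no token passes over the floor `n`. -/
noncomputable def closedSum (k n : ℕ) : ℚ :=
  ∑ C ∈ (endConfs n k).filter fun C => ¬ Covered C n, confVal 0 n C

theorem mem_blocks {e q k : ℕ} {C : ℕ → List Tok} : C ∈ blocks e q k ↔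
    (EndConf e C ∧ endCost e C = k) ∧ ∀ u, 1 ≤ u → u ≤ q → Covered C u := by
  simp only [blocks, Finset.mem_filter, mem_endConfs]

/-- Splitting the words at the last floor `v ≤ m` over which no token passes. -/
theorem sum_endConfs_eq_sum_blocks {e m : ℕ} (k : ℕ) (hm : m ≤ e) (H : ℕ → (ℕ → List Tok) → ℚ)
    (hH : ∀ v e', v + e' = e → v ≤ m → ∀ C, EndConf e C → ¬ Covered C v →
      H e C = H e' (rightPart v C)) :
    ∑ C ∈ endConfs e k, confVal 0 e C * H e C =
      ∑ v ∈ Finset.range (m + 1), ∑ j ∈ Finset.range (k + 1), closedSum (k - j) v *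
        ∑ C ∈ blocks (e - v) (m - v) j, confVal v (e - v) C * H (e - v) C := by
  classical
  have hlast : ∀ C, EndConf e C → ∀ v ≤ m, Nat.findGreatest (fun v => ¬ Covered C v) m = v ↔
      ¬ Covered C v ∧ ∀ u, v < u → u ≤ m → Covered C u := by
    intro C hC v hv
    rw [Nat.findGreatest_eq_iff]
    simp only [not_not]
    constructor
    · rintro ⟨-, h1, h2⟩
      refine ⟨?_, fun u hu hu' => h2 hu hu'⟩
      -- The default value `0` of `Nat.findGreatest` is a genuine solution, as no token passes over
      -- the floor `0`.
      by_cases h0 : v = 0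
      · rw [h0]
        exact hC.not_covered_zero
      · exact h1 h0
    · exact fun h => ⟨hv, fun _ => h.1, h.2⟩
  rw [← Finset.sum_fiberwise_of_maps_to (t := Finset.range (m + 1))
    (g := fun C => Nat.findGreatest (fun v => ¬ Covered C v) m) fun C _ =>
      Finset.mem_range.2 (Nat.lt_succ_of_le (Nat.findGreatest_le m))]
  refine Finset.sum_congr rfl fun v hv => ?_
  have hvm : v ≤ m := Nat.lt_succ_iff.1 (Finset.mem_range.1 hv)
  obtain ⟨e', rfl⟩ : ∃ e', e = v + e' := ⟨e - v, by omega⟩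
  rw [Nat.add_sub_cancel_left]
  have hmem : ∀ C, C ∈ (endConfs (v + e') k).filter (fun C =>
      Nat.findGreatest (fun v => ¬ Covered C v) m = v) ↔ (EndConf (v + e') C ∧ ¬ Covered C v) ∧
      endCost v (leftPart v C) + endCost e' (rightPart v C) = k ∧
      ∀ u, 1 ≤ u → u ≤ m - v → Covered (rightPart v C) u := by
    intro C
    rw [Finset.mem_filter, mem_endConfs]
    constructor
    · rintro ⟨⟨h1, h2⟩, h3⟩
      rw [hlast C h1 v hvm] at h3
      refine ⟨⟨h1, h3.1⟩, by rw [← endCost_eq_add h3.1, h2], fun u hu hu' => ?_⟩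
      exact (covered_rightPart h3.1 hu).2 (h3.2 _ (by omega) (by omega))
    · rintro ⟨⟨h1, h2⟩, h3, h4⟩
      refine ⟨⟨h1, by rw [endCost_eq_add h2, h3]⟩, (hlast C h1 v hvm).2 ⟨h2, fun u hu hu' => ?_⟩⟩
      obtain ⟨u, rfl⟩ : ∃ u', u = v + u' := ⟨u - v, by omega⟩
      exact (covered_rightPart h2 (by omega)).1 (h4 u (by omega) (by omega))
  rw [← Finset.sum_fiberwise_of_maps_to (t := Finset.range (k + 1))
    (g := fun C => endCost e' (rightPart v C)) fun C hC => by
      have := ((hmem C).1 hC).2.1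
      rw [Finset.mem_range]
      omega]
  refine Finset.sum_congr rfl fun j hj => ?_
  have hjk := Finset.mem_range.1 hj
  rw [closedSum, Finset.sum_mul_sum, ← Finset.sum_product']
  refine Finset.sum_nbij' (fun C => (leftPart v C, rightPart v C)) (fun P => glue v P.1 P.2)
    ?_ ?_ ?_ ?_ ?_
  · intro C hC
    rw [Finset.mem_filter, hmem] at hC
    obtain ⟨⟨⟨h1, h2⟩, h3, h4⟩, h5⟩ := hC
    rw [Finset.mem_product, Finset.mem_filter, mem_endConfs, mem_blocks]
    exact ⟨⟨⟨h1.leftPart h2, by simp only; omega⟩, not_covered_leftPart h2⟩,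
      ⟨h1.rightPart h2, h5⟩, h4⟩
  · rintro ⟨C₁, C₂⟩ hP
    rw [Finset.mem_product, Finset.mem_filter, mem_endConfs, mem_blocks] at hP
    obtain ⟨⟨⟨h1, h2⟩, h3⟩, ⟨h4, h5⟩, h6⟩ := hP
    simp only at h1 h2 h3 h4 h5 h6
    rw [Finset.mem_filter, hmem, rightPart_glue, leftPart_glue (h1.eq_nil_of_not_covered h3)]
    exact ⟨⟨⟨h1.glue h3 h4, not_covered_glue h3 h4⟩, show endCost v C₁ + endCost e' C₂ = k by omega, h6⟩, h5⟩
  · exact fun C _ => glue_leftPart_rightPart v C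
  · rintro ⟨C₁, C₂⟩ hP
    rw [Finset.mem_product, Finset.mem_filter, mem_endConfs] at hP
    obtain ⟨⟨⟨h1, h2⟩, h3⟩, -⟩ := hP
    simp only at h1 h2 h3
    simp only [rightPart_glue, leftPart_glue (h1.eq_nil_of_not_covered h3)]
  · intro C hC
    rw [Finset.mem_filter, hmem] at hC
    obtain ⟨⟨⟨h1, h2⟩, -⟩, -⟩ := hC
    simp only
    rw [confVal_eq_mul 0 h2, zero_add, hH v e' rfl hvm C h1 h2, mul_assoc]

/-! ### Eventually polynomial functions. -/

/-- A function which agrees with a polynomial from `N` on. -/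
def PolyFrom (N : ℕ) (f : ℕ → ℚ) : Prop := ∃ p : Polynomial ℚ, ∀ n, N ≤ n → f n = p.eval (n : ℚ)

namespace PolyFrom

variable {N : ℕ} {f g : ℕ → ℚ}

theorem congr (hf : PolyFrom N f) (h : ∀ n, N ≤ n → g n = f n) : PolyFrom N g := by
  obtain ⟨p, hp⟩ := hf
  exact ⟨p, fun n hn => (h n hn).trans (hp n hn)⟩

theorem const (N : ℕ) (c : ℚ) : PolyFrom N fun _ => c := ⟨Polynomial.C c, by simp⟩

theorem add (hf : PolyFrom N f) (hg : PolyFrom N g) : PolyFrom N fun n => f n + g n := by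
  obtain ⟨p, hp⟩ := hf
  obtain ⟨q, hq⟩ := hg
  exact ⟨p + q, fun n hn => by simp only [hp n hn, hq n hn, Polynomial.eval_add]⟩

theorem mul (hf : PolyFrom N f) (hg : PolyFrom N g) : PolyFrom N fun n => f n * g n := by
  obtain ⟨p, hp⟩ := hf
  obtain ⟨q, hq⟩ := hg
  exact ⟨p * q, fun n hn => by simp only [hp n hn, hq n hn, Polynomial.eval_mul]⟩

theorem sum {ι : Type*} {s : Finset ι} {F : ι → ℕ → ℚ} (h : ∀ i ∈ s, PolyFrom N (F i)) :
    PolyFrom N fun n => ∑ i ∈ s, F i n := by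
  classical
  induction s using Finset.induction_on with
  | empty => simpa using const N 0
  | insert i s hi ih =>
    refine ((h i (Finset.mem_insert_self i s)).add
      (ih fun j hj => h j (Finset.mem_insert_of_mem hj))).congr fun n _ => ?_
    rw [Finset.sum_insert hi]

theorem prod {ι : Type*} {s : Finset ι} {F : ι → ℕ → ℚ} (h : ∀ i ∈ s, PolyFrom N (F i)) :
    PolyFrom N fun n => ∏ i ∈ s, F i n := by
  classical
  induction s using Finset.induction_on with
  | empty => simpa using const N 1
  | insert i s hi ih =>
    refine ((h i (Finset.mem_insert_self i s)).mul
      (ih fun j hj => h j (Finset.mem_insert_of_mem hj))).congr fun n _ => ?_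
    rw [Finset.prod_insert hi]

theorem comp_sub {M l : ℕ} (hf : PolyFrom N f) (h : N + l ≤ M) : PolyFrom M fun n => f (n - l) := by
  obtain ⟨p, hp⟩ := hf
  refine ⟨p.comp (Polynomial.X - Polynomial.C (l : ℚ)), fun n hn => ?_⟩
  have h1 : ((n - l : ℕ) : ℚ) = n - l := Nat.cast_sub (by omega)
  simp only [hp (n - l) (by omega), h1, Polynomial.eval_comp, Polynomial.eval_sub, Polynomial.eval_X,
    Polynomial.eval_C]

/-- Bernoulli polynomials satisfy `B_{n+1}(x + 1) - B_{n+1}(x) = (n + 1) x ^ n`. -/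
theorem exists_polynomial_difference (p : Polynomial ℚ) :
    ∃ q : Polynomial ℚ, ∀ x, q.eval (x + 1) = q.eval x + p.eval x := by
  induction p using Polynomial.induction_on' with
  | add p p' h h' =>
    obtain ⟨q, hq⟩ := h
    obtain ⟨q', hq'⟩ := h'
    refine ⟨q + q', fun x => ?_⟩
    simp only [Polynomial.eval_add, hq, hq']
    ring
  | monomial n a =>
    refine ⟨Polynomial.C (a / (n + 1)) * Polynomial.bernoulli (n + 1), fun x => ?_⟩
    have h : (n + 1 : ℚ) ≠ 0 := by positivity
    rw [Polynomial.eval_mul, Polynomial.eval_mul, Polynomial.eval_C, Polynomial.eval_C, add_comm x 1,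
      Polynomial.bernoulli_eval_one_add, Polynomial.eval_monomial, Nat.add_sub_cancel]
    push_cast
    field_simp

theorem of_succ (hg : PolyFrom N g) (h : ∀ n, N ≤ n → f (n + 1) = f n + g n) : PolyFrom N f := by
  obtain ⟨p, hp⟩ := hg
  obtain ⟨q, hq⟩ := exists_polynomial_difference p
  refine ⟨q + Polynomial.C (f N - q.eval (N : ℚ)), fun n hn => ?_⟩
  induction n, hn using Nat.le_induction with
  | base => simp
  | succ n hn ih =>
    rw [h n hn, ih, hp n hn, Nat.cast_succ, Polynomial.eval_add, Polynomial.eval_add, hq]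
    simp only [Polynomial.eval_C]
    ring

end PolyFrom

/-! ### Thresholds for the polynomiality of a block. -/

/-- A binomial coefficient `y.choose r` equals its polynomial for every natural `y`, also for `y <
r`, where both vanish. So it suffices that `l ≤ x + r`, not `l ≤ x`; this gain of `r` makes the
thresholds sharp enough. -/
theorem polyFrom_gapFactor {N s g l r : ℕ} (hs : s ≤ N) (hr : r ≤ l) (h : l - r + s ≤ N + g + 1) :
    PolyFrom N fun n => (gapFactor (n - s + g + 1) l r : ℚ) := by
  refine ⟨Polynomial.C ((r ! : ℚ)⁻¹) * (descPochhammer ℚ r).comp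
    (Polynomial.X + Polynomial.C ((g + 1 + r : ℚ) - (l + s))), fun n hn => ?_⟩
  have h1 : gapFactor (n - s + g + 1) l r = (n - s + g + 1 + r - l).choose r :=
    if_pos (by omega)
  simp only [h1]
  rw [Nat.cast_choose_eq_descPochhammer_div, Polynomial.eval_mul,
    Polynomial.eval_comp, Polynomial.eval_C, div_eq_inv_mul]
  congr 2
  rw [Nat.cast_sub (by omega)]
  push_cast
  rw [Nat.cast_sub (by omega)]
  simp only [Polynomial.eval_add, Polynomial.eval_X, Polynomial.eval_C]
  ring

/-- A lower bound for the cost `j` of a block through the number `l` of its covered floors. -/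
def BlockBound (τ e l j : ℕ) (C : ℕ → List Tok) : Prop :=
  l + τ ≤ j ∧ ∀ g < e, lam e C g - (C g).length + l + τ ≤ j + g + 1

theorem lam_add_costFrom_le {e : ℕ} {C : ℕ → List Tok} {g : ℕ} (hg : g < e) :
    lam e C g - (C g).length + costFrom e C (g + 1) ≤ endCost e C := by
  rw [endCost_eq_costFrom, costFrom, costFrom, ← add_assoc]
  refine Nat.add_le_add_right ?_ _
  rw [← Finset.sum_eq_sum_Ico_succ_bot hg fun g => lam e C g - (C g).length]
  exact Finset.sum_le_sum_of_subset (Finset.Ico_subset_Ico_left (Nat.zero_le g))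

/-- The covered floors after `x` cost at least `l - x` in the gaps from `x` on. With `x = g + 1`
this leaves at most `j - (l - g - 1)` for the gap `g` alone. -/
theorem blockBound_zero {e l j : ℕ} {C : ℕ → List Tok} (hC : C ∈ blocks e l j) (hl : l ≤ e) :
    BlockBound 0 e l j C := by
  obtain ⟨⟨h1, rfl⟩, h2⟩ := mem_blocks.1 hC
  have key : ∀ x, l - x ≤ costFrom e C x := by
    intro x
    have := covered_le_costFrom h1 x (Finset.Ico (x + 1) (l + 1)) fun v hv => by
      have := Finset.mem_Ico.1 hv
      exact ⟨by omega, by omega, h2 v (by omega) (by omega)⟩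
    rw [Nat.card_Ico] at this
    omega
  refine ⟨?_, fun g hg => ?_⟩
  · have := key 0
    rw [← endCost_eq_costFrom] at this
    omega
  · have := key (g + 1)
    have := lam_add_costFrom_le (C := C) hg
    omega

/-- Some token of weight at least `2` ends immediately before the floor `e`. -/
def HeavyEnd (e : ℕ) (C : ℕ → List Tok) : Prop :=
  ∃ p, ∃ t ∈ C p, p + t.2.1 + 1 = e ∧ 2 ≤ (t.2.2 : ℕ)

theorem blockBound_one {l j : ℕ} {C : ℕ → List Tok} (hC : C ∈ blocks (l + 1) l j)
    (hh : HeavyEnd (l + 1) C) : BlockBound 1 (l + 1) l j C := by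
  obtain ⟨⟨h1, rfl⟩, h2⟩ := mem_blocks.1 hC
  have key : ∀ x ≤ l, l - x + 1 ≤ costFrom (l + 1) C x := by
    intro x hx
    have := covered_lt_costFrom h1 (Nat.lt_succ_of_le hx) (Finset.Ico (x + 1) (l + 1)) (fun v hv => by
      have := Finset.mem_Ico.1 hv
      exact ⟨by omega, by omega, h2 v (by omega) (by omega)⟩) hh
    rw [Nat.card_Ico] at this
    omega
  refine ⟨?_, fun g hg => ?_⟩
  · have := key 0 (Nat.zero_le l)
    rw [← endCost_eq_costFrom] at this
    omega
  · have h3 := lam_add_costFrom_le (C := C) hg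
    rcases Nat.lt_succ_iff_lt_or_eq.1 hg with h4 | rfl
    · have := key (g + 1) h4
      omega
    · omega

/-- The left part is polynomial once `n - l ≥ k - j`, and the gap `g` of the block once `n - l + g +
1` is at least `lam` minus the number of tokens. `BlockBound` says that `n ≥ k - τ` suffices for
both. -/
theorem polyFrom_block {τ e l j k : ℕ} {C : ℕ → List Tok} (hb : BlockBound τ e l j C) (hj : j ≤ k)
    (hA : PolyFrom (k - j) (closedSum (k - j))) :
    PolyFrom (k - τ) fun n => closedSum (k - j) (n - l) * confVal (n - l) e C := by
  obtain ⟨h1, h2⟩ := hb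
  refine (hA.comp_sub (by omega)).mul ?_
  unfold confVal
  refine (PolyFrom.const _ _).mul (PolyFrom.prod fun g hg => ?_)
  have hg' := Finset.mem_range.1 hg
  refine polyFrom_gapFactor (by omega) (length_le_lam (by omega)) ?_
  have := h2 g hg'
  omega

/-- Splitting off the last block, whose size is bounded independently of `m`. -/
theorem sum_endConfs_eq_sum_range {τ s k m : ℕ} (hm : k ≤ m + τ) (H : ℕ → (ℕ → List Tok) → ℚ)
    (hH : ∀ v e', v + e' = m + s → v ≤ m → ∀ C, EndConf (m + s) C → ¬ Covered C v →
      H (m + s) C = H e' (rightPart v C))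
    (hb : ∀ l j, ∀ C ∈ blocks (l + s) l j, H (l + s) C ≠ 0 → BlockBound τ (l + s) l j C) :
    ∑ C ∈ endConfs (m + s) k, confVal 0 (m + s) C * H (m + s) C =
      ∑ l ∈ Finset.range (k + 1), ∑ j ∈ Finset.range (k + 1), ∑ C ∈ blocks (l + s) l j,
        closedSum (k - j) (m - l) * confVal (m - l) (l + s) C * H (l + s) C := by
  -- A contributing block with `l` covered floors costs at least `l + τ`, and at most `k` is
  -- available.
  have hz : ∀ l, k < l + τ → ∀ j ∈ Finset.range (k + 1), ∀ C ∈ blocks (l + s) l j,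
      H (l + s) C = 0 := by
    intro l hl j hj C hC
    by_contra hne
    have h1 := (hb l j C hC hne).1
    have h2 := Finset.mem_range.1 hj
    omega
  let T : ℕ → ℚ := fun l => ∑ j ∈ Finset.range (k + 1), ∑ C ∈ blocks (l + s) l j,
    closedSum (k - j) (m - l) * confVal (m - l) (l + s) C * H (l + s) C
  have hT : ∀ l, k < l + τ → T l = 0 := fun l hl => Finset.sum_eq_zero fun j hj =>
    Finset.sum_eq_zero fun C hC => by rw [hz l hl j hj C hC, mul_zero]
  rw [sum_endConfs_eq_sum_blocks k (Nat.le_add_right m s) H hH,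
    ← Finset.sum_range_reflect _ (m + 1)]
  trans ∑ l ∈ Finset.range (m + 1), T l
  · refine Finset.sum_congr rfl fun l hl => Finset.sum_congr rfl fun j _ => ?_
    have hl' := Finset.mem_range.1 hl
    rw [Nat.add_sub_cancel, show m + s - (m - l) = l + s by omega, show m - (m - l) = l by omega,
      Finset.mul_sum]
    simp only [mul_assoc]
  -- If `m < k`, the terms with `m < l ≤ k` were not in the original sum; they vanish because `k ≤ m
  -- + τ < l + τ`.
  · rw [← Finset.sum_subset (s₁ := Finset.range (min (m + 1) (k + 1))) (s₂ := Finset.range (m + 1)),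
      ← Finset.sum_subset (s₁ := Finset.range (min (m + 1) (k + 1))) (s₂ := Finset.range (k + 1))]
    · exact Finset.range_subset_range.2 (min_le_right _ _)
    · intro l h1 h2
      rw [Finset.mem_range] at h1 h2
      exact hT l (by omega)
    · exact Finset.range_subset_range.2 (min_le_left _ _)
    · intro l h1 h2
      rw [Finset.mem_range] at h1 h2
      exact hT l (by omega)

/-! ### Polynomiality of the sums over closed configurations. -/

open Classical in
theorem closedSum_eq_sum (k n : ℕ) : closedSum k n =
    ∑ C ∈ endConfs n k, confVal 0 n C * if Covered C n then 0 else 1 := by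
  rw [closedSum, Finset.sum_filter]
  refine Finset.sum_congr rfl fun C _ => ?_
  split_ifs <;> simp

theorem mem_blocks_zero {e l : ℕ} {C : ℕ → List Tok} :
    C ∈ blocks e l 0 ↔ l = 0 ∧ C = fun _ => [] := by
  rw [mem_blocks]
  constructor
  · rintro ⟨⟨h1, h2⟩, h3⟩
    have hC := h1.eq_nil_of_endCost_eq_zero h2
    refine ⟨?_, hC⟩
    by_contra hl
    obtain ⟨p, t, ht, -⟩ := h3 1 le_rfl (by omega)
    rw [hC] at ht
    simp at ht
  · rintro ⟨rfl, rfl⟩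
    refine ⟨⟨⟨?_, ?_, List.Pairwise.nil⟩, ?_⟩, fun u hu hu' => by omega⟩
    · intro g t ht
      simp at ht
    · intro g t ht
      simp at ht
    · simp [endCost, lam, crossWord, earlyCount]

open Classical in
/-- The sum over all closed words with a heavy token before the last floor. -/
noncomputable def heavySum (k n : ℕ) : ℚ :=
  ∑ C ∈ endConfs n k, confVal 0 n C * if ¬ Covered C n ∧ HeavyEnd n C then 1 else 0

theorem heavyEnd_rightPart {e v : ℕ} {C : ℕ → List Tok} (h : ¬ Covered C v) (he : 1 ≤ e) :
    HeavyEnd e (rightPart v C) ↔ HeavyEnd (v + e) C := by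
  constructor
  · rintro ⟨p, t, ht, h1, h2⟩
    exact ⟨v + p, t, ht, by omega, h2⟩
  · rintro ⟨p, t, ht, h1, h2⟩
    by_cases hp : p < v
    · have := right_lt_of_not_covered h hp ht
      omega
    · refine ⟨p - v, t, ?_, by omega, h2⟩
      rwa [rightPart, Nat.add_sub_cancel' (not_lt.1 hp)]

theorem sum_range_sum_range_eq_add (k : ℕ) (T : ℕ → ℕ → ℚ) (h : ∀ l, l ≠ 0 → T l 0 = 0) :
    ∑ l ∈ Finset.range (k + 1), ∑ j ∈ Finset.range (k + 1), T l j =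
      T 0 0 + ∑ l ∈ Finset.range (k + 1), ∑ j ∈ Finset.range k, T l (j + 1) := by
  rw [Finset.sum_congr rfl fun l _ => Finset.sum_range_succ' (T l) k, Finset.sum_add_distrib,
    Finset.sum_range_succ' (fun l => T l 0), Finset.sum_eq_zero fun l _ => h _ l.succ_ne_zero,
    zero_add, add_comm]

/-- Split a closed configuration of size `n + 1` at its last uncovered floor `v ≤ n`. The empty
block contributes `closedSum k n`; all other blocks have cost `j ≥ 1` and bring in `closedSum (k -
j)`, known by induction. So the first difference is polynomial from `k` on, and summation keeps this
threshold. -/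
theorem polyFrom_closedSum (k : ℕ) : PolyFrom k (closedSum k) := by
  classical
  induction k using Nat.strong_induction_on with
  | _ k ih =>
    let H : ℕ → (ℕ → List Tok) → ℚ := fun e C => if Covered C e then 0 else 1
    have hpoly : PolyFrom k fun n => ∑ l ∈ Finset.range (k + 1), ∑ j ∈ Finset.range k,
        ∑ C ∈ blocks (l + 1) l (j + 1),
          closedSum (k - (j + 1)) (n - l) * confVal (n - l) (l + 1) C * H (l + 1) C := by
      refine PolyFrom.sum fun l _ => PolyFrom.sum fun j hj => PolyFrom.sum fun C hC => ?_
      have hj' := Finset.mem_range.1 hj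
      exact (polyFrom_block (blockBound_zero hC (Nat.le_succ l)) hj' (ih _ (by omega))).mul
        (PolyFrom.const _ _)
    refine hpoly.of_succ fun n hn => ?_
    rw [closedSum_eq_sum, sum_endConfs_eq_sum_range (τ := 0) (s := 1) hn H]
    · rw [sum_range_sum_range_eq_add k fun l j => ∑ C ∈ blocks (l + 1) l j,
        closedSum (k - j) (n - l) * confVal (n - l) (l + 1) C * H (l + 1) C]
      · congr 1
        have h0 : blocks (0 + 1) 0 0 = {fun _ => []} := by
          ext C
          rw [mem_blocks_zero, Finset.mem_singleton, and_iff_right rfl]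
        have h1 : ¬ Covered (fun _ => []) (0 + 1) := by
          rintro ⟨p, t, ht, -⟩
          simp at ht
        have h2 : confVal (n - 0) (0 + 1) (fun _ => []) = 1 := by
          simp [confVal, wordWeight, gapFactor, lam, crossWord]
        simp only [h0, Finset.sum_singleton, H, if_neg h1, h2, mul_one]
        rfl
      · intro l hl
        refine Finset.sum_eq_zero fun C hC => ?_
        exact absurd (mem_blocks_zero.1 hC).1 hl
    · intro v e' hve hv C _ h
      simp only [H]
      rw [← hve, covered_rightPart h (by omega)]
    · exact fun l j C hC _ => blockBound_zero hC (Nat.le_succ l)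

/-- A heavy edge into the last floor makes the last block nonempty and gains one unit in the bounds.
Hence no summation is needed, and in terms of `n = m + 1` the threshold is again `k`. -/
theorem polyFrom_heavySum (k : ℕ) (hk : 1 ≤ k) : PolyFrom (k - 1) fun m => heavySum k (m + 1) := by
  classical
  let H : ℕ → (ℕ → List Tok) → ℚ := fun e C => if ¬ Covered C e ∧ HeavyEnd e C then 1 else 0
  have hpoly : PolyFrom (k - 1) fun n => ∑ l ∈ Finset.range (k + 1), ∑ j ∈ Finset.range (k + 1),
      ∑ C ∈ blocks (l + 1) l j,
        closedSum (k - j) (n - l) * confVal (n - l) (l + 1) C * H (l + 1) C := by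
    refine PolyFrom.sum fun l _ => PolyFrom.sum fun j hj => PolyFrom.sum fun C hC => ?_
    have hj' := Finset.mem_range.1 hj
    by_cases hh : ¬ Covered C (l + 1) ∧ HeavyEnd (l + 1) C
    · exact (polyFrom_block (blockBound_one hC hh.2) (by omega) (polyFrom_closedSum _)).mul
        (PolyFrom.const _ _)
    · refine (PolyFrom.const _ 0).congr fun n _ => ?_
      simp only [H]
      rw [if_neg hh, mul_zero]
  refine hpoly.congr fun m hm => ?_
  rw [heavySum, sum_endConfs_eq_sum_range (τ := 1) (s := 1) (by omega) H]
  · intro v e' hve hv C _ h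
    simp only [H]
    rw [← hve, covered_rightPart h (by omega), heavyEnd_rightPart h (by omega)]
  · intro l j C hC hne
    refine blockBound_one hC ?_
    by_contra hh
    exact hne (if_neg fun h => hh h.2)

/-! ### The full sum for `d ≥ δ + 1`. -/

/-- All nontrivial ends lie after an uncovered floor, so the dependence on `α` and `β` sits entirely
in the last block. -/
theorem endFactor_rightPart {e v : ℕ} {C : ℕ → List Tok} (h : ¬ Covered C v) (δ : ℕ)
    (U : Finset ℕ+) (α β : TangencySeq) :
    endFactor δ U α β (v + e) C = endFactor δ U α β e (rightPart v C) := by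
  have h1 : ∀ w, earlyEnds (v + e) C w = earlyEnds e (rightPart v C) w := by
    intro w
    rw [earlyEnds, earlyEnds, Finset.sum_range_add _ v e, Finset.sum_eq_zero fun p hp => ?_, zero_add]
    · simp only [rightPart, add_assoc, add_right_inj]
    · refine sum_map_ite_eq_zero _ _ _ fun t ht => ?_
      have := right_lt_of_not_covered h (Finset.mem_range.1 hp) ht
      omega
  simp only [endFactor, usedBeta, usedAlpha, earlyCount_rightPart h, h1]
  rfl

theorem sum_endConfs_endFactor {δ e : ℕ} (he : δ ≤ e) (U : Finset ℕ+) (α β : TangencySeq) :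
    ∑ C ∈ endConfs e δ, confVal 0 e C * endFactor δ U α β e C =
      ∑ l ∈ Finset.range (δ + 1), ∑ j ∈ Finset.range (δ + 1), ∑ C ∈ blocks l l j,
        closedSum (δ - j) (e - l) * confVal (e - l) l C * endFactor δ U α β l C := by
  refine sum_endConfs_eq_sum_range (τ := 0) (s := 0) he (endFactor δ U α β) ?_ ?_
  · intro v e' hve _ C _ h
    rw [← hve, endFactor_rightPart h]
  · exact fun l j C hC _ => blockBound_zero hC le_rfl

/-! ### The boundary case `d = δ`: ends led to an additional floor. -/

/-- There are no `α`-vertices, and all tokens reaching the last floor `e` have weight `1`. -/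
def LightEnds (e : ℕ) (C : ℕ → List Tok) : Prop :=
  C (e + 1) = [] ∧ ∀ p, ∀ t ∈ C p, p + t.2.1 = e → t.2.2 = 1

/-- Let all `β`-edges end at a new floor `e + 1`. The ends become midpoints, those of weight one
attached to the floor `e` and lying after it become trivial in the new sense, and nothing passes
over the new floor. -/
theorem endConf_and_lightEnds_iff {e : ℕ} {C : ℕ → List Tok} :
    EndConf e C ∧ LightEnds e C ↔
      EndConf (e + 1) C ∧ ¬ Covered C (e + 1) ∧ ¬ HeavyEnd (e + 1) C := by
  constructor
  · rintro ⟨h, h1, h2⟩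
    have hlt : ∀ g, ∀ t ∈ C g, g < e + 1 := by
      intro g t ht
      have := h.fits g t ht
      rcases lt_trichotomy g (e + 1) with h3 | rfl | h3
      · exact h3
      · rw [h1] at ht
        simp at ht
      · omega
    refine ⟨⟨fun g t ht => ?_, fun g t ht => ?_, ?_⟩, ?_, ?_⟩
    · have := h.fits g t ht
      have := hlt g t ht
      omega
    · have h3 := hlt g t ht
      have h4 := h.nontriv g t ht
      rw [← Bool.not_eq_false] at h4 ⊢
      rw [nontriv_eq_false_lt h3]
      rintro rfl
      rcases Nat.lt_succ_iff_lt_or_eq.1 h3 with h5 | rfl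
      · exact h4 ((nontriv_eq_false_lt h5).2 rfl)
      · exact h4 (nontriv_eq_false_eq.2 rfl)
    · rw [h.eq_nil (by omega)]
      exact List.Pairwise.nil
    · rintro ⟨p, t, ht, h3, h4⟩
      have := h.fits p t ht
      have := hlt p t ht
      omega
    · rintro ⟨p, t, ht, h3, h4⟩
      have := h2 p t ht (by omega)
      rw [this] at h4
      exact absurd h4 (by decide)
  · rintro ⟨h, h1, h2⟩
    have hnil := h.eq_nil_of_not_covered h1
    have hlight : ∀ p, ∀ t ∈ C p, p + t.2.1 = e → t.2.2 = 1 := by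
      intro p t ht h3
      by_contra h4
      refine h2 ⟨p, t, ht, by omega, ?_⟩
      have h5 := t.2.2.pos
      have h6 : (t.2.2 : ℕ) ≠ 1 := fun h => h4 (PNat.eq h)
      omega
    have hlt : ∀ g, ∀ t ∈ C g, g < e + 1 := by
      intro g t ht
      by_contra h3
      rw [hnil g (not_lt.1 h3)] at ht
      simp at ht
    refine ⟨⟨fun g t ht => ?_, fun g t ht => ?_, ?_⟩, hnil _ le_rfl, hlight⟩
    · have h3 := h.fits g t ht
      have h4 := right_lt_of_not_covered h1 (hlt g t ht) ht
      have := hlt g t ht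
      omega
    · have h3 := hlt g t ht
      have h4 := h.nontriv g t ht
      have h5 := right_lt_of_not_covered h1 h3 ht
      rw [← Bool.not_eq_false, nontriv_eq_false_lt h3] at h4
      rw [← Bool.not_eq_false]
      rcases Nat.lt_succ_iff_lt_or_eq.1 h3 with h6 | rfl
      · rwa [nontriv_eq_false_lt h6]
      · rw [nontriv_eq_false_eq]
        intro h6
        have h7 : t.2.1 = 0 := by omega
        exact h4 (Prod.ext h6 (Prod.ext h7 (hlight g t ht (by omega))))
    · rw [hnil _ le_rfl]
      exact List.Pairwise.nil

section Light

variable {e : ℕ} {C : ℕ → List Tok}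

theorem lam_succ (h : EndConf e C) (g : ℕ) : lam (e + 1) C g = lam e C g := by
  rw [lam, lam, crossWord, crossWord, Finset.sum_range_succ _ (e + 2), h.eq_nil le_rfl, List.map_nil,
    List.sum_nil, add_zero]

theorem lam_eq_earlyCount_add (h : EndConf e C) (hl : LightEnds e C) :
    lam e C e = earlyCount e C + (C e).length := by
  rw [lam, crossWord, Finset.sum_range_succ, Finset.sum_range_succ, hl.1, List.map_nil,
    List.sum_nil, add_zero, earlyCount]
  congr 1
  · refine Finset.sum_congr rfl fun g hg => ?_
    congr 1
    refine List.map_congr_left fun t ht => ?_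
    have h1 := h.fits.lt_bound (Finset.mem_range.1 hg).le ht
    have := Finset.mem_range.1 hg
    by_cases h2 : g + t.2.1 = e
    · rw [if_pos ⟨by omega, by omega⟩, if_pos h2, hl.2 g t ht h2]
      rfl
    · rw [if_neg (by omega), if_neg h2]
  · have : ((C e).map fun t => if e ≤ e + t.1 ∧ e ≤ e + t.2.1 then (t.2.2 : ℕ) else 0) =
        (C e).map fun _ => 1 := by
      refine List.map_congr_left fun t ht => ?_
      have h1 := h.fits.lt_bound le_rfl ht
      rw [if_pos ⟨by omega, by omega⟩, hl.2 e t ht (by omega)]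
      rfl
    rw [this]
    simp

theorem earlyCount_succ (h : EndConf e C) : earlyCount (e + 1) C = 0 := by
  refine Finset.sum_eq_zero fun g hg => sum_map_ite_eq_zero _ _ _ fun t ht => ?_
  have := h.fits.lt_bound (Nat.lt_succ_iff.1 (Finset.mem_range.1 hg)) ht
  omega

/-- The gap `e`, now counted, contributes `lam` minus the number of its tokens, which is
`earlyCount`; this replaces the former summand `earlyCount`, as early ends no longer exist. -/
theorem endCost_succ (h : EndConf e C) (hl : LightEnds e C) : endCost (e + 1) C = endCost e C := by
  rw [endCost, endCost, earlyCount_succ h, Finset.sum_range_succ, lam_succ h,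
    lam_eq_earlyCount_add h hl, Nat.add_sub_cancel, add_zero]
  congr 1
  exact Finset.sum_congr rfl fun g _ => by rw [lam_succ h]

theorem confVal_succ (h : EndConf e C) (hl : LightEnds e C) :
    confVal 0 (e + 1) C =
      confVal 0 e C * gapFactor (e + 1) (earlyCount e C + (C e).length) (C e).length := by
  have h1 : wordWeight (e + 1 + 1) C = wordWeight (e + 1) C := by
    rw [wordWeight, Finset.prod_range_succ, hl.1, List.map_nil, List.prod_nil, mul_one, wordWeight]
    refine Finset.prod_congr rfl fun g hg => ?_
    congr 1
    refine List.map_congr_left fun t ht => ?_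
    have h1 := h.fits.lt_bound (Nat.lt_succ_iff.1 (Finset.mem_range.1 hg)) ht
    rw [if_pos (by omega)]
    by_cases h2 : g + t.2.1 = e
    · rw [if_neg (by omega), hl.2 g t ht h2]
      rfl
    · rw [if_pos (by omega)]
  rw [confVal, confVal, h1, Finset.prod_range_succ, lam_succ h, lam_eq_earlyCount_add h hl, zero_add,
    mul_assoc]
  congr 2
  exact Finset.prod_congr rfl fun g _ => by rw [lam_succ h]

theorem size_single (w : ℕ+) (n : ℕ) : TangencySeq.size (Finsupp.single w n) = n := by
  simp [TangencySeq.size]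

/-- Write `d = e + 1`, `b` for the number of early ends and `r` for the number of nontrivial tokens
in the gap `e`. Both sides equal the product of the falling factorials `(d)_b`, `(d - b)_{k - b}`
and `(d - b)_r`, divided by `r!`. -/
theorem endFactor_of_lightEnds {k : ℕ} (h : EndConf e C) (hl : LightEnds e C) (hk : endCost e C = k)
    (hke : k ≤ e + 1) {U : Finset ℕ+} (hU : 1 ∈ U) :
    endFactor k U 0 (Finsupp.single 1 (e + 1)) e C =
      (e + 1).descFactorial k *
        gapFactor (e + 1) (earlyCount e C + (C e).length) (C e).length := by
  have hb : earlyCount e C ≤ k := by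
    rw [← hk, endCost]
    omega
  have hw1 : ∀ t ∈ C e, t.2.2 = 1 := fun t ht => by
    have := h.fits.lt_bound le_rfl ht
    exact hl.2 e t ht (by omega)
  have hw2 : ∀ g < e, ∀ t ∈ C g, g + t.2.1 = e → t.2.2 = 1 := fun g _ t ht h => hl.2 g t ht h
  have h1 : usedBeta e C 1 = earlyCount e C + (C e).length := by
    have h2 := sum_earlyEnds e C {1} (by simpa using hw2)
    have h3 := sum_weightCount (fun t : Tok => t.2.2) {1} (C e) (by simpa using hw1)
    rw [Finset.sum_singleton] at h2 h3
    rw [usedBeta, h2, h3]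
  have h2 : ∀ w, usedAlpha e C w = 0 := by
    intro w
    rw [usedAlpha, hl.1]
    rfl
  have h3 : ∀ w ∈ U, w ≠ 1 → (((Finsupp.single 1 (e + 1) : TangencySeq) w).descFactorial
      (usedBeta e C w) : ℚ) = 1 := by
    intro w _ hw
    rw [usedBeta_eq_zero {1} (by simpa using hw1) (by simpa using hw2) (by simpa using hw)]
    simp
  rw [endFactor, size_single, Finset.prod_eq_single_of_mem 1 hU h3, h1,
    Finset.prod_eq_one fun w _ => by rw [h2, Nat.choose_zero_right, Nat.cast_one], mul_one,
    Finsupp.single_eq_same]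
  generalize earlyCount e C = b at *
  generalize (C e).length = r
  generalize e + 1 = d at *
  have hmul : ∀ x, d.descFactorial (b + x) = d.descFactorial b * (d - b).descFactorial x := by
    intro x
    rw [← Nat.descFactorial_mul_descFactorial (Nat.le_add_right b x), Nat.add_sub_cancel_left,
      mul_comm]
  have h4 : gapFactor d (b + r) r = (d - b).choose r := by
    rw [gapFactor, if_pos (by omega)]
    congr 1
    omega
  rw [h4, show d.descFactorial k = d.descFactorial (b + (k - b)) by congr 1; omega, hmul, hmul,
    Nat.descFactorial_eq_factorial_mul_choose (d - b) r]
  have : (r ! : ℚ) ≠ 0 := Nat.cast_ne_zero.2 (Nat.factorial_ne_zero _)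
  push_cast
  field_simp

theorem endFactor_of_not_lightEnds {k : ℕ} (h : EndConf e C) (hl : ¬ LightEnds e C)
    (hk : endCost e C = k) {U : Finset ℕ+} (hU : ∀ w : ℕ+, (w : ℕ) ≤ k → w ∈ U) :
    endFactor k U 0 (Finsupp.single 1 (e + 1)) e C = 0 := by
  by_cases h1 : C (e + 1) = []
  · have h2 : ∃ p, ∃ t ∈ C p, p + t.2.1 = e ∧ t.2.2 ≠ 1 := by
      by_contra hc
      push Not at hc
      exact hl ⟨h1, hc⟩
    obtain ⟨p, t, ht, h3, h4⟩ := h2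
    have h5 : usedBeta e C t.2.2 ≠ 0 := by
      intro h0
      rw [usedBeta, Nat.add_eq_zero_iff, weightCount_eq_zero] at h0
      rcases Nat.lt_or_ge p e with hp | hp
      · have h6 := h0.1
        rw [earlyEnds, Finset.sum_eq_zero_iff] at h6
        have h7 := List.sum_eq_zero_iff.1 (h6 p (Finset.mem_range.2 hp)) _ (List.mem_map_of_mem ht)
        simp [h3] at h7
      · obtain rfl : p = e := by omega
        exact h0.2 t ht rfl
    have h6 : (((Finsupp.single 1 (e + 1) : TangencySeq) t.2.2).descFactorial
        (usedBeta e C t.2.2) : ℚ) = 0 := by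
      rw [Finsupp.single_eq_of_ne h4, Nat.cast_eq_zero, Nat.descFactorial_eq_zero_iff_lt]
      omega
    rw [endFactor, Finset.prod_eq_zero (hU _ (hk ▸ weight_le_endCost h ht h3.ge)) h6, zero_mul,
      mul_zero]
  · obtain ⟨t, ht⟩ := List.exists_mem_of_ne_nil _ h1
    have h5 : usedAlpha e C t.2.2 ≠ 0 := fun h0 => weightCount_eq_zero.1 h0 t ht rfl
    have h6 : (((0 : TangencySeq) t.2.2).choose (usedAlpha e C t.2.2) : ℚ) = 0 := by
      rw [Finsupp.zero_apply, Nat.cast_eq_zero, Nat.choose_eq_zero_iff]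
      omega
    rw [endFactor, Finset.prod_eq_zero (f := fun w => (((0 : TangencySeq) w).choose
      (usedAlpha e C w) : ℚ)) (hU _ (hk ▸ weight_le_endCost h ht (by omega))) h6, mul_zero, mul_zero]

end Light

/-- Configurations using an `α`-vertex or a `β`-vertex of weight at least two have end factor zero.
The others correspond, through the additional floor, to closed configurations of size `e + 1`
without a heavy end, whose last gap factor is exactly what remains of the end factor. -/
theorem sum_endConfs_endFactor_single {k e : ℕ} (hk : 1 ≤ k) (hke : k ≤ e + 1) (U : Finset ℕ+)
    (hU : ∀ w : ℕ+, (w : ℕ) ≤ k → w ∈ U) :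
    ∑ C ∈ endConfs e k, confVal 0 e C * endFactor k U 0 (Finsupp.single 1 (e + 1)) e C =
      (e + 1).descFactorial k * (closedSum k (e + 1) - heavySum k (e + 1)) := by
  classical
  have h1 : closedSum k (e + 1) - heavySum k (e + 1) =
      ∑ C ∈ (endConfs (e + 1) k).filter fun C => ¬ Covered C (e + 1) ∧ ¬ HeavyEnd (e + 1) C,
        confVal 0 (e + 1) C := by
    rw [closedSum_eq_sum, heavySum, ← Finset.sum_sub_distrib, Finset.sum_filter]
    refine Finset.sum_congr rfl fun C _ => ?_
    by_cases h2 : Covered C (e + 1) <;> by_cases h3 : HeavyEnd (e + 1) C <;> simp [h2, h3]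
  have h2 : (endConfs (e + 1) k).filter (fun C => ¬ Covered C (e + 1) ∧ ¬ HeavyEnd (e + 1) C) =
      (endConfs e k).filter (LightEnds e) := by
    ext C
    simp only [Finset.mem_filter, mem_endConfs]
    constructor
    · rintro ⟨⟨h3, h4⟩, h5⟩
      obtain ⟨h6, h7⟩ := endConf_and_lightEnds_iff.2 ⟨h3, h5⟩
      exact ⟨⟨h6, by rw [← endCost_succ h6 h7, h4]⟩, h7⟩
    · rintro ⟨⟨h3, h4⟩, h5⟩
      obtain ⟨h6, h7⟩ := endConf_and_lightEnds_iff.1 ⟨h3, h5⟩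
      exact ⟨⟨h6, by rw [endCost_succ h3 h5, h4]⟩, h7⟩
  rw [h1, h2, Finset.sum_filter, Finset.mul_sum]
  refine Finset.sum_congr rfl fun C hC => ?_
  obtain ⟨h3, h4⟩ := mem_endConfs.1 hC
  split_ifs with h5
  · rw [endFactor_of_lightEnds h3 h5 h4 hke (hU 1 hk), confVal_succ h3 h5]
    ring
  · rw [endFactor_of_not_lightEnds h3 h5 h4 hU, mul_zero, mul_zero]

/-! ### Assembling the polynomial. -/

theorem MvPolynomial.eval_polynomial_aeval {σ : Type*} (f : σ → ℚ) (x : MvPolynomial σ ℚ)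
    (p : Polynomial ℚ) :
    MvPolynomial.eval f (Polynomial.aeval x p) = p.eval (MvPolynomial.eval f x) := by
  induction p using Polynomial.induction_on' with
  | add p q hp hq => rw [map_add, map_add, hp, hq, Polynomial.eval_add]
  | monomial n a =>
    rw [Polynomial.aeval_monomial, Polynomial.eval_monomial, map_mul, map_pow,
      MvPolynomial.algebraMap_eq, MvPolynomial.eval_C]

/-- The values of `d`, `|β|`, `α₁, …, α_δ`, `β₁, …, β_δ`. -/
def nodeVal (δ : ℕ) (α β : TangencySeq) : NodeVar δ → ℚ
  | .degree => (α.weight + β.weight : ℕ)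
  | .size => β.size
  | .alpha i => α (Nat.succPNat i)
  | .beta i => β (Nat.succPNat i)

/-- The positive integers up to `δ`. -/
def smallWeights (δ : ℕ) : Finset ℕ+ :=
  Finset.univ.map ⟨fun i : Fin δ => Nat.succPNat i, fun _ _ h => Fin.ext (Nat.succPNat_injective h)⟩

theorem mem_smallWeights {δ : ℕ} {w : ℕ+} (h : (w : ℕ) ≤ δ) : w ∈ smallWeights δ := by
  have := w.pos
  refine Finset.mem_map.2 ⟨⟨w - 1, by omega⟩, Finset.mem_univ _, PNat.eq ?_⟩
  change (w : ℕ) - 1 + 1 = w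
  omega

theorem prod_smallWeights {δ : ℕ} (f : ℕ+ → ℚ) :
    ∏ w ∈ smallWeights δ, f w = ∏ i : Fin δ, f (Nat.succPNat i) :=
  Finset.prod_map _ _ _

theorem exists_eval_eq_endFactor {δ l : ℕ} (C : ℕ → List Tok) (hb : earlyCount l C ≤ δ) :
    ∃ E : MvPolynomial (NodeVar δ) ℚ, ∀ α β : TangencySeq, δ ≤ β.size →
      endFactor δ (smallWeights δ) α β l C = MvPolynomial.eval (nodeVal δ α β) E := by
  refine ⟨Polynomial.aeval (MvPolynomial.X .size - MvPolynomial.C (earlyCount l C : ℚ))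
      (descPochhammer ℚ (δ - earlyCount l C)) * MvPolynomial.C ((C l).length ! : ℚ)⁻¹ *
    ((∏ i : Fin δ, Polynomial.aeval (MvPolynomial.X (.beta i))
        (descPochhammer ℚ (usedBeta l C (Nat.succPNat i)))) *
      ∏ i : Fin δ, (Polynomial.aeval (MvPolynomial.X (.alpha i))
        (descPochhammer ℚ (usedAlpha l C (Nat.succPNat i))) *
          MvPolynomial.C ((usedAlpha l C (Nat.succPNat i))! : ℚ)⁻¹)), fun α β hβ => ?_⟩
  simp only [map_mul, map_prod, MvPolynomial.eval_polynomial_aeval, MvPolynomial.eval_C,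
    MvPolynomial.eval_X, map_sub, nodeVal, endFactor, prod_smallWeights]
  rw [← Nat.cast_sub (hb.trans hβ), descPochhammer_eval_eq_descFactorial, div_eq_mul_inv]
  simp only [descPochhammer_eval_eq_descFactorial, Nat.cast_choose_eq_descPochhammer_div,
    div_eq_mul_inv]

theorem earlyCount_le_endCost (e : ℕ) (C : ℕ → List Tok) : earlyCount e C ≤ endCost e C := by
  rw [endCost]
  exact Nat.le_add_left _ _

theorem exists_eval_eq_sum (δ : ℕ) : ∃ R : MvPolynomial (NodeVar δ) ℚ,
    ∀ (α β : TangencySeq) (e : ℕ), e + 1 = α.weight + β.weight → δ ≤ β.size → δ ≤ e →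
      ∑ C ∈ endConfs e δ, confVal 0 e C * endFactor δ (smallWeights δ) α β e C =
        MvPolynomial.eval (nodeVal δ α β) R := by
  have h1 : ∀ l j, ∀ C ∈ blocks l l j, j ≤ δ → ∃ p : Polynomial ℚ, ∀ e, δ ≤ e →
      closedSum (δ - j) (e - l) * confVal (e - l) l C = p.eval (e : ℚ) := fun l j C hC hj =>
    polyFrom_block (τ := 0) (blockBound_zero hC le_rfl) hj (polyFrom_closedSum _)
  have h2 : ∀ l j, ∀ C ∈ blocks l l j, j ≤ δ → ∃ E : MvPolynomial (NodeVar δ) ℚ,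
      ∀ α β : TangencySeq, δ ≤ β.size →
        endFactor δ (smallWeights δ) α β l C = MvPolynomial.eval (nodeVal δ α β) E := by
    intro l j C hC hj
    refine exists_eval_eq_endFactor C ?_
    have := earlyCount_le_endCost l C
    have := (mem_blocks.1 hC).1.2
    omega
  choose! p hp using h1
  choose! E hE using h2
  -- The block sums are polynomials in `e`, which is the degree minus one.
  refine ⟨∑ l ∈ Finset.range (δ + 1), ∑ j ∈ Finset.range (δ + 1), ∑ C ∈ blocks l l j,
    Polynomial.aeval (MvPolynomial.X .degree - 1) (p l j C) * E l j C, fun α β e hd hβ he => ?_⟩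
  rw [sum_endConfs_endFactor he]
  simp only [map_sum, map_mul]
  refine Finset.sum_congr rfl fun l _ => Finset.sum_congr rfl fun j hj =>
    Finset.sum_congr rfl fun C hC => ?_
  have hj' := Nat.lt_succ_iff.1 (Finset.mem_range.1 hj)
  rw [hp l j C hC hj' e he, hE l j C hC hj' α β hβ, MvPolynomial.eval_polynomial_aeval, map_sub,
    map_one, MvPolynomial.eval_X, nodeVal, ← hd, Nat.cast_succ, add_sub_cancel_right]

namespace TangencySeq

theorem weight_single_one (N : ℕ) : weight (Finsupp.single 1 N) = N := by
  simp [weight]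

theorem size_le_weight (s : TangencySeq) : s.size ≤ s.weight :=
  Finset.sum_le_sum fun w _ => Nat.le_mul_of_pos_left _ w.pos

theorem eq_zero_of_weight_eq_zero {s : TangencySeq} (h : s.weight = 0) : s = 0 := by
  refine size_eq_zero_iff.1 ?_
  have := s.size_le_weight
  omega

theorem eq_single_of_weight_eq_size {s : TangencySeq} (h : s.weight = s.size) :
    s = Finsupp.single 1 s.size := by
  have h1 : ∀ w ∈ s.support, s w = (w : ℕ) * s w :=
    (Finset.sum_eq_sum_iff_of_le fun w _ => Nat.le_mul_of_pos_left _ w.pos).1 h.symm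
  have h2 : ∀ w, w ≠ 1 → s w = 0 := by
    intro w hw
    by_contra hs
    have h3 := h1 w (Finsupp.mem_support_iff.2 hs)
    have h4 : (w : ℕ) = 1 := Nat.eq_of_mul_eq_mul_right (Nat.pos_of_ne_zero hs) (by omega)
    exact hw (PNat.eq h4)
  have h5 : s = Finsupp.single 1 (s 1) := by
    ext w
    by_cases hw : w = 1
    · rw [hw, Finsupp.single_eq_same]
    · rw [h2 w hw, Finsupp.single_eq_of_ne hw]
  have h6 : s.size = s 1 := by
    conv_lhs => rw [h5]
    exact size_single 1 _
  rw [h6]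
  exact h5

theorem fact_ne_zero (s : TangencySeq) : s.fact ≠ 0 :=
  Finset.prod_ne_zero_iff.2 fun _ _ => Nat.factorial_ne_zero _

theorem powProd_ne_zero (s : TangencySeq) : s.powProd ≠ 0 :=
  Finset.prod_ne_zero_iff.2 fun w _ => pow_ne_zero _ w.ne_zero

theorem size_ofFin {m : ℕ} (a : Fin m → ℕ) : (ofFin a).size = ∑ i, a i := by
  rw [size, ofFin, ← Finsupp.sum_finsetSum_index (by simp) (by simp)]
  simp

theorem weight_ofFin {m : ℕ} (a : Fin m → ℕ) : (ofFin a).weight = ∑ i : Fin m, ((i : ℕ) + 1) * a i := by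
  rw [weight, ofFin, ← Finsupp.sum_finsetSum_index (by simp) (by intros; ring)]
  simp

theorem ofFin_succPNat {m : ℕ} (a : Fin m → ℕ) (k : ℕ) :
    ofFin a (Nat.succPNat k) = if h : k < m then a ⟨k, h⟩ else 0 := by
  rw [ofFin, Finsupp.finsetSum_apply]
  split_ifs with h
  · rw [Finset.sum_eq_single_of_mem ⟨k, h⟩ (Finset.mem_univ _), Finsupp.single_eq_same]
    intro i _ hi
    refine Finsupp.single_eq_of_ne fun hk => hi (Fin.ext ?_)
    exact (Nat.succPNat_injective hk).symm
  · refine Finset.sum_eq_zero fun i _ => Finsupp.single_eq_of_ne fun hk => h ?_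
    rw [Nat.succPNat_injective hk]
    exact i.2

end TangencySeq

theorem eval_toPoly {δ m n : ℕ} (a : Fin m → ℕ) (b : Fin n → ℕ) (x : NodeVar δ) :
    MvPolynomial.eval (Sum.elim (fun i => (a i : ℚ)) (fun i => (b i : ℚ))) (x.toPoly m n) =
      nodeVal δ (TangencySeq.ofFin a) (TangencySeq.ofFin b) x := by
  rcases x with _ | _ | i | i
  · simp [NodeVar.toPoly, nodeVal, TangencySeq.weight_ofFin]
  · simp [NodeVar.toPoly, nodeVal, TangencySeq.size_ofFin]
  · rw [NodeVar.toPoly, nodeVal, TangencySeq.ofFin_succPNat]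
    split_ifs <;> simp
  · rw [NodeVar.toPoly, nodeVal, TangencySeq.ofFin_succPNat]
    split_ifs <;> simp

theorem eval_aeval_toPoly {δ m n : ℕ} (a : Fin m → ℕ) (b : Fin n → ℕ)
    (R : MvPolynomial (NodeVar δ) ℚ) :
    MvPolynomial.eval (Sum.elim (fun i => (a i : ℚ)) (fun i => (b i : ℚ)))
        (MvPolynomial.aeval (NodeVar.toPoly m n) R) =
      MvPolynomial.eval (nodeVal δ (TangencySeq.ofFin a) (TangencySeq.ofFin b)) R := by
  induction R using MvPolynomial.induction_on with
  | C c => simp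
  | add p q hp hq => rw [map_add, map_add, hp, hq, map_add]
  | mul_X p x hp => rw [map_mul, map_mul, hp, map_mul, MvPolynomial.aeval_X, MvPolynomial.eval_X,
      eval_toPoly]

/-- The restriction of a polynomial to `α = 0` and `β = (N, 0, 0, …)`. -/
noncomputable def restrictNode (δ : ℕ) : NodeVar δ → Polynomial ℚ
  | .degree => Polynomial.X
  | .size => Polynomial.X
  | .alpha _ => 0
  | .beta i => if (i : ℕ) = 0 then Polynomial.X else 0

theorem eval_aeval_restrictNode {δ : ℕ} (R : MvPolynomial (NodeVar δ) ℚ) (N : ℕ) :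
    (MvPolynomial.aeval (restrictNode δ) R).eval (N : ℚ) =
      MvPolynomial.eval (nodeVal δ 0 (Finsupp.single 1 N)) R := by
  induction R using MvPolynomial.induction_on with
  | C c => simp
  | add p q hp hq => rw [map_add, Polynomial.eval_add, hp, hq, map_add]
  | mul_X p x hp =>
    rw [map_mul, Polynomial.eval_mul, hp, map_mul, MvPolynomial.aeval_X, MvPolynomial.eval_X]
    congr 1
    rcases x with _ | _ | i | i
    · simp [restrictNode, nodeVal, TangencySeq.weight]
    · simp [restrictNode, nodeVal, size_single]
    · simp [restrictNode, nodeVal]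
    · rw [restrictNode, nodeVal]
      split_ifs with h
      · rw [h, Polynomial.eval_X, show Nat.succPNat 0 = 1 from rfl, Finsupp.single_eq_same]
      · rw [Finsupp.single_eq_of_ne, Polynomial.eval_zero, Nat.cast_zero]
        intro h'
        exact h (Nat.succPNat_injective (h'.trans (show (1 : ℕ+) = Nat.succPNat 0 from rfl)))

/-- The polynomiality extends to the only case in which `d = δ`. -/
theorem sum_eq_eval_of_eq {δ : ℕ} (hδ : 1 ≤ δ) {R : MvPolynomial (NodeVar δ) ℚ}
    (hR : ∀ (α β : TangencySeq) (e : ℕ), e + 1 = α.weight + β.weight → δ ≤ β.size → δ ≤ e →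
      ∑ C ∈ endConfs e δ, confVal 0 e C * endFactor δ (smallWeights δ) α β e C =
        MvPolynomial.eval (nodeVal δ α β) R) {e : ℕ} (he : e + 1 = δ) :
    ∑ C ∈ endConfs e δ, confVal 0 e C *
        endFactor δ (smallWeights δ) 0 (Finsupp.single 1 (e + 1)) e C =
      MvPolynomial.eval (nodeVal δ 0 (Finsupp.single 1 (e + 1))) R := by
  have hw : (0 : TangencySeq).weight = 0 := by simp [TangencySeq.weight]
  -- Both pieces are polynomial from `e + 1 = δ` on, one step earlier than the range in which `hR`
  -- applies.
  obtain ⟨p, hp⟩ := polyFrom_closedSum δ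
  obtain ⟨q, hq⟩ := (polyFrom_heavySum δ hδ).comp_sub (M := δ) (l := 1) (by omega)
  let Q : Polynomial ℚ := descPochhammer ℚ δ * (p - q)
  have hQ : ∀ e, δ ≤ e + 1 → ∑ C ∈ endConfs e δ, confVal 0 e C *
      endFactor δ (smallWeights δ) 0 (Finsupp.single 1 (e + 1)) e C = Q.eval ((e + 1 : ℕ) : ℚ) := by
    intro e he
    have h1 := hq (e + 1) he
    simp only [Nat.add_sub_cancel] at h1
    rw [sum_endConfs_endFactor_single hδ he _ fun w => mem_smallWeights, hp _ he, h1,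
      Polynomial.eval_mul, Polynomial.eval_sub, descPochhammer_eval_eq_descFactorial]
  -- At the arguments `δ + k + 1` both polynomials compute the same sum; infinitely many agreements
  -- identify them, including at `δ`.
  have hinf : {x : ℚ | Q.eval x = (MvPolynomial.aeval (restrictNode δ) R).eval x}.Infinite := by
    refine Set.infinite_of_injective_forall_mem (f := fun k : ℕ => ((δ + k + 1 : ℕ) : ℚ)) ?_ ?_
    · intro x y hxy
      have := Nat.cast_injective hxy
      omega
    · intro k
      rw [Set.mem_ofPred_eq, ← hQ _ (by omega), eval_aeval_restrictNode]
      refine hR 0 _ _ ?_ ?_ (by omega)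
      · rw [hw, zero_add, TangencySeq.weight_single_one]
      · rw [size_single]
        omega
  rw [hQ e he.ge, Polynomial.eq_of_infinite_eval_eq _ _ hinf, eval_aeval_restrictNode]

theorem relativeSeveriDegree_eq_eval {δ : ℕ} (hδ : 1 ≤ δ) : ∃ R : MvPolynomial (NodeVar δ) ℚ,
    ∀ α β : TangencySeq, δ ≤ β.size → (relativeSeveriDegree δ α β : ℚ) =
      β.powProd * ((β.size - δ)! : ℕ) / β.fact * MvPolynomial.eval (nodeVal δ α β) R := by
  obtain ⟨R, hR⟩ := exists_eval_eq_sum δ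
  refine ⟨R, fun α β hβ => ?_⟩
  have hs := β.size_le_weight
  obtain ⟨e, he⟩ : ∃ e, e + 1 = α.weight + β.weight := ⟨α.weight + β.weight - 1, by omega⟩
  rw [relativeSeveriDegree_eq_sum_endConfs α β he hβ (smallWeights δ) fun w => mem_smallWeights]
  congr 1
  by_cases hδe : δ ≤ e
  · exact hR α β e he hβ hδe
  -- Here `e + 1 ≤ δ ≤ |β| ≤ β.weight ≤ e + 1`, so equality holds throughout: `α` vanishes and every
  -- entry of `β` sits in weight one.
  · obtain rfl : α = 0 := TangencySeq.eq_zero_of_weight_eq_zero (by omega)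
    have h1 := TangencySeq.eq_single_of_weight_eq_size (s := β) (by omega)
    rw [show β.size = e + 1 by omega] at h1
    rw [h1]
    exact sum_eq_eval_of_eq hδ hR (by omega)

/-! ### Uniqueness and conclusion. -/

/-- The prefactor never vanishes, so two node polynomials agree wherever `|β| ≥ δ`. As there is at
least one `β`-variable, this includes the grid of all points with integer coordinates at least `δ`,
which determines a polynomial. -/
theorem IsRelativeNodePolynomial.unique {δ m n : ℕ} (hn : 1 ≤ n)
    {P Q : MvPolynomial (Fin m ⊕ Fin n) ℚ} (hP : IsRelativeNodePolynomial δ m n P)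
    (hQ : IsRelativeNodePolynomial δ m n Q) : P = Q := by
  refine MvPolynomial.funext_set (fun _ => (fun k : ℕ => ((δ + k : ℕ) : ℚ)) '' Set.univ)
    (fun _ => Set.infinite_univ.image fun x _ y _ hxy => ?_) fun x hx => ?_
  · have := Nat.cast_injective hxy
    omega
  · choose k hk using fun i => hx i (Set.mem_univ i)
    have hx' : x = Sum.elim (fun i => ((δ + k (.inl i) : ℕ) : ℚ)) (fun i => ((δ + k (.inr i) : ℕ) : ℚ)) := by
      ext i
      rcases i with i | i
      · exact (hk (.inl i)).2.symm
      · exact (hk (.inr i)).2.symm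
    have hsize : δ ≤ (TangencySeq.ofFin fun i => δ + k (.inr i)).size := by
      rw [TangencySeq.size_ofFin]
      exact (Nat.le_add_right δ (k (.inr ⟨0, hn⟩))).trans
        (Finset.single_le_sum (f := fun i : Fin n => δ + k (.inr i)) (fun _ _ => Nat.zero_le _)
          (Finset.mem_univ (⟨0, hn⟩ : Fin n)))
    have h := (hP (fun i => δ + k (.inl i)) (fun i => δ + k (.inr i)) hsize).symm.trans
      (hQ (fun i => δ + k (.inl i)) (fun i => δ + k (.inr i)) hsize)
    rw [hx']
    refine mul_left_cancel₀ ?_ h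
    refine div_ne_zero (mul_ne_zero ?_ ?_) ?_
    · exact Nat.cast_ne_zero.2 (TangencySeq.powProd_ne_zero _)
    · exact Nat.cast_ne_zero.2 (Nat.factorial_ne_zero _)
    · exact Nat.cast_ne_zero.2 (TangencySeq.fact_ne_zero _)

theorem proposition1p3 (δ : ℕ) (hδ : 1 ≤ δ) :
    ∃ R : MvPolynomial (NodeVar δ) ℚ, ∀ m n : ℕ, 1 ≤ n →
      IsRelativeNodePolynomial δ m n (MvPolynomial.aeval (NodeVar.toPoly m n) R) ∧
      ∀ P : MvPolynomial (Fin m ⊕ Fin n) ℚ, IsRelativeNodePolynomial δ m n P →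
        P = MvPolynomial.aeval (NodeVar.toPoly m n) R := by
  obtain ⟨R, hR⟩ := relativeSeveriDegree_eq_eval hδ
  refine ⟨R, fun m n hn => ?_⟩
  have h : IsRelativeNodePolynomial δ m n (MvPolynomial.aeval (NodeVar.toPoly m n) R) := by
    intro a b hb
    rw [eval_aeval_toPoly, hR _ _ hb]
  exact ⟨h, fun P hP => hP.unique hn h⟩
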